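/- A graph here is finite, simple, undirected and connected. A graph is hamiltonian if it contains a cycle through all of its vertices; it is hypohamiltonian if it is not hamiltonian but, for every vertex $v$, the graph $G-v$ obtained by deleting $v$ is hamiltonian. It is cubic if every vertex has degree $3$, planar if it can be drawn in the plane without edge crossings, and its girth is the length of a shortest cycle. **Theorem.** There are infinitely many pairwise non-isomorphic planar cubic hypohamiltonian graphs of girth $5$. More specifically, for every integer $k \ge 2$ and every $a \in \{2,4\}$ there exists a planar cubic hypohamiltonian graph of girth $5$ with exactly $74k+a$ vertices. -/

import Mathlib

/-- `A` is an arc in the plane with end points `p` and `q`: the image of an injective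
continuous map `[0, 1] → ℝ²` that sends `0` to `p` and `1` to `q`. Only the topology of the
plane matters, so the plane is `ℝ × ℝ`. -/
def IsPlaneArc (p q : ℝ × ℝ) (A : Set (ℝ × ℝ)) : Prop :=
  ∃ γ : Path p q, Function.Injective γ ∧ Set.range γ = A

/-- A drawing of the graph `G` in the plane without crossings: `point v` is the point that
represents the vertex `v` and `arc e` is the arc that represents the edge `e`. -/
structure IsPlaneDrawing {V : Type*} (G : SimpleGraph V)
    (point : V → ℝ × ℝ) (arc : Sym2 V → Set (ℝ × ℝ)) : Prop where
  /-- Distinct vertices are distinct points. -/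
  point_injective : Function.Injective point
  /-- Every edge is an arc between its end vertices. -/
  isPlaneArc : ∀ u v : V, G.Adj u v → IsPlaneArc (point u) (point v) (arc s(u, v))
  /-- An edge contains no vertex other than its end vertices. -/
  mem_of_point_mem : ∀ e ∈ G.edgeSet, ∀ w : V, point w ∈ arc e → w ∈ e
  /-- Two distinct edges meet only in end vertices that they share. -/
  inter_subset : ∀ e ∈ G.edgeSet, ∀ f ∈ G.edgeSet, e ≠ f →
    arc e ∩ arc f ⊆ point '' {v | v ∈ e ∧ v ∈ f}

/-- A graph is planar if it can be drawn in the plane without crossings. -/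
def IsPlanar {V : Type*} (G : SimpleGraph V) : Prop :=
  ∃ (point : V → ℝ × ℝ) (arc : Sym2 V → Set (ℝ × ℝ)), IsPlaneDrawing G point arc

/-- A graph is cubic if each of its vertices has exactly three neighbours. -/
def IsCubic {V : Type*} (G : SimpleGraph V) : Prop :=
  ∀ v : V, (G.neighborSet v).ncard = 3

open Classical in
/-- A graph `G` is hypohamiltonian if it is not hamiltonian, but for every vertex `v` the
vertex-deleted subgraph `G - v` is hamiltonian. -/
def IsHypohamiltonian {V : Type*} [Fintype V] (G : SimpleGraph V) : Prop :=
  ¬ G.IsHamiltonian ∧ ∀ v : V, (G.induce {w : V | w ≠ v}).IsHamiltonian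

/-- The finite connected planar cubic hypohamiltonian graphs of girth 5. -/
structure IsPlanarCubicHypohamiltonianOfGirthFive {V : Type*} [Fintype V]
    (G : SimpleGraph V) : Prop where
  connected : G.Connected
  planar : IsPlanar G
  cubic : IsCubic G
  hypohamiltonian : IsHypohamiltonian G
  girth_eq : G.girth = 5

/-!
Poles and links carry the whole construction. A pole (`IsPole`) is obtained from a hypohamiltonian
cubic graph by removing two independent edges; its four terminals are the ends of these edges. A
link (`IsLink`) is obtained from such a graph by removing two adjacent vertices, which leaves four
terminals on the left, and two independent edges, which leaves four terminals on the right. To join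
a pole to a link by four edges is the dot product of cubic graphs. The result, with the
terminals on the right, is a pole again. Its closure has no Hamiltonian cycle
(`not_hasSpanningCycle_glue`), since such a cycle would pass either through the pole as through the
removed edge of the other graph or through the link as through the removed edges of the pole. A
vertex-deleted subgraph has one, because pole and link have enough spanning systems of paths
(`IsPole.glue`). Planarity is kept: a pole is drawn with straight edges to the left of a vertical
line with its terminals on the line, a link in a vertical strip with its terminals on both borders,
and the four connecting segments do not cross (`IsStraightDrawing.glue`). Neither cycles of length 3
or 4 nor vertices of another degree arise. Thus a link with 74 vertices and a base pole with `n`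
vertices give graphs with `74 * k + n` vertices (`IsGoodPole.exists_card`).

The link with 74 vertices is cut out of a graph with 76 vertices (`goodLink76`), and this graph also
serves as the base for `74 * k + 2`. The base for `74 * k + 4` has 152 vertices (`goodPole152`). It
consists of two poles with 76 vertices each that are joined by four edges.

That a given cubic plane graph has no Hamiltonian cycle is proved with faces. A Hamiltonian cycle
splits the faces into two sides. Both sides are connected, the three faces at a vertex are never
on the same side, and Grinberg's equation holds (`FaceSystem.exists_isSidedness`). The
combinatorial faces used here need not come from a drawing: Euler's formula and connectedness
suffice, because the edges off the cycle are too few to connect all faces. A backtracking search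
over the faces, in which Grinberg's equation is used modulo 3 only, finds that no such splitting
exists (`Refutation.Fits.not_isHamiltonian`). For the graph with 152 vertices this search would be
too long. A Hamiltonian cycle of it induces a spanning path or a spanning pair of paths in each of
the two halves, and every possible combination of these is excluded by a search in a smaller
graph: the left half plus the two edges removed from the graph with 76 vertices, or one of the
halves plus two vertices, with the condition that the cycle avoids certain edges at these vertices
(`not_hasSpanningCycle_glue_of_not_spans`, `not_hasSpanningCycle152`).

The Hamiltonian cycles of vertex-deleted subgraphs and the drawings are given explicitly and
checked.
-/

/-! ### Spanning systems of paths -/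

section Spanning

variable {V W : Type*}

/-- The list `l` runs along a path of `G` from `u` to `v`. -/
structure IsListPath (G : SimpleGraph V) (l : List V) (u v : V) : Prop where
  chain : l.IsChain G.Adj
  head : l.head? = some u
  last : l.getLast? = some v

/-- The graph `G` has a system of vertex-disjoint paths, one for each pair in `ps` and running
from the first to the second entry of the pair, whose vertices are exactly those in `S`.
With `u = v` a pair `(u, v)` stands for a path with a single vertex. -/
def Spans (G : SimpleGraph V) (S : Set V) (ps : List (V × V)) : Prop :=
  ∃ ls : List (List V), List.Forall₂ (fun l p => IsListPath G l p.1 p.2) ls ps ∧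
    ls.flatten.Nodup ∧ ∀ w, w ∈ ls.flatten ↔ w ∈ S

namespace IsListPath

variable {G : SimpleGraph V} {l m : List V} {u v p q : V}

theorem reverse (h : IsListPath G l u v) : IsListPath G l.reverse v u where
  chain := by
    rw [List.isChain_reverse]
    exact h.chain.imp fun _ _ => SimpleGraph.Adj.symm
  head := by rw [List.head?_reverse, h.last]
  last := by rw [List.getLast?_reverse, h.head]

theorem append (h : IsListPath G l u v) (h' : IsListPath G m p q) (hvp : G.Adj v p) :
    IsListPath G (l ++ m) u q where
  chain := by
    refine List.isChain_append.2 ⟨h.chain, h'.chain, ?_⟩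
    rw [h.last, h'.head]
    rintro _ ⟨⟩ _ ⟨⟩
    exact hvp
  head := by simp [List.head?_append, h.head]
  last := by simp [List.getLast?_append, h'.last]

theorem map {H : SimpleGraph W} (h : IsListPath G l u v) (f : V → W)
    (hf : ∀ x y, G.Adj x y → H.Adj (f x) (f y)) : IsListPath H (l.map f) (f u) (f v) where
  chain := List.isChain_map_of_isChain f (fun _ _ => hf _ _) h.chain
  head := by simp [h.head]
  last := by simp [h.last]

theorem ne_nil (h : IsListPath G l u v) : l ≠ [] := by
  rintro rfl
  simpa using h.head

theorem mem_left (h : IsListPath G l u v) : u ∈ l := List.mem_of_mem_head? h.head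

theorem mem_right (h : IsListPath G l u v) : v ∈ l := List.mem_of_mem_getLast? h.last

end IsListPath

namespace Spans

variable {G : SimpleGraph V} {S : Set V} {ps qs : List (V × V)} {u v p q : V}

theorem mono {H : SimpleGraph V} (hGH : G ≤ H) (h : Spans G S ps) : Spans H S ps := by
  obtain ⟨ls, hls, hn, hS⟩ := h
  exact ⟨ls, hls.imp fun l p hl => ⟨hl.chain.imp fun _ _ => @hGH _ _, hl.head, hl.last⟩, hn, hS⟩

theorem reverse_head (h : Spans G S ((u, v) :: ps)) : Spans G S ((v, u) :: ps) := by
  obtain ⟨ls, hls, hn, hS⟩ := h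
  cases hls with
  | cons hl hls =>
    rename_i l ls
    have hp : ((l.reverse :: ls).flatten).Perm (l :: ls).flatten := by
      simpa using (List.reverse_perm l).append_right _
    exact ⟨l.reverse :: ls, .cons hl.reverse hls, hp.nodup_iff.2 hn,
      fun w => hp.mem_iff.trans (hS w)⟩

theorem perm (h : Spans G S ps) (hp : ps.Perm qs) : Spans G S qs := by
  obtain ⟨ls, hls, hn, hS⟩ := h
  obtain ⟨ms, hms, hp'⟩ := (List.perm_comp_forall₂ hp.symm (List.Forall₂.flip hls))
  exact ⟨ms, hms.flip, hp'.flatten.nodup_iff.2 hn, fun w => hp'.flatten.mem_iff.trans (hS w)⟩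

theorem join (h : Spans G S ((u, v) :: (p, q) :: ps)) (hvp : G.Adj v p) :
    Spans G S ((u, q) :: ps) := by
  obtain ⟨ls, hls, hn, hS⟩ := h
  cases hls with
  | cons hl hls =>
    cases hls with
    | cons hm hls =>
      rename_i l m ls
      exact ⟨(l ++ m) :: ls, .cons (hl.append hm hvp) hls, by simpa using hn, by simpa using hS⟩

end Spans

/-- A spanning path whose ends are joined by an edge is a Hamiltonian cycle. -/
def HasSpanningCycle (G : SimpleGraph V) (S : Set V) : Prop :=
  ∃ u v, G.Adj v u ∧ Spans G S [(u, v)]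

theorem HasSpanningCycle.of_isHamiltonian [Fintype V] [DecidableEq V] {G : SimpleGraph V}
    (hG : G.IsHamiltonian) (hV : Fintype.card V ≠ 1) : HasSpanningCycle G Set.univ := by
  obtain ⟨a, p, hp⟩ := hG hV
  have hnil := hp.isCycle.not_nil
  refine ⟨p.snd, a, p.adj_snd hnil, [p.tail.support], ?_, ?_, ?_⟩
  · refine .cons ⟨p.tail.isChain_adj_support, ?_, ?_⟩ .nil
    · rw [List.head?_eq_some_head p.tail.support_ne_nil, p.tail.head_support]
    · rw [List.getLast?_eq_some_getLast p.tail.support_ne_nil, p.tail.getLast_support]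
  · simpa using hp.isHamiltonian_tail.isPath.support_nodup
  · intro w
    simpa using hp.isHamiltonian_tail.mem_support w

theorem HasSpanningCycle.isHamiltonian_induce {G : SimpleGraph V} {S : Set V} [Fintype S]
    [DecidableEq S] (h : HasSpanningCycle G S) (hS : 3 ≤ Fintype.card S) :
    (G.induce S).IsHamiltonian := by
  intro _
  obtain ⟨u, v, hvu, ls, hls, hn, hmem⟩ := h
  obtain ⟨l, hl, rfl⟩ : ∃ l, IsListPath G l u v ∧ ls = [l] := by
    cases hls with
    | cons hl hls => cases hls; exact ⟨_, hl, rfl⟩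
  simp only [List.flatten_cons, List.flatten_nil, List.append_nil] at hn hmem
  have hlS : ∀ w ∈ l, w ∈ S := fun w hw => (hmem w).1 hw
  let l' : List S := l.attachWith (· ∈ S) hlS
  have hl' : l'.map Subtype.val = l := by simp [l']
  have hne : l' ≠ [] := by
    intro h0
    rw [h0] at hl'
    exact hl.ne_nil hl'.symm
  have hchain : l'.IsChain (G.induce S).Adj := by
    have := hl.chain
    rw [← hl', List.isChain_map] at this
    exact this
  have hn' : l'.Nodup := List.Nodup.of_map _ (hl'.symm ▸ hn)
  let p := SimpleGraph.Walk.ofSupport l' hne hchain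
  have hps : p.support = l' := SimpleGraph.Walk.support_ofSupport hne hchain
  have hhead : (l'.head hne : V) = u := by
    have h1 := hl.head
    rw [← hl', List.head?_map, List.head?_eq_some_head hne] at h1
    simpa using h1
  have hlast : (l'.getLast hne : V) = v := by
    have h1 := hl.last
    rw [← hl', List.getLast?_map, List.getLast?_eq_some_getLast hne] at h1
    simpa using h1
  have hadj : (G.induce S).Adj (l'.getLast hne) (l'.head hne) := by
    rw [SimpleGraph.induce_adj, hhead, hlast]
    exact hvu
  have hp : p.IsPath := SimpleGraph.Walk.IsPath.mk' (hps.symm ▸ hn')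
  have hham : p.IsHamiltonian := hp.isHamiltonian_of_mem fun w => by
    rw [hps]
    have := (hmem w).2 w.2
    rw [← hl', List.mem_map] at this
    obtain ⟨x, hx, hxw⟩ := this
    rwa [← Subtype.ext hxw]
  refine ⟨l'.getLast hne, .cons hadj p, ?_⟩
  refine ⟨(SimpleGraph.Walk.cons_isCycle_iff _ _).2 ⟨hp, fun he => ?_⟩,
    by simpa [SimpleGraph.Walk.IsHamiltonian] using hham⟩
  -- If the closing edge were an edge of the path, then the path would have length one.
  have h1 := hp.length_eq_one_of_mem_edges (by rwa [Sym2.eq_swap])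
  have h2 := hham.length_eq
  omega

end Spanning


/-! ### Gluing two graphs along four edges -/

section Glue

variable {V W : Type*}

/-- The disjoint union of `K` and `L` together with the edges from `t i` to `t' i`. -/
def glue (K : SimpleGraph V) (L : SimpleGraph W) (t : Fin 4 → V) (t' : Fin 4 → W) :
    SimpleGraph (V ⊕ W) where
  Adj
    | .inl u, .inl v => K.Adj u v
    | .inr u, .inr v => L.Adj u v
    | .inl u, .inr v => ∃ i, t i = u ∧ t' i = v
    | .inr u, .inl v => ∃ i, t i = v ∧ t' i = u
  symm := ⟨by
    rintro (u | u) (v | v) h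
    exacts [K.symm.symm _ _ h, h, h, L.symm.symm _ _ h]⟩
  loopless := ⟨by
    rintro (u | u) h
    exacts [K.loopless.irrefl u h, L.loopless.irrefl u h]⟩

section

variable {K : SimpleGraph V} {L : SimpleGraph W} {t : Fin 4 → V} {t' : Fin 4 → W}

@[simp] theorem glue_adj_inl_inl {u v : V} :
    (glue K L t t').Adj (.inl u) (.inl v) ↔ K.Adj u v := Iff.rfl

@[simp] theorem glue_adj_inr_inr {u v : W} :
    (glue K L t t').Adj (.inr u) (.inr v) ↔ L.Adj u v := Iff.rfl

@[simp] theorem glue_adj_inl_inr {u : V} {v : W} :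
    (glue K L t t').Adj (.inl u) (.inr v) ↔ ∃ i, t i = u ∧ t' i = v := Iff.rfl

@[simp] theorem glue_adj_inr_inl {u : V} {v : W} :
    (glue K L t t').Adj (.inr v) (.inl u) ↔ ∃ i, t i = u ∧ t' i = v := Iff.rfl

end

/-- The list `l` runs around a cycle of `G`, the last vertex being adjacent to the first.
Two adjacent vertices count as a cycle. -/
def IsListCycle (G : SimpleGraph V) (l : List V) : Prop :=
  ∃ u v, IsListPath G l u v ∧ G.Adj v u

theorem IsListPath.of_append {G : SimpleGraph V} {l m : List V} {u v : V}
    (h : IsListPath G (l ++ m) u v) (hl : l ≠ []) (hm : m ≠ []) :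
    ∃ p q, IsListPath G l u p ∧ G.Adj p q ∧ IsListPath G m q v := by
  obtain ⟨hc, hh, hla⟩ := h
  obtain ⟨h1, h2, h3⟩ := List.isChain_append.1 hc
  refine ⟨l.getLast hl, m.head hm, ⟨h1, ?_, List.getLast?_eq_some_getLast hl⟩, ?_,
    ⟨h2, List.head?_eq_some_head hm, ?_⟩⟩
  · rw [← hh, List.head?_append_of_ne_nil _ hl]
  · exact h3 _ (List.getLast?_eq_some_getLast hl) _ (List.head?_eq_some_head hm)
  · rw [← hla, List.getLast?_append_of_ne_nil _ hm]

theorem IsListCycle.rotate {G : SimpleGraph V} {l m : List V}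
    (h : IsListCycle G (l ++ m)) (hl : l ≠ []) (hm : m ≠ []) : IsListCycle G (m ++ l) := by
  obtain ⟨u, v, h, hvu⟩ := h
  obtain ⟨p, q, h1, hpq, h2⟩ := h.of_append hl hm
  exact ⟨q, p, h2.append h1 hvu, hpq⟩

theorem IsListPath.eq_of_nodup {G : SimpleGraph V} {l : List V} {u x : V}
    (h : IsListPath G l u u) (hn : l.Nodup) (hx : x ∈ l) : x = u := by
  obtain ⟨_, h1, h2⟩ := h
  match l, h1, h2, hn, hx with
  | [y], h1, _, _, hx => simp_all
  | y :: z :: l, h1, h2, hn, hx =>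
    exfalso
    simp only [List.head?_cons, Option.some.injEq] at h1
    subst h1
    rw [List.getLast?_cons_cons] at h2
    exact (List.nodup_cons.1 hn).1 (List.mem_of_mem_getLast? h2)

/-- The longest initial segment of a list that stays in the left summand. -/
theorem List.exists_eq_map_inl_append (l : List (V ⊕ W)) :
    ∃ (v : List V) (m : List (V ⊕ W)), l = v.map .inl ++ m ∧
      (m = [] ∨ ∃ w, m.head? = some (.inr w)) := by
  induction l with
  | nil => exact ⟨[], [], rfl, .inl rfl⟩
  | cons x l ih =>
    obtain ⟨v, m, rfl, hm⟩ := ih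
    cases x with
    | inl x => exact ⟨x :: v, m, rfl, hm⟩
    | inr x => exact ⟨[], _, rfl, .inr ⟨x, rfl⟩⟩

/-- The longest initial segment of a list that stays in the right summand. -/
theorem List.exists_eq_map_inr_append (l : List (V ⊕ W)) :
    ∃ (w : List W) (m : List (V ⊕ W)), l = w.map .inr ++ m ∧
      (m = [] ∨ ∃ v, m.head? = some (.inl v)) := by
  induction l with
  | nil => exact ⟨[], [], rfl, .inl rfl⟩
  | cons x l ih =>
    obtain ⟨v, m, rfl, hm⟩ := ih
    cases x with
    | inr x => exact ⟨x :: v, m, rfl, hm⟩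
    | inl x => exact ⟨[], _, rfl, .inr ⟨x, rfl⟩⟩

variable {K : SimpleGraph V} {L : SimpleGraph W} {t : Fin 4 → V} {t' : Fin 4 → W}

/-- A cycle through both sides of a glued graph can be started at the left end of an edge between
the two sides, so that it returns to its start from the right. -/
theorem IsListCycle.exists_perm_inl_inr {l : List (V ⊕ W)} (h : IsListCycle (glue K L t t') l)
    {v : V} {w : W} (hv : .inl v ∈ l) (hw : .inr w ∈ l) :
    ∃ m, m.Perm l ∧ ∃ u z, IsListPath (glue K L t t') m (.inl u) (.inr z) ∧
      (glue K L t t').Adj (.inr z) (.inl u) := by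
  -- A cycle that starts on the right is rotated to its first vertex on the left.
  have key : ∀ l : List (V ⊕ W), IsListCycle (glue K L t t') l → .inl v ∈ l →
      (∃ z, l.head? = some (.inr z)) → ∃ m, m.Perm l ∧ ∃ u z,
      IsListPath (glue K L t t') m (.inl u) (.inr z) ∧
        (glue K L t t').Adj (.inr z) (.inl u) := by
    intro l h hv hz
    obtain ⟨x, y, rfl, hy⟩ := l.exists_eq_map_inr_append
    have hy0 : y ≠ [] := by
      rintro rfl
      simp at hv
    have hx0 : x ≠ [] := by
      rintro rfl
      simp only [List.map_nil, List.nil_append] at hz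
      obtain ⟨z, hz⟩ := hz
      rcases hy with hy | ⟨_, hy⟩
      · exact hy0 hy
      · simp [hy] at hz
    have hx1 : x.map (Sum.inr (α := V)) ≠ [] := by simpa using hx0
    obtain ⟨u, z, hp, ha⟩ := h.rotate hx1 hy0
    refine ⟨_, List.perm_append_comm, ?_⟩
    obtain ⟨u', hu'⟩ : ∃ v, y.head? = some (.inl v) := hy.resolve_left hy0
    have h1 := hp.head
    rw [List.head?_append_of_ne_nil _ hy0, hu'] at h1
    have h2 := hp.last
    rw [List.getLast?_append_of_ne_nil _ hx1, List.getLast?_map,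
      List.getLast?_eq_some_getLast hx0] at h2
    simp only [Option.some.injEq, Option.map_some] at h1 h2
    subst h1 h2
    exact ⟨_, _, hp, ha⟩
  obtain ⟨u, z, hp, ha⟩ := id h
  rcases u with u | u
  · rcases z with z | z
    · obtain ⟨x, y, rfl, hy⟩ := l.exists_eq_map_inl_append
      have hy0 : y ≠ [] := by
        rintro rfl
        simp at hw
      have hx1 : x.map (Sum.inl (β := W)) ≠ [] := by
        intro h0
        obtain ⟨w, hw⟩ := hy.resolve_left hy0
        have := hp.head
        rw [h0, List.nil_append, hw] at this
        simp at this
      obtain ⟨w, hw⟩ := hy.resolve_left hy0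
      obtain ⟨m, hm, hr⟩ := key (y ++ x.map .inl) (h.rotate hx1 hy0)
        (List.perm_append_comm.mem_iff.1 hv)
        ⟨w, by rw [List.head?_append_of_ne_nil _ hy0, hw]⟩
      exact ⟨m, hm.trans List.perm_append_comm, hr⟩
    · exact ⟨l, .refl _, u, z, hp, ha⟩
  · exact key l h hv ⟨u, hp.head⟩

/-- The first two blocks of a path that starts on the left and ends on the right. -/
theorem IsListPath.exists_blocks {l : List (V ⊕ W)} {u : V} {z : W}
    (h : IsListPath (glue K L t t') l (.inl u) (.inr z)) :
    ∃ (x : List V) (y : List W) (j : Fin 4), IsListPath K x u (t j) ∧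
      ((l = x.map .inl ++ y.map .inr ∧ IsListPath L y (t' j) z) ∨
      ∃ (m : List (V ⊕ W)) (k : Fin 4), l = x.map .inl ++ (y.map .inr ++ m) ∧
        IsListPath L y (t' j) (t' k) ∧ IsListPath (glue K L t t') m (.inl (t k)) (.inr z)) := by
  have hK : ∀ {x : List V} {a b : V ⊕ W}, IsListPath (glue K L t t') (x.map .inl) a b →
      ∃ a' b', a = .inl a' ∧ b = .inl b' ∧ IsListPath K x a' b' := by
    intro x a b hx
    have hx0 : x ≠ [] := by
      rintro rfl
      exact hx.ne_nil rfl
    refine ⟨x.head hx0, x.getLast hx0, ?_, ?_, (List.isChain_map (Sum.inl (β := W))).1 hx.chain,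
      List.head?_eq_some_head hx0, List.getLast?_eq_some_getLast hx0⟩
    · have := hx.head
      rw [List.head?_map, List.head?_eq_some_head hx0] at this
      simpa using this.symm
    · have := hx.last
      rw [List.getLast?_map, List.getLast?_eq_some_getLast hx0] at this
      simpa using this.symm
  have hL : ∀ {x : List W} {a b : V ⊕ W}, IsListPath (glue K L t t') (x.map .inr) a b →
      ∃ a' b', a = .inr a' ∧ b = .inr b' ∧ IsListPath L x a' b' := by
    intro x a b hx
    have hx0 : x ≠ [] := by
      rintro rfl
      exact hx.ne_nil rfl
    refine ⟨x.head hx0, x.getLast hx0, ?_, ?_, (List.isChain_map (Sum.inr (α := V))).1 hx.chain,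
      List.head?_eq_some_head hx0, List.getLast?_eq_some_getLast hx0⟩
    · have := hx.head
      rw [List.head?_map, List.head?_eq_some_head hx0] at this
      simpa using this.symm
    · have := hx.last
      rw [List.getLast?_map, List.getLast?_eq_some_getLast hx0] at this
      simpa using this.symm
  obtain ⟨x, m, rfl, hm⟩ := l.exists_eq_map_inl_append
  have hm0 : m ≠ [] := by
    rintro rfl
    rw [List.append_nil] at h
    obtain ⟨_, _, _, h2, _⟩ := hK h
    simp at h2
  have hx0 : x.map (Sum.inl (β := W)) ≠ [] := by
    intro h0
    obtain ⟨w, hw⟩ := hm.resolve_left hm0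
    have := h.head
    rw [h0, List.nil_append, hw] at this
    simp at this
  obtain ⟨p, q, h1, hpq, h2⟩ := h.of_append hx0 hm0
  obtain ⟨u', p', hu, rfl, h1⟩ := hK h1
  obtain rfl := Sum.inl_injective hu
  obtain ⟨q', rfl⟩ : ∃ q', q = .inr q' := by
    obtain ⟨w, hw⟩ := hm.resolve_left hm0
    have := h2.head
    rw [hw] at this
    exact ⟨w, by simpa using this.symm⟩
  obtain ⟨j, rfl, rfl⟩ := hpq
  obtain ⟨y, r, rfl, hr⟩ := m.exists_eq_map_inr_append
  refine ⟨x, y, j, h1, ?_⟩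
  by_cases hr0 : r = []
  · subst hr0
    left
    rw [List.append_nil] at h2 ⊢
    obtain ⟨_, _, ha, hb, h2⟩ := hL h2
    obtain rfl := Sum.inr_injective ha
    obtain rfl := Sum.inr_injective hb
    exact ⟨rfl, h2⟩
  · right
    obtain ⟨v, hv⟩ := hr.resolve_left hr0
    have hy0 : y.map (Sum.inr (α := V)) ≠ [] := by
      intro h0
      have := h2.head
      rw [h0, List.nil_append, hv] at this
      simp at this
    obtain ⟨p, q, h3, hpq, h4⟩ := h2.of_append hy0 hr0
    obtain ⟨_, p', ha, rfl, h3⟩ := hL h3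
    obtain rfl := Sum.inr_injective ha
    have hq := h4.head
    rw [hv] at hq
    obtain rfl : Sum.inl v = q := by simpa using hq
    obtain ⟨k, rfl, rfl⟩ := hpq
    exact ⟨r, k, rfl, h3, h4⟩

/-- A Hamiltonian cycle of a glued graph uses two or all four of the connecting edges, and
induces on either side a spanning path or a spanning pair of paths. -/
theorem HasSpanningCycle.of_glue (ht : t.Injective) (ht' : t'.Injective)
    (h : HasSpanningCycle (glue K L t t') Set.univ) :
    (∃ i j, i ≠ j ∧ Spans K Set.univ [(t i, t j)] ∧ Spans L Set.univ [(t' j, t' i)]) ∨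
    ∃ i j k l, [i, j, k, l].Nodup ∧ Spans K Set.univ [(t i, t j), (t k, t l)] ∧
      Spans L Set.univ [(t' j, t' k), (t' l, t' i)] := by
  obtain ⟨u, v, hvu, ls, hls, hn, hmem⟩ := h
  obtain ⟨l, hl, rfl⟩ : ∃ l, IsListPath (glue K L t t') l u v ∧ ls = [l] := by
    cases hls with
    | cons hl hls => cases hls; exact ⟨_, hl, rfl⟩
  simp only [List.flatten_cons, List.flatten_nil, List.append_nil, Set.mem_univ, iff_true]
    at hn hmem
  obtain ⟨m, hm, u, z, hp, i, rfl, rfl⟩ :=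
    IsListCycle.exists_perm_inl_inr ⟨u, v, hl, hvu⟩ (hmem (.inl (t 0))) (hmem (.inr (t' 0)))
  replace hn := hm.nodup_iff.2 hn
  replace hmem := fun w => hm.mem_iff.2 (hmem w)
  clear hm hl hvu l hls
  obtain ⟨x, y, j, hx, ⟨rfl, hy⟩ | ⟨r, k, rfl, hy, hr⟩⟩ := hp.exists_blocks
  · left
    have hxn : x.Nodup := List.Nodup.of_map _ (List.nodup_append.1 hn).1
    have hyn : y.Nodup := List.Nodup.of_map _ (List.nodup_append.1 hn).2.1
    have hxm : ∀ w, w ∈ x := fun w => by simpa using hmem (.inl w)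
    have hym : ∀ w, w ∈ y := fun w => by simpa using hmem (.inr w)
    refine ⟨i, j, ?_, ⟨[x], .cons hx .nil, by simpa using hxn, by simpa using hxm⟩,
      ⟨[y], .cons hy .nil, by simpa using hyn, by simpa using hym⟩⟩
    rintro rfl
    have := ht ((hx.eq_of_nodup hxn (hxm (t 0))).trans (hx.eq_of_nodup hxn (hxm (t 1))).symm)
    simp at this
  · right
    have hij : i ≠ j := by
      rintro rfl
      have h1 : Sum.inr (t' i) ∈ y.map (Sum.inr (α := V)) := by simpa using hy.mem_left
      have h2 := hr.mem_right
      simp only [List.nodup_append] at hn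
      exact hn.2.1.2.2 _ h1 _ h2 rfl
    obtain ⟨x', y', l, hx', ⟨rfl, hy'⟩ | ⟨r', k', rfl, hy', hr'⟩⟩ := hr.exists_blocks
    · have hxn : (x ++ x').Nodup := by
        refine List.Nodup.of_map (Sum.inl (β := W)) (List.Nodup.sublist ?_ hn)
        rw [List.map_append]
        exact (List.Sublist.refl _).append ((List.sublist_append_left _ _).trans
          (List.sublist_append_right _ _))
      have hyn : (y ++ y').Nodup := by
        refine List.Nodup.of_map (Sum.inr (α := V)) (List.Nodup.sublist ?_ hn)
        rw [List.map_append]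
        exact ((List.Sublist.refl _).append (List.sublist_append_right _ _)).trans
          (List.sublist_append_right _ _)
      have hxm : ∀ w, w ∈ x ++ x' := fun w => by simpa using hmem (.inl w)
      have hym : ∀ w, w ∈ y ++ y' := fun w => by simpa using hmem (.inr w)
      refine ⟨i, j, k, l, ?_, ⟨[x, x'], .cons hx (.cons hx' .nil), by simpa using hxn,
        by simpa using hxm⟩, ⟨[y, y'], .cons hy (.cons hy' .nil), by simpa using hyn,
        by simpa using hym⟩⟩
      rw [List.nodup_append] at hxn hyn
      have hx1 := hxn.2.2
      have hy1 := hyn.2.2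
      have a1 := hx1 _ hx.mem_left _ hx'.mem_left
      have a2 := hx1 _ hx.mem_left _ hx'.mem_right
      have a3 := hx1 _ hx.mem_right _ hx'.mem_left
      have a4 := hx1 _ hx.mem_right _ hx'.mem_right
      have a5 := hy1 _ hy.mem_right _ hy'.mem_left
      rw [Ne, ht.eq_iff] at a1 a2 a3 a4
      rw [Ne, ht'.eq_iff] at a5
      simp [*]
    · exfalso
      have e : ∀ {a b : Fin 4} {X Y : List (V ⊕ W)}, (X ++ Y).Nodup → Sum.inl (t a) ∈ X →
          Sum.inl (t b) ∈ Y → a ≠ b := by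
        rintro a b X Y hXY ha hb rfl
        exact (List.nodup_append.1 hXY).2.2 _ ha _ hb rfl
      have hn1 := (List.nodup_append.1 (List.nodup_append.1 hn).2.1).2.1
      have hkl : k ≠ l := by
        rintro rfl
        have h1 : Sum.inr (t' k) ∈ y.map (Sum.inr (α := V)) := by simpa using hy.mem_right
        have h2 : Sum.inr (t' k) ∈ y'.map (Sum.inr (α := V)) := by simpa using hy'.mem_left
        simp only [List.nodup_append] at hn
        exact hn.2.1.2.2 _ h1 _ (List.mem_append_right _ (List.mem_append_left _ h2)) rfl
      have i1 : Sum.inl (t i) ∈ x.map (Sum.inl (β := W)) := by simpa using hx.mem_left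
      have i2 : Sum.inl (t j) ∈ x.map (Sum.inl (β := W)) := by simpa using hx.mem_right
      have i3 : Sum.inl (t k) ∈ x'.map (Sum.inl (β := W)) := by simpa using hx'.mem_left
      have i4 : Sum.inl (t l) ∈ x'.map (Sum.inl (β := W)) := by simpa using hx'.mem_right
      have i5 := hr'.mem_left
      have m3 := List.mem_append_right (y.map (Sum.inr (α := V)))
        (List.mem_append_left (y'.map Sum.inr ++ r') i3)
      have m4 := List.mem_append_right (y.map (Sum.inr (α := V)))
        (List.mem_append_left (y'.map Sum.inr ++ r') i4)
      have m5 := List.mem_append_right (y.map (Sum.inr (α := V)))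
        (List.mem_append_right (x'.map (Sum.inl (β := W)))
          (List.mem_append_right (y'.map Sum.inr) i5))
      have b1 := e hn i1 m3
      have b2 := e hn i1 m4
      have b3 := e hn i1 m5
      have b4 := e hn i2 m3
      have b5 := e hn i2 m4
      have b6 := e hn i2 m5
      have b7 := e hn1 i3 (List.mem_append_right _ i5)
      have b8 := e hn1 i4 (List.mem_append_right _ i5)
      omega

end Glue


/-! ### Grinberg's criterion for cubic plane graphs -/

section Grinberg

open Finset

/-- The combinatorial faces of a cubic plane graph. The three neighbours of a vertex `v` are
numbered, and `corner v i` is the face at `v` that is *not* bounded by the edge from `v` to its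
`i`-th neighbour, so that this edge separates `corner v (i + 1)` from `corner v (i + 2)`. -/
structure FaceSystem {V : Type*} [Fintype V] (G : SimpleGraph V) (F : Type*) [Fintype F] where
  /-- The `i`-th neighbour of a vertex. -/
  nbr : V → Fin 3 → V
  /-- The face opposite to the `i`-th edge at a vertex. -/
  corner : V → Fin 3 → F
  adj_iff : ∀ u v, G.Adj u v ↔ ∃ i, nbr u i = v
  nbr_injective : ∀ u, Function.Injective (nbr u)
  corner_edge : ∀ v i j, nbr (nbr v i) j = v →
    s(corner v (i + 1), corner v (i + 2)) = s(corner (nbr v i) (j + 1), corner (nbr v i) (j + 2))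
  euler : 2 * Fintype.card F = Fintype.card V + 4
  connected : ∀ S : Set F, S.Nonempty → (∀ v i j, corner v i ∈ S → corner v j ∈ S) → S = Set.univ

/-- A property that is invariant along the edges of a walk is constant on the walk. -/
theorem SimpleGraph.Walk.iff_of_toSubgraph_adj {V : Type*} {G : SimpleGraph V} {X : V → Prop} :
    ∀ {u v : V} (q : G.Walk u v), (∀ x y, q.toSubgraph.Adj x y → (X x ↔ X y)) →
      ∀ w ∈ q.support, X u ↔ X w
  | _, _, .nil, _, w, hw => by
    obtain rfl : w = _ := by simpa using hw
    rfl
  | _, _, .cons h q, hX, w, hw => by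
    rw [SimpleGraph.Walk.support_cons, List.mem_cons] at hw
    rcases hw with rfl | hw
    · rfl
    · refine (hX _ _ ?_).trans (q.iff_of_toSubgraph_adj (fun x y hxy => hX x y ?_) w hw)
      · simp [SimpleGraph.Walk.toSubgraph]
      · exact Or.inr hxy

variable {V F : Type*} [Fintype V] [Fintype F] {G : SimpleGraph V}

/-- A connected family of faces whose edges come from a perfect matching of the vertices has at
most half as many members, up to one, as there are vertices carrying such an edge. -/
theorem two_mul_card_le_of_matching {m : V → V} (hm : ∀ v, m v ≠ v) {f g : V → F}
    (hP : ∀ v, s(f (m v), g (m v)) = s(f v, g v)) (p : F → Prop) [DecidablePred p]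
    (hp : ∃ x, p x) (hfg : ∀ v, p (f v) ↔ p (g v))
    (hconn : ∀ T : Set F, T.Nonempty → (∀ x ∈ T, p x) → (∀ v, f v ∈ T ↔ g v ∈ T) →
      ∀ x, p x → x ∈ T) :
    2 * #{x | p x} ≤ #{v | p (f v)} + 2 := by
  classical
  let A : SimpleGraph {x // p x} :=
    { Adj := fun x y => x ≠ y ∧ ∃ v, s(f v, g v) = s(x.1, y.1)
      symm := ⟨fun x y ⟨h, v, hv⟩ => ⟨h.symm, v, hv.trans Sym2.eq_swap⟩⟩
      loopless := ⟨fun x h => h.1 rfl⟩ }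
  have hA : A.Connected := by
    obtain ⟨x0, hx0⟩ := hp
    have : ∀ x, A.Reachable ⟨x0, hx0⟩ x := by
      intro x
      have := hconn {y | ∃ hy : p y, A.Reachable ⟨x0, hx0⟩ ⟨y, hy⟩} ⟨x0, hx0, .refl _⟩
        (fun y hy => hy.1) ?_ x.1 x.2
      · obtain ⟨_, h⟩ := this
        exact h
      · intro v
        have key : ∀ a b (ha : p a) (hb : p b), s(f v, g v) = s(a, b) →
            A.Reachable ⟨x0, hx0⟩ ⟨a, ha⟩ → A.Reachable ⟨x0, hx0⟩ ⟨b, hb⟩ := by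
          intro a b ha hb hab hr
          by_cases h : a = b
          · subst h; exact hr
          · exact hr.trans (SimpleGraph.Adj.reachable ⟨by simpa using h, v, hab⟩)
        constructor
        · rintro ⟨h1, h2⟩
          exact ⟨(hfg v).1 h1, key _ _ _ _ rfl h2⟩
        · rintro ⟨h1, h2⟩
          exact ⟨(hfg v).2 h1, key _ _ _ _ Sym2.eq_swap h2⟩
    exact { preconnected := fun x y => (this x).symm.trans (this y), nonempty := ⟨⟨x0, hx0⟩⟩ }
  have h1 := hA.card_vert_le_card_edgeSet_add_one
  rw [Nat.card_eq_fintype_card, Nat.card_eq_fintype_card, ← SimpleGraph.edgeFinset_card,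
    Fintype.card_subtype] at h1
  have h2 := Finset.card_mul_le_card_mul (s := A.edgeFinset) (t := {v | p (f v)})
    (m := 2) (n := 1) (fun e v => e.map Subtype.val = s(f v, g v)) ?_ ?_
  · omega
  · intro e he
    induction e with
    | _ x y =>
      rw [SimpleGraph.mem_edgeFinset, SimpleGraph.mem_edgeSet] at he
      obtain ⟨_, v, hv⟩ := he
      have hpv : p (f v) := by
        have : f v ∈ s(x.1, y.1) := hv ▸ Sym2.mem_mk_left _ _
        rcases Sym2.mem_iff.1 this with h | h
        · rw [h]; exact x.2
        · rw [h]; exact y.2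
      have hpm : p (f (m v)) := by
        have : f (m v) ∈ s(x.1, y.1) := hv ▸ hP v ▸ Sym2.mem_mk_left _ _
        rcases Sym2.mem_iff.1 this with h | h
        · rw [h]; exact x.2
        · rw [h]; exact y.2
      rw [← Finset.card_pair (hm v).symm]
      refine Finset.card_le_card fun w hw => ?_
      rw [Finset.mem_insert, Finset.mem_singleton] at hw
      rcases hw with rfl | rfl
      · simp [Finset.mem_bipartiteAbove, hv, hpv]
      · simp [Finset.mem_bipartiteAbove, hP, hv, hpm]
  · intro v _
    rw [Finset.card_le_one]
    intro a ha b hb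
    simp only [Finset.mem_bipartiteBelow] at ha hb
    exact Sym2.map.injective Subtype.val_injective (ha.2.trans hb.2.symm)

namespace FaceSystem

variable (Φ : FaceSystem G F)

/-- The two sides of a Hamiltonian cycle: a colouring of the faces such that around no vertex all
faces have the same colour, each colour class is connected, and Grinberg's equation holds. -/
structure IsSidedness (s : F → Bool) : Prop where
  not_mono : ∀ v b, ∃ i, s (Φ.corner v i) = b
  connected : ∀ b, ∀ T : Set F, T.Nonempty → (∀ f ∈ T, s f = b) →
    (∀ v i j, Φ.corner v i ∈ T → s (Φ.corner v j) = b → Φ.corner v j ∈ T) →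
    ∀ f, s f = b → f ∈ T
  grinberg : ∀ b, #{x : V × Fin 3 | s (Φ.corner x.1 x.2) = b} + 2 =
    Fintype.card V + 2 * #{f | s f = b}

variable {Φ} in
theorem IsSidedness.not {s : F → Bool} (hs : Φ.IsSidedness s) : Φ.IsSidedness fun f => !s f where
  not_mono v b := by
    obtain ⟨i, hi⟩ := hs.not_mono v (!b)
    exact ⟨i, by simp [hi]⟩
  connected b T hT h1 h2 f hf := by
    have key : ∀ f, (!s f) = b ↔ s f = !b := fun f => by cases s f <;> cases b <;> simp
    simp only [key] at h1 h2 hf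
    exact hs.connected _ T hT h1 h2 f hf
  grinberg b := by
    have key : ∀ f, (!s f) = b ↔ s f = !b := fun f => by cases s f <;> cases b <;> simp
    simpa only [key] using hs.grinberg (!b)

/-- A Hamiltonian cycle divides the faces into those on one side and those on the other; any edge
that is not in the cycle has the same side of the cycle on its two sides. -/
theorem exists_isSidedness [DecidableEq V] {H : SimpleGraph V} (hHG : H ≤ G)
    (hH : H.IsHamiltonian) (hV : Fintype.card V ≠ 1) :
    ∃ s, Φ.IsSidedness s ∧ ∀ v i, ¬ H.Adj v (Φ.nbr v i) →
      s (Φ.corner v (i + 1)) = s (Φ.corner v (i + 2)) := by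
  classical
  obtain ⟨a, p, hp⟩ := hH hV
  let C := p.toSubgraph.Adj
  have hCG : ∀ {u v}, C u v → G.Adj u v := fun h => hHG (p.toSubgraph.adj_sub h)
  have hCs : ∀ {u v}, C u v → C v u := fun h => h.symm
  -- Exactly one of the three edges at `v` is not in the cycle; its number is `k v`.
  have hk : ∀ v, ∃ k, ¬ C v (Φ.nbr v k) ∧ C v (Φ.nbr v (k + 1)) ∧ C v (Φ.nbr v (k + 2)) := by
    intro v
    have h2 : (p.toSubgraph.neighborSet v).ncard = 2 :=
      hp.isCycle.ncard_neighborSet_toSubgraph_eq_two (hp.mem_support v)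
    have h3 : p.toSubgraph.neighborSet v =
        Φ.nbr v '' ((Finset.univ.filter fun i => C v (Φ.nbr v i) : Finset (Fin 3)) :
          Set (Fin 3)) := by
      ext w
      constructor
      · intro hw
        obtain ⟨i, rfl⟩ := (Φ.adj_iff v w).1 (hCG hw)
        exact ⟨i, by simpa using hw, rfl⟩
      · rintro ⟨i, hi, rfl⟩
        simpa using hi
    rw [h3, Set.ncard_image_of_injective _ (Φ.nbr_injective v), Set.ncard_coe_finset] at h2
    have h4 : ∀ I : Finset (Fin 3), #I = 2 → ∃ k, k ∉ I ∧ k + 1 ∈ I ∧ k + 2 ∈ I := by decide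
    simpa using h4 _ h2
  choose k hk0 hk1 hk2 using hk
  have hkne : ∀ v i, C v (Φ.nbr v i) → i = k v + 1 ∨ i = k v + 2 := by
    intro v i hi
    have : ∀ i k : Fin 3, i = k ∨ i = k + 1 ∨ i = k + 2 := by decide
    rcases this i (k v) with rfl | h
    · exact absurd hi (hk0 v)
    · exact h
  let m : V → V := fun v => Φ.nbr v (k v)
  have hGm : ∀ v, G.Adj v (m v) := fun v => (Φ.adj_iff _ _).2 ⟨_, rfl⟩
  have hmm : ∀ v, Φ.nbr (m v) (k (m v)) = v := by
    intro v
    obtain ⟨j, hj⟩ := (Φ.adj_iff _ _).1 (hGm v).symm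
    have : ∀ i k : Fin 3, i = k ∨ i = k + 1 ∨ i = k + 2 := by decide
    rcases this j (k (m v)) with rfl | rfl | rfl
    · exact hj
    · have h1 := hk1 (m v)
      rw [hj] at h1
      exact absurd (hCs h1) (hk0 v)
    · have h1 := hk2 (m v)
      rw [hj] at h1
      exact absurd (hCs h1) (hk0 v)
  let f : V → F := fun v => Φ.corner v (k v + 1)
  let g : V → F := fun v => Φ.corner v (k v + 2)
  let h : V → F := fun v => Φ.corner v (k v)
  have hP : ∀ v, s(f (m v), g (m v)) = s(f v, g v) := fun v =>
    (Φ.corner_edge v (k v) (k (m v)) (hmm v)).symm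
  have hm : ∀ v, m v ≠ v := fun v hv => (hGm v).ne hv.symm
  have hcorner : ∀ v i, Φ.corner v i = f v ∨ Φ.corner v i = g v ∨ Φ.corner v i = h v := by
    intro v i
    have : ∀ i k : Fin 3, i = k ∨ i = k + 1 ∨ i = k + 2 := by decide
    rcases this i (k v) with rfl | rfl | rfl
    · exact .inr (.inr rfl)
    · exact .inl rfl
    · exact .inr (.inl rfl)
  -- A set of faces whose boundary lies in the cycle has the whole cycle as its boundary.
  have hcut : ∀ S : Set F, S.Nonempty → S ≠ Set.univ → (∀ v, f v ∈ S ↔ g v ∈ S) →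
      ∀ v, ¬ (h v ∈ S ↔ f v ∈ S) := by
    intro S hS hSu hfg v hv
    refine hSu (Φ.connected S hS ?_)
    have hstep : ∀ x y, C x y → ((h x ∈ S ↔ f x ∈ S) ↔ (h y ∈ S ↔ f y ∈ S)) := by
      have hx : ∀ x i, C x (Φ.nbr x i) → ((h x ∈ S ↔ f x ∈ S) ↔
          (Φ.corner x (i + 1) ∈ S ↔ Φ.corner x (i + 2) ∈ S)) := by
        intro x i hi
        have hfgx := hfg x
        have e1 : ∀ k : Fin 3, k + 1 + 1 = k + 2 ∧ k + 1 + 2 = k ∧ k + 2 + 1 = k ∧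
          k + 2 + 2 = k + 1 := by decide
        obtain ⟨c1, c2, c3, c4⟩ := e1 (k x)
        rcases hkne x i hi with rfl | rfl
        · rw [c1, c2]
          change _ ↔ (g x ∈ S ↔ h x ∈ S)
          tauto
        · rw [c3, c4]
      intro x y hxy
      obtain ⟨i, rfl⟩ := (Φ.adj_iff x y).1 (hCG hxy)
      obtain ⟨j, hj⟩ := (Φ.adj_iff _ _).1 (hCG hxy).symm
      rw [hx x i hxy, hx (Φ.nbr x i) j (by rw [hj]; exact hCs hxy)]
      have := Φ.corner_edge x i j hj
      rw [Sym2.eq_iff] at this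
      rcases this with ⟨h1, h2⟩ | ⟨h1, h2⟩
      · rw [h1, h2]
      · rw [h1, h2]
        tauto
    have hall := p.iff_of_toSubgraph_adj hstep
    have hall' : ∀ w, h w ∈ S ↔ f w ∈ S := fun w =>
      (hall w (hp.mem_support w)).1 ((hall v (hp.mem_support v)).2 hv)
    intro w i j
    have h1 := hall' w
    have h2 := hfg w
    rcases hcorner w i with h3 | h3 | h3 <;> rcases hcorner w j with h4 | h4 | h4 <;>
      rw [h3, h4] <;> tauto
  have hFne : Nonempty F := ⟨h a⟩
  -- By Euler's formula there are too few edges off the cycle to connect all faces.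
  obtain ⟨S, hS, hSu, hSfg⟩ : ∃ S : Set F, S.Nonempty ∧ S ≠ Set.univ ∧
      ∀ v, f v ∈ S ↔ g v ∈ S := by
    by_contra! hcon
    have := two_mul_card_le_of_matching hm hP (fun _ => True) ⟨h a, trivial⟩ (fun _ => Iff.rfl)
      (fun T hT _ hT' x _ => by
        by_cases hTu : T = Set.univ
        · rw [hTu]; trivial
        · obtain ⟨v, hv⟩ := hcon T hT hTu
          have := hT' v
          tauto)
    simp only [Finset.filter_true, Finset.card_univ] at this
    have := Φ.euler
    omega
  have hSh := hcut S hS hSu hSfg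
  let s : F → Bool := fun x => decide (x ∈ S)
  have hsfg : ∀ v, s (f v) = s (g v) := fun v => by
    simp only [s]; exact decide_eq_decide.2 (hSfg v)
  have hsh : ∀ v, s (h v) = !s (f v) := by
    intro v
    have := hSh v
    simp only [s]
    by_cases h1 : h v ∈ S <;> by_cases h2 : f v ∈ S <;> simp_all
  have hmono : ∀ v b, ∃ i, s (Φ.corner v i) = b := by
    intro v b
    by_cases hb : s (f v) = b
    · exact ⟨_, hb⟩
    · refine ⟨k v, ?_⟩
      change s (h v) = b
      rw [hsh]
      revert hb
      cases s (f v) <;> cases b <;> simp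
  have hconn : ∀ b, ∀ T : Set F, T.Nonempty → (∀ x ∈ T, s x = b) →
      (∀ v, f v ∈ T ↔ g v ∈ T) → ∀ x, s x = b → x ∈ T := by
    intro b T hT hTb hTfg x hx
    by_contra hxT
    have hTu : T ≠ Set.univ := fun h => hxT (h ▸ trivial)
    obtain ⟨y, hy⟩ := hT
    have h1 := hcut T ⟨y, hy⟩ hTu hTfg a
    have h2 := hcut ({z | s z = b} \ T) ⟨x, hx, hxT⟩ (fun h => by
      have : y ∈ {z | s z = b} \ T := h ▸ trivial
      exact this.2 hy) (fun v => by
        simp only [Set.mem_sdiff, Set.mem_ofPred_eq, hsfg v, hTfg v]) a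
    have h3 := hsh a
    have h4 := hTb (f a)
    have h5 := hTb (h a)
    simp only [Set.mem_sdiff, Set.mem_ofPred_eq] at h2
    by_cases c1 : h a ∈ T <;> by_cases c2 : f a ∈ T
    · exact h1 (iff_of_true c1 c2)
    · refine h2 (iff_of_false (fun q => q.2 c1) fun q => ?_)
      rw [h5 c1, q.1] at h3
      cases b <;> simp at h3
    · refine h2 (iff_of_false (fun q => ?_) fun q => q.2 c2)
      rw [h4 c2, q.1] at h3
      cases b <;> simp at h3
    · exact h1 (iff_of_false c1 c2)
  refine ⟨s, ⟨hmono, fun b T hT hTb hTc => hconn b T hT hTb ?_, ?_⟩, fun v i hi => ?_⟩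
  · intro v
    constructor
    · intro hv
      exact hTc v _ _ hv ((hsfg v).symm.trans (hTb _ hv))
    · intro hv
      exact hTc v _ _ hv ((hsfg v).trans (hTb _ hv))
  · have hcount : ∀ b, #{x : V × Fin 3 | s (Φ.corner x.1 x.2) = b} =
        Fintype.card V + #{v | s (f v) = b} := by
      intro b
      have hv : ∀ v, ∑ i, (if s (Φ.corner v i) = b then 1 else 0) =
          1 + if s (f v) = b then 1 else 0 := by
        intro v
        have : ∀ φ : Fin 3 → ℕ, ∀ k : Fin 3, ∑ i, φ i = φ k + φ (k + 1) + φ (k + 2) := by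
          intro φ k
          rw [Fin.sum_univ_three]
          fin_cases k <;> simp <;> omega
        rw [this _ (k v)]
        change (if s (h v) = b then 1 else 0) + (if s (f v) = b then 1 else 0) +
          (if s (g v) = b then 1 else 0) = _
        rw [hsh, ← hsfg]
        cases s (f v) <;> cases b <;> simp
      rw [Finset.card_filter, Fintype.sum_prod_type]
      simp only [hv]
      rw [Finset.sum_add_distrib, Finset.card_filter]
      simp
    -- Added up, these two inequalities are Euler's formula, so both are equalities.
    have hlow : ∀ b, 2 * #{x | s x = b} ≤ #{v | s (f v) = b} + 2 := fun b =>
      two_mul_card_le_of_matching hm hP (fun x => s x = b)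
        (by obtain ⟨i, hi⟩ := hmono a b; exact ⟨_, hi⟩) (fun v => by rw [hsfg]) (hconn b)
    have hF : #{x | s x = true} + #{x | s x = false} = Fintype.card F := by
      simpa using Finset.card_filter_add_card_filter_not (s := Finset.univ) (fun x => s x = true)
    have hVs : #{v | s (f v) = true} + #{v | s (f v) = false} = Fintype.card V := by
      simpa using
        Finset.card_filter_add_card_filter_not (s := Finset.univ) (fun x => s (f x) = true)
    have hE := Φ.euler
    have ht := hlow true
    have hf := hlow false
    intro b
    rw [hcount]
    cases b <;> omega
  · have : ∀ i k : Fin 3, i = k ∨ i = k + 1 ∨ i = k + 2 := by decide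
    rcases this i (k v) with rfl | rfl | rfl
    · exact hsfg v
    · exact absurd (p.toSubgraph.adj_sub (hk1 v)) hi
    · exact absurd (p.toSubgraph.adj_sub (hk2 v)) hi

end FaceSystem

end Grinberg


/-! ### Poles and links -/

section Pole

variable {V W : Type*} {K : SimpleGraph V} {L : SimpleGraph W} {t : Fin 4 → V} {t' : Fin 4 → W}

theorem Spans.map {G : SimpleGraph V} {H : SimpleGraph W} {S : Set V} {ps : List (V × V)}
    (h : Spans G S ps) (f : V → W) (hf : f.Injective) (hGH : ∀ x y, G.Adj x y → H.Adj (f x) (f y)) :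
    Spans H (f '' S) (ps.map (Prod.map f f)) := by
  obtain ⟨ls, hls, hn, hS⟩ := h
  refine ⟨ls.map (List.map f), ?_, ?_, ?_⟩
  · rw [List.forall₂_map_left_iff, List.forall₂_map_right_iff]
    exact hls.imp fun l p hl => hl.map f hGH
  · rw [← List.map_flatten]
    exact hn.map hf
  · intro w
    rw [← List.map_flatten, List.mem_map]
    simp only [hS, Set.mem_image]

theorem Spans.append {G : SimpleGraph V} {S T : Set V} {ps qs : List (V × V)}
    (h : Spans G S ps) (h' : Spans G T qs) (hST : Disjoint S T) :
    Spans G (S ∪ T) (ps ++ qs) := by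
  obtain ⟨ls, hls, hn, hS⟩ := h
  obtain ⟨ms, hms, hm, hT⟩ := h'
  refine ⟨ls ++ ms, List.rel_append hls hms, ?_, ?_⟩
  · rw [List.flatten_append, List.nodup_append']
    refine ⟨hn, hm, fun x hx hx' => Set.disjoint_left.1 hST ((hS x).1 hx) ((hT x).1 hx')⟩
  · simp [hS, hT]

/-- Spanning systems of paths on the two sides of a glued graph form one such system. -/
theorem Spans.glue {U : Set (V ⊕ W)} {ps : List (V × V)} {qs : List (W × W)}
    (h : Spans K (Sum.inl ⁻¹' U) ps) (h' : Spans L (Sum.inr ⁻¹' U) qs) :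
    Spans (glue K L t t') U (ps.map (Prod.map Sum.inl Sum.inl) ++
      qs.map (Prod.map Sum.inr Sum.inr)) := by
  have h1 := h.map (H := _root_.glue K L t t') Sum.inl Sum.inl_injective fun _ _ h => h
  have h2 := h'.map (H := _root_.glue K L t t') Sum.inr Sum.inr_injective fun _ _ h => h
  have h3 := h1.append h2 (by
    rw [Set.disjoint_left]
    rintro _ ⟨x, _, rfl⟩ ⟨y, _, h⟩
    cases h)
  convert h3 using 1
  ext (x | x) <;> simp

/-- Two paths on the right that are linked up by one path on the left. -/
theorem Spans.glue_transit {U : Set (V ⊕ W)} {i j : Fin 4} {p q : W}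
    (h : Spans K (Sum.inl ⁻¹' U) [(t i, t j)])
    (h' : Spans L (Sum.inr ⁻¹' U) [(p, t' i), (t' j, q)]) :
    Spans (_root_.glue K L t t') U [(.inr p, .inr q)] := by
  have h1 := (Spans.glue (t := t) (t' := t') h h').perm (List.Perm.swap _ _ _)
  exact (h1.join ⟨i, rfl, rfl⟩).join ⟨j, rfl, rfl⟩

theorem HasSpanningCycle.glue_of_single {i j : Fin 4} (h : Spans K Set.univ [(t i, t j)])
    (h' : Spans L Set.univ [(t' j, t' i)]) : HasSpanningCycle (glue K L t t') Set.univ :=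
  ⟨.inl (t i), .inr (t' i), ⟨i, rfl, rfl⟩,
    (Spans.glue (t := t) (t' := t') (U := Set.univ) h h').join ⟨j, rfl, rfl⟩⟩

theorem HasSpanningCycle.glue_of_pair {i j k l : Fin 4}
    (h : Spans K Set.univ [(t i, t j), (t k, t l)])
    (h' : Spans L Set.univ [(t' j, t' k), (t' l, t' i)]) :
    HasSpanningCycle (glue K L t t') Set.univ := by
  have h1 : Spans (_root_.glue K L t t') Set.univ [(.inl (t i), .inl (t j)),
      (.inr (t' j), .inr (t' k)), (.inl (t k), .inl (t l)), (.inr (t' l), .inr (t' i))] :=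
    (Spans.glue (t := t) (t' := t') (U := Set.univ) h h').perm (.cons _ (.swap _ _ _))
  exact ⟨.inl (t i), .inr (t' i), ⟨i, rfl, rfl⟩, ((h1.join ⟨j, rfl, rfl⟩).join ⟨k, rfl, rfl⟩).join
    ⟨l, rfl, rfl⟩⟩

/-- The graph `K` with two further edges, one between the terminals `t 0` and `t 1` and one
between the terminals `t 2` and `t 3`. -/
def close (K : SimpleGraph V) (t : Fin 4 → V) : SimpleGraph V :=
  K ⊔ SimpleGraph.edge (t 0) (t 1) ⊔ SimpleGraph.edge (t 2) (t 3)

theorem le_close : K ≤ close K t := le_sup_left.trans le_sup_left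

theorem close_adj {u v : V} : (close K t).Adj u v ↔ K.Adj u v ∨
    (t 0 = u ∧ t 1 = v ∨ t 0 = v ∧ t 1 = u) ∧ u ≠ v ∨
    (t 2 = u ∧ t 3 = v ∨ t 2 = v ∧ t 3 = u) ∧ u ≠ v := by
  simp only [close, SimpleGraph.sup_adj, SimpleGraph.edge_adj]
  grind

theorem close_glue (r : Fin 4 → W) :
    close (glue K L t t') (Sum.inr ∘ r) = glue K (close L r) t t' := by
  ext (x | x) (y | y) <;> simp [close_adj]

/-- The terminals `t i` and `t j` lie on different sides of a pole. -/
def Crossing (i j : Fin 4) : Prop := (i < 2 ∧ 2 ≤ j) ∨ (j < 2 ∧ 2 ≤ i)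

instance (i j : Fin 4) : Decidable (Crossing i j) := inferInstanceAs (Decidable (_ ∨ _))

/-- A graph with four terminals that can take the place of an edge `xy` together with its ends in
the Hamiltonian cycles of a graph with one vertex deleted: the terminals `t 0` and `t 1` stand for
the edges at `x`, the terminals `t 2` and `t 3` for the edges at `y`. -/
structure IsPole (K : SimpleGraph V) (t : Fin 4 → V) : Prop where
  cross : ∀ i j, Crossing i j → Spans K Set.univ [(t i, t j)]
  delete : ∀ v, Spans K {v}ᶜ [(t 0, t 1)] ∨ Spans K {v}ᶜ [(t 2, t 3)]

/-- Two paths of `L` that cover `S` and become one path from `p` to `q` once a path between two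
terminals on different sides of a pole is put between them. -/
def Transit (L : SimpleGraph W) (t' : Fin 4 → W) (S : Set W) (p q : W) : Prop :=
  ∃ i j, Crossing i j ∧ Spans L S [(p, t' i), (t' j, q)]

/-- A graph with four terminals `t'` to be joined to those of a pole and four terminals `r`
of its own, such that gluing yields a pole again. -/
structure IsLink (L : SimpleGraph W) (t' r : Fin 4 → W) : Prop where
  cross : ∀ i j, i < 2 → 2 ≤ j → Transit L t' Set.univ (r i) (r j)
  delete : ∀ v, Transit L t' {v}ᶜ (r 0) (r 1) ∨ Transit L t' {v}ᶜ (r 2) (r 3)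
  delete_left : Spans L Set.univ [(r 0, t' 0), (t' 1, r 1)] ∨
    Spans L Set.univ [(r 2, t' 0), (t' 1, r 3)]
  delete_right : Spans L Set.univ [(r 0, t' 2), (t' 3, r 1)] ∨
    Spans L Set.univ [(r 2, t' 2), (t' 3, r 3)]

/-- If a vertex of the pole is deleted, then a cycle uses only two terminals of the pole, on the
same side; this is where `delete_left` and `delete_right` are needed. -/
theorem IsPole.glue (hK : IsPole K t) {r : Fin 4 → W} (hL : IsLink L t' r) :
    IsPole (_root_.glue K L t t') (Sum.inr ∘ r) where
  cross := by
    have key : ∀ i j, i < 2 → 2 ≤ j →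
        Spans (_root_.glue K L t t') Set.univ [(.inr (r i), .inr (r j))] := fun i j hi hj => by
      obtain ⟨k, l, hkl, h⟩ := hL.cross i j hi hj
      exact Spans.glue_transit (U := Set.univ) (hK.cross k l hkl) h
    rintro i j (⟨hi, hj⟩ | ⟨hi, hj⟩)
    · exact key i j hi hj
    · exact (key j i hi hj).reverse_head
  delete := by
    rintro (v | v)
    · have h1 : (Sum.inl ⁻¹' {(Sum.inl v : V ⊕ W)}ᶜ : Set V) = {v}ᶜ := by ext; simp
      have h2 : (Sum.inr ⁻¹' {(Sum.inl v : V ⊕ W)}ᶜ : Set W) = Set.univ := by ext; simp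
      have key : ∀ i j p q, Spans K {v}ᶜ [(t i, t j)] → Spans L Set.univ [(p, t' i), (t' j, q)] →
          Spans (_root_.glue K L t t') {Sum.inl v}ᶜ [(.inr p, .inr q)] := fun i j p q h h' =>
        Spans.glue_transit (U := {Sum.inl v}ᶜ) (h1.symm ▸ h) (h2.symm ▸ h')
      rcases hK.delete v with h | h
      · exact hL.delete_left.imp (key _ _ _ _ h) (key _ _ _ _ h)
      · exact hL.delete_right.imp (key _ _ _ _ h) (key _ _ _ _ h)
    · have h1 : (Sum.inl ⁻¹' {(Sum.inr v : V ⊕ W)}ᶜ : Set V) = Set.univ := by ext; simp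
      have h2 : (Sum.inr ⁻¹' {(Sum.inr v : V ⊕ W)}ᶜ : Set W) = {v}ᶜ := by ext; simp
      have key : ∀ p q, Transit L t' {v}ᶜ p q →
          Spans (_root_.glue K L t t') {Sum.inr v}ᶜ [(.inr p, .inr q)] := by
        rintro p q ⟨i, j, hij, h⟩
        exact Spans.glue_transit (U := {Sum.inr v}ᶜ) (h1.symm ▸ hK.cross i j hij) (h2.symm ▸ h)
      exact (hL.delete v).imp (key _ _) (key _ _)

/-- The terminals of the pole that consists of a single edge. -/
def edgeTerminal : Fin 4 → Fin 2 := ![0, 0, 1, 1]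

theorem Spans.pair_top {u v : Fin 2} (h : u ≠ v) : Spans (⊤ : SimpleGraph (Fin 2)) Set.univ
    [(u, v)] :=
  ⟨[[u, v]], .cons ⟨by simpa using h, rfl, rfl⟩ .nil, by simpa using h, fun w => by
    simp only [List.flatten_cons, List.flatten_nil, List.append_nil, List.mem_cons,
      List.not_mem_nil, or_false, Set.mem_univ, iff_true]
    omega⟩

theorem Spans.singletons_top {u v : Fin 2} (h : u ≠ v) :
    Spans (⊤ : SimpleGraph (Fin 2)) Set.univ [(u, u), (v, v)] :=
  ⟨[[u], [v]], .cons ⟨.singleton _, rfl, rfl⟩ (.cons ⟨.singleton _, rfl, rfl⟩ .nil),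
    by simpa using h, fun w => by
    simp only [List.flatten_cons, List.flatten_nil, List.append_nil, List.mem_cons,
      List.not_mem_nil, or_false, Set.mem_univ, iff_true, List.cons_append, List.nil_append]
    omega⟩

theorem isPole_edge : IsPole (⊤ : SimpleGraph (Fin 2)) edgeTerminal where
  cross i j h := Spans.pair_top (by
    revert i j
    decide)
  delete v := by
    have key : ∀ u : Fin 2, u ≠ v → Spans (⊤ : SimpleGraph (Fin 2)) {v}ᶜ [(u, u)] := fun u h =>
      ⟨[[u]], .cons ⟨.singleton _, rfl, rfl⟩ .nil, by simp, fun w => by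
        simp only [List.flatten_cons, List.flatten_nil, List.append_nil, List.mem_cons,
          List.not_mem_nil, or_false, Set.mem_compl_iff, Set.mem_singleton_iff]
        omega⟩
    by_cases h : (0 : Fin 2) = v
    · exact .inr (key 1 (by omega))
    · exact .inl (key 0 h)

/-- Gluing a pole in place of an edge creates no Hamiltonian cycle: a Hamiltonian cycle of the
glued graph passes through the pole in a way that an edge with its ends allows, too, or in a way
that the two closing edges turn into a Hamiltonian cycle of the closed pole. -/
theorem not_hasSpanningCycle_glue (ht : t.Injective) (ht' : t'.Injective)
    (hK : ¬ HasSpanningCycle (close K t) Set.univ)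
    (hL : ¬ HasSpanningCycle (glue (⊤ : SimpleGraph (Fin 2)) L edgeTerminal t') Set.univ) :
    ¬ HasSpanningCycle (glue K L t t') Set.univ := by
  intro h
  have h01 : (close K t).Adj (t 0) (t 1) := by
    have := ht.ne (show (0 : Fin 4) ≠ 1 by decide)
    simp [close_adj, this]
  have h23 : (close K t).Adj (t 2) (t 3) := by
    have := ht.ne (show (2 : Fin 4) ≠ 3 by decide)
    simp [close_adj, this]
  have hadj : ∀ i j, i ≠ j → ¬ Crossing i j → (close K t).Adj (t i) (t j) := by
    intro i j hij hc
    have : (i = 0 ∧ j = 1) ∨ (i = 1 ∧ j = 0) ∨ (i = 2 ∧ j = 3) ∨ (i = 3 ∧ j = 2) := by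
      revert i j
      decide
    rcases this with ⟨rfl, rfl⟩ | ⟨rfl, rfl⟩ | ⟨rfl, rfl⟩ | ⟨rfl, rfl⟩
    exacts [h01, h01.symm, h23, h23.symm]
  have hne : ∀ i j, Crossing i j → edgeTerminal i ≠ edgeTerminal j := by decide
  have heq : ∀ i j, ¬ Crossing i j → edgeTerminal i = edgeTerminal j := by decide
  rcases HasSpanningCycle.of_glue ht ht' h with ⟨i, j, hij, h1, h2⟩ | ⟨i, j, k, l, hn, h1, h2⟩
  · by_cases hc : Crossing i j
    · exact hL (.glue_of_single (Spans.pair_top (hne i j hc)) h2)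
    · exact hK ⟨_, _, (hadj i j hij hc).symm, h1.mono le_close⟩
  · by_cases hc : Crossing i j
    · have h3 : ¬ Crossing j k ∧ ¬ Crossing l i ∨ ¬ Crossing j l ∧ ¬ Crossing k i := by
        clear h1 h2
        revert i j k l
        decide
      have hn' : j ≠ k ∧ l ≠ i ∧ j ≠ l ∧ k ≠ i := by simp at hn; tauto
      have h4 := h1.mono (le_close (t := t))
      rcases h3 with ⟨h3, h3'⟩ | ⟨h3, h3'⟩
      · exact hK ⟨_, _, hadj l i hn'.2.1 h3', h4.join (hadj j k hn'.1 h3)⟩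
      · have h5 := ((h4.perm (.swap _ _ _)).reverse_head).perm (.swap _ _ _)
        exact hK ⟨_, _, hadj k i hn'.2.2.2 h3', h5.join (hadj j l hn'.2.2.1 h3)⟩
    · have h3 : ¬ Crossing k l ∧ Crossing i k := by
        clear h1 h2
        revert i j k l
        decide
      refine hL (.glue_of_pair (i := i) (j := j) (k := k) (l := l) ?_ h2)
      rw [← heq i j hc, ← heq k l h3.1]
      exact Spans.singletons_top (hne i k h3.2)

end Pole


/-! ### Short cycles and degrees -/

section Girth

variable {V W : Type*} {G : SimpleGraph V}

/-- The graph has neither triangles nor 4-cycles. -/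
structure NoShortCycle (G : SimpleGraph V) : Prop where
  three : ∀ a b c, G.Adj a b → G.Adj b c → ¬ G.Adj c a
  four : ∀ a b c d, a ≠ c → b ≠ d → G.Adj a b → G.Adj b c → G.Adj c d → ¬ G.Adj d a

/-- The graph has a 5-cycle. -/
def HasFiveCycle (G : SimpleGraph V) : Prop :=
  ∃ a b c d e, [a, b, c, d, e].Nodup ∧ G.Adj a b ∧ G.Adj b c ∧ G.Adj c d ∧ G.Adj d e ∧ G.Adj e a

theorem NoShortCycle.comap {H : SimpleGraph W} (hH : NoShortCycle H) (f : V → W)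
    (hf : f.Injective) (hGH : ∀ x y, G.Adj x y → H.Adj (f x) (f y)) : NoShortCycle G where
  three _ _ _ h1 h2 h3 := hH.three _ _ _ (hGH _ _ h1) (hGH _ _ h2) (hGH _ _ h3)
  four _ _ _ _ h h' h1 h2 h3 h4 := hH.four _ _ _ _ (hf.ne h) (hf.ne h') (hGH _ _ h1) (hGH _ _ h2)
    (hGH _ _ h3) (hGH _ _ h4)

theorem HasFiveCycle.map {H : SimpleGraph W} (hG : HasFiveCycle G) (f : V → W)
    (hf : f.Injective) (hGH : ∀ x y, G.Adj x y → H.Adj (f x) (f y)) : HasFiveCycle H := by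
  obtain ⟨a, b, c, d, e, hn, h1, h2, h3, h4, h5⟩ := hG
  exact ⟨f a, f b, f c, f d, f e, hn.map hf, hGH _ _ h1, hGH _ _ h2, hGH _ _ h3, hGH _ _ h4,
    hGH _ _ h5⟩

theorem girth_eq_five (hG : NoShortCycle G) (h5 : HasFiveCycle G) : G.girth = 5 := by
  have hle : (5 : ℕ∞) ≤ G.egirth := by
    rw [SimpleGraph.le_egirth]
    intro a w hw
    have h3 := hw.three_le_length
    by_contra! hlt
    have hlt' : w.length < 5 := by exact_mod_cast hlt
    match w, hw, h3, hlt' with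
    | .cons h1 (.cons h2 (.cons h3 .nil)), hw, _, _ => exact hG.three _ _ _ h1 h2 h3
    | .cons h1 (.cons h2 (.cons h3 (.cons h4 .nil))), hw, _, _ =>
      have hn := hw.support_nodup
      simp only [SimpleGraph.Walk.support_cons, SimpleGraph.Walk.support_nil, List.tail_cons,
        List.nodup_cons, List.mem_cons, List.not_mem_nil, or_false, not_or] at hn
      exact hG.four _ _ _ _ (fun h => hn.2.1.2 h.symm) hn.1.2.1 h1 h2 h3 h4
    | .cons h1 (.cons h2 (.cons h3 (.cons h4 (.cons h5 w)))), hw, _, h =>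
      simp only [SimpleGraph.Walk.length_cons] at h
      omega
  have hge : G.egirth ≤ (5 : ℕ∞) := by
    obtain ⟨a, b, c, d, e, hn, h1, h2, h3, h4, h5⟩ := h5
    have hc : (SimpleGraph.Walk.cons h1 (.cons h2 (.cons h3 (.cons h4 (.cons h5
        .nil))))).IsCycle := by
      rw [SimpleGraph.Walk.cons_isCycle_iff]
      simp at hn
      simp [SimpleGraph.Walk.cons_isPath_iff]
      grind
    exact SimpleGraph.egirth_le_length hc
  rw [SimpleGraph.girth, le_antisymm hge hle]
  rfl

theorem NoShortCycle.glue {K : SimpleGraph V} {L : SimpleGraph W} {t : Fin 4 → V}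
    {t' : Fin 4 → W} (hK : NoShortCycle K) (hL : NoShortCycle L) (ht : t.Injective)
    (ht' : t'.Injective) (hn : ∀ i j, ¬ L.Adj (t' i) (t' j)) : NoShortCycle (glue K L t t') where
  three := by
    have h3 := hK.three
    have h3' := hL.three
    have e : ∀ i j, t i = t j ↔ i = j := fun i j => ht.eq_iff
    have e' : ∀ i j, t' i = t' j ↔ i = j := fun i j => ht'.eq_iff
    have s := fun x y => K.adj_comm x y
    have s' := fun x y => L.adj_comm x y
    have l := fun x => K.irrefl (v := x)
    have l' := fun x => L.irrefl (v := x)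
    rintro (a | a) (b | b) (c | c) <;>
      simp only [glue_adj_inl_inl, glue_adj_inl_inr, glue_adj_inr_inl, glue_adj_inr_inr] <;>
      grind
  four := by
    have h4 := hK.four
    have h4' := hL.four
    have e : ∀ i j, t i = t j ↔ i = j := fun i j => ht.eq_iff
    have e' : ∀ i j, t' i = t' j ↔ i = j := fun i j => ht'.eq_iff
    rintro (a | a) (b | b) (c | c) (d | d) <;>
      simp only [glue_adj_inl_inl, glue_adj_inl_inr, glue_adj_inr_inl, glue_adj_inr_inr, ne_eq,
        Sum.inl.injEq, Sum.inr.injEq, reduceCtorEq, not_false_eq_true, true_imp_iff] <;>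
      grind

theorem ncard_neighborSet_glue [Finite V] [Finite W] {K : SimpleGraph V} {L : SimpleGraph W}
    {t : Fin 4 → V} {t' : Fin 4 → W} (ht' : t'.Injective) (v : V) :
    ((glue K L t t').neighborSet (.inl v)).ncard =
      (K.neighborSet v).ncard + {i | t i = v}.ncard := by
  have h : (glue K L t t').neighborSet (.inl v) =
      Sum.inl '' K.neighborSet v ∪ (Sum.inr ∘ t') '' {i | t i = v} := by
    ext (x | x) <;> simp
  rw [h, Set.ncard_union_eq, Set.ncard_image_of_injective _ Sum.inl_injective,
    Set.ncard_image_of_injective _ (Sum.inr_injective.comp ht')]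
  rw [Set.disjoint_left]
  rintro _ ⟨x, _, rfl⟩ ⟨i, _, h⟩
  cases h

theorem ncard_neighborSet_glue_right [Finite V] [Finite W] {K : SimpleGraph V}
    {L : SimpleGraph W} {t : Fin 4 → V} {t' : Fin 4 → W} (ht' : t'.Injective) (w : W) :
    ((glue K L t t').neighborSet (.inr w)).ncard =
      (L.neighborSet w).ncard + {i | t' i = w}.ncard := by
  have h : (glue K L t t').neighborSet (.inr w) =
      Sum.inr '' L.neighborSet w ∪ (Sum.inl ∘ t) '' {i | t' i = w} := by
    ext (x | x) <;> simp [and_comm]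
  have hs : {i | t' i = w}.Subsingleton := fun i hi j hj => ht' (hi.trans hj.symm)
  rw [h, Set.ncard_union_eq, Set.ncard_image_of_injective _ Sum.inr_injective,
    (hs.injOn _).ncard_image]
  rw [Set.disjoint_left]
  rintro _ ⟨x, _, rfl⟩ ⟨i, _, h⟩
  cases h

theorem ncard_neighborSet_close [Finite V] {K : SimpleGraph V} {t : Fin 4 → V} (ht : t.Injective)
    (hn : ∀ i j, ¬ K.Adj (t i) (t j)) (v : V) :
    ((close K t).neighborSet v).ncard = (K.neighborSet v).ncard + {i | t i = v}.ncard := by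
  let σ : Fin 4 → Fin 4 := ![1, 0, 3, 2]
  have hσ : σ.Injective := by decide
  have h : (close K t).neighborSet v = K.neighborSet v ∪ (t ∘ σ) '' {i | t i = v} := by
    ext x
    have e : ∀ i j, t i = t j ↔ i = j := fun i j => ht.eq_iff
    simp only [SimpleGraph.mem_neighborSet, close_adj, Set.mem_union, Set.mem_image,
      Set.mem_ofPred_eq, Fin.exists_fin_succ, Function.comp_apply]
    simp [σ]
    grind
  rw [h, Set.ncard_union_eq, Set.ncard_image_of_injective _ (ht.comp hσ)]
  rw [Set.disjoint_left]
  rintro _ hx ⟨i, rfl, rfl⟩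
  exact hn _ _ hx

end Girth


/-! ### Straight-line drawings -/

section Drawing

variable {V W : Type*}

/-- A drawing of `G` with straight edges: the segments between adjacent vertices meet only in
common ends. -/
structure IsStraightDrawing (G : SimpleGraph V) (p : V → ℝ × ℝ) : Prop where
  injective : p.Injective
  vertex : ∀ u v w, G.Adj u v → p w ∈ segment ℝ (p u) (p v) → w = u ∨ w = v
  inter : ∀ u v u' v' z, G.Adj u v → G.Adj u' v' → z ∈ segment ℝ (p u) (p v) →
    z ∈ segment ℝ (p u') (p v') → s(u, v) ≠ s(u', v') → ∃ w, z = p w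

namespace IsStraightDrawing

variable {G : SimpleGraph V} {p : V → ℝ × ℝ}

theorem mono {H : SimpleGraph V} (h : IsStraightDrawing H p) (hGH : G ≤ H) :
    IsStraightDrawing G p where
  injective := h.injective
  vertex u v w huv := h.vertex u v w (hGH huv)
  inter u v u' v' z huv huv' := h.inter u v u' v' z (hGH huv) (hGH huv')

theorem isPlanar (h : IsStraightDrawing G p) : IsPlanar G := by
  let arc : Sym2 V → Set (ℝ × ℝ) := Sym2.lift ⟨fun u v => segment ℝ (p u) (p v),
    fun u v => segment_symm ℝ (p u) (p v)⟩
  have harc : ∀ u v, arc s(u, v) = segment ℝ (p u) (p v) := fun _ _ => rfl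
  refine ⟨p, arc, h.injective, ?_, ?_, ?_⟩
  · intro u v huv
    have hne : p v - p u ≠ 0 := sub_ne_zero.2 (h.injective.ne huv.ne')
    refine ⟨⟨⟨fun s => AffineMap.lineMap (p u) (p v) (s : ℝ), by fun_prop⟩, by simp, by simp⟩,
      ?_, ?_⟩
    · intro s s' hs
      have : AffineMap.lineMap (p u) (p v) (s : ℝ) = AffineMap.lineMap (p u) (p v) (s' : ℝ) := hs
      simp only [AffineMap.lineMap_apply_module', add_left_inj] at this
      exact Subtype.ext (smul_left_injective ℝ hne this)
    · rw [harc, segment_eq_image_lineMap]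
      ext z
      simp only [Set.mem_range, Set.mem_image]
      constructor
      · rintro ⟨s, hs⟩
        exact ⟨s, s.2, hs⟩
      · rintro ⟨s, hs, hz⟩
        exact ⟨⟨s, hs⟩, hz⟩
  · intro e
    induction e using Sym2.ind with
    | _ u v =>
      intro huv w hw
      simpa using h.vertex u v w huv hw
  · intro e
    induction e using Sym2.ind with
    | _ u v =>
      intro huv f
      induction f using Sym2.ind with
      | _ u' v' =>
        rintro huv' hne z ⟨hz, hz'⟩
        obtain ⟨w, rfl⟩ := h.inter u v u' v' z huv huv' hz hz' hne
        refine ⟨w, ⟨?_, ?_⟩, rfl⟩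
        · simpa using h.vertex u v w huv hz
        · simpa using h.vertex u' v' w huv' hz'

end IsStraightDrawing

/-- Twice the signed area of the triangle `abc`. -/
def orient {R : Type*} [CommRing R] (a b c : R × R) : R :=
  (b.1 - a.1) * (c.2 - a.2) - (b.2 - a.2) * (c.1 - a.1)

theorem orient_eq_zero_of_mem_segment {a b z : ℝ × ℝ} (hz : z ∈ segment ℝ a b) :
    orient a b z = 0 := by
  obtain ⟨s, s', _, _, h, rfl⟩ := hz
  obtain rfl : s = 1 - s' := by linarith
  simp only [orient, Prod.fst_add, Prod.snd_add, Prod.smul_fst, Prod.smul_snd, smul_eq_mul]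
  ring

/-- The points `c` and `d`, hence all points of the segment between them, lie strictly on one side
of the line `ab`. -/
theorem orient_ne_zero_of_mem_segment {a b c d z : ℝ × ℝ}
    (h : 0 < orient a b c * orient a b d) (hz : z ∈ segment ℝ c d) : orient a b z ≠ 0 := by
  obtain ⟨s, s', hs, hs', hss, rfl⟩ := hz
  have key : orient a b (s • c + s' • d) = s * orient a b c + s' * orient a b d := by
    obtain rfl : s = 1 - s' := by linarith
    simp only [orient, Prod.fst_add, Prod.snd_add, Prod.smul_fst, Prod.smul_snd, smul_eq_mul]
    ring
  rw [key]
  intro h0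
  have h1 : 0 ≤ s * s' * (orient a b c * orient a b d) := by positivity
  have h2 : 0 < orient a b c ^ 2 := by
    have : orient a b c ≠ 0 := left_ne_zero_of_mul h.ne'
    positivity
  have h3 : s * orient a b c ^ 2 + s' * (orient a b c * orient a b d) = 0 := by
    linear_combination orient a b c * h0
  have h4 : 0 ≤ s * orient a b c ^ 2 := by positivity
  have h5 : 0 ≤ s' * (orient a b c * orient a b d) := by positivity
  have h6 : s = 0 := by
    rcases mul_eq_zero.1 (show s * orient a b c ^ 2 = 0 by linarith) with h | h
    · exact h
    · exact absurd h h2.ne'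
  have h7 : s' = 0 := by
    rcases mul_eq_zero.1 (show s' * (orient a b c * orient a b d) = 0 by linarith) with h' | h'
    · exact h'
    · exact absurd h' h.ne'
  linarith

/-- A sufficient condition for the segments `ab` and `cd` to be disjoint: one of them lies strictly
on one side of the line through the other, or they lie at different heights. -/
def Separated {R : Type*} [CommRing R] [LT R] (a b c d : R × R) : Prop :=
  0 < orient a b c * orient a b d ∨ 0 < orient c d a * orient c d b ∨
    (a.2 < c.2 ∧ a.2 < d.2 ∧ b.2 < c.2 ∧ b.2 < d.2) ∨
    (c.2 < a.2 ∧ c.2 < b.2 ∧ d.2 < a.2 ∧ d.2 < b.2)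

instance (a b c d : ℤ × ℤ) : Decidable (Separated a b c d) := inferInstanceAs (Decidable (_ ∨ _))

theorem fst_le_of_mem_segment {c d z : ℝ × ℝ} {x : ℝ} (hc : c.1 ≤ x) (hd : d.1 ≤ x)
    (hz : z ∈ segment ℝ c d) : z.1 ≤ x :=
  (convex_halfSpace_le (LinearMap.fst ℝ ℝ ℝ).isLinear x).segment_subset hc hd hz

theorem le_fst_of_mem_segment {c d z : ℝ × ℝ} {x : ℝ} (hc : x ≤ c.1) (hd : x ≤ d.1)
    (hz : z ∈ segment ℝ c d) : x ≤ z.1 :=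
  (convex_halfSpace_ge (LinearMap.fst ℝ ℝ ℝ).isLinear x).segment_subset hc hd hz

theorem snd_le_of_mem_segment {c d z : ℝ × ℝ} {y : ℝ} (hc : c.2 ≤ y) (hd : d.2 ≤ y)
    (hz : z ∈ segment ℝ c d) : z.2 ≤ y :=
  (convex_halfSpace_le (LinearMap.snd ℝ ℝ ℝ).isLinear y).segment_subset hc hd hz

theorem lt_snd_of_mem_segment {c d z : ℝ × ℝ} {y : ℝ} (hc : y < c.2) (hd : y < d.2)
    (hz : z ∈ segment ℝ c d) : y < z.2 :=
  (convex_halfSpace_gt (LinearMap.snd ℝ ℝ ℝ).isLinear y).segment_subset hc hd hz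

theorem Separated.disjoint {a b c d z : ℝ × ℝ} (h : Separated a b c d) (hz : z ∈ segment ℝ a b)
    (hz' : z ∈ segment ℝ c d) : False := by
  have key : ∀ {a b c d : ℝ × ℝ}, a.2 < c.2 → a.2 < d.2 → b.2 < c.2 → b.2 < d.2 →
      z ∈ segment ℝ a b → z ∈ segment ℝ c d → False := by
    intro a b c d h1 h2 h3 h4 hz hz'
    have := lt_snd_of_mem_segment (max_lt h1 h3) (max_lt h2 h4) hz'
    exact this.not_ge (snd_le_of_mem_segment (le_max_left _ _) (le_max_right _ _) hz)
  rcases h with h | h | ⟨h1, h2, h3, h4⟩ | ⟨h1, h2, h3, h4⟩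
  · exact orient_ne_zero_of_mem_segment h hz' (orient_eq_zero_of_mem_segment hz)
  · exact orient_ne_zero_of_mem_segment h hz (orient_eq_zero_of_mem_segment hz')
  · exact key h1 h2 h3 h4 hz hz'
  · exact key h1 h2 h3 h4 hz' hz

theorem eq_left_of_mem_segment {a b c z : ℝ × ℝ} (h : orient a b c ≠ 0) (hz : z ∈ segment ℝ a b)
    (hz' : z ∈ segment ℝ a c) : z = a := by
  have h0 := orient_eq_zero_of_mem_segment hz
  obtain ⟨s, s', _, _, hs, rfl⟩ := hz'
  obtain rfl : s = 1 - s' := by linarith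
  have h1 : s' * orient a b c = 0 := by
    rw [← h0]
    simp only [orient, Prod.fst_add, Prod.snd_add, Prod.smul_fst, Prod.smul_snd, smul_eq_mul]
    ring
  obtain rfl := (mul_eq_zero.1 h1).resolve_right h
  simp

/-- A sufficient condition for two edges, drawn as segments with the ends given by `q`, to meet
only in a common end. -/
def NonCrossing [DecidableEq V] {R : Type*} [CommRing R] [LT R] (q : V → R × R) (e f : V × V) :
    Prop :=
  (e.1 = f.1 ∧ orient (q e.1) (q e.2) (q f.2) ≠ 0) ∨
  (e.1 = f.2 ∧ orient (q e.1) (q e.2) (q f.1) ≠ 0) ∨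
  (e.2 = f.1 ∧ orient (q e.2) (q e.1) (q f.2) ≠ 0) ∨
  (e.2 = f.2 ∧ orient (q e.2) (q e.1) (q f.1) ≠ 0) ∨
  Separated (q e.1) (q e.2) (q f.1) (q f.2)

instance [DecidableEq V] (q : V → ℤ × ℤ) (e f : V × V) : Decidable (NonCrossing q e f) :=
  inferInstanceAs (Decidable (_ ∨ _))

/-- The point of the plane with the given integral coordinates. -/
def latticePoint (x : ℤ × ℤ) : ℝ × ℝ := (x.1, x.2)

theorem latticePoint_injective : latticePoint.Injective := by
  rintro ⟨a, b⟩ ⟨c, d⟩ h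
  simpa [latticePoint] using h

theorem orient_latticePoint (a b c : ℤ × ℤ) :
    orient (latticePoint a) (latticePoint b) (latticePoint c) = (orient a b c : ℤ) := by
  simp [orient, latticePoint]

theorem Separated.latticePoint {a b c d : ℤ × ℤ} (h : Separated a b c d) :
    Separated (latticePoint a) (latticePoint b) (latticePoint c) (latticePoint d) := by
  unfold Separated at *
  simp only [orient_latticePoint]
  simp only [_root_.latticePoint]
  exact_mod_cast h

theorem NonCrossing.exists_eq [DecidableEq V] {q : V → ℤ × ℤ} {e f : V × V} {z : ℝ × ℝ}
    (h : NonCrossing q e f) (hz : z ∈ segment ℝ (latticePoint (q e.1)) (latticePoint (q e.2)))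
    (hz' : z ∈ segment ℝ (latticePoint (q f.1)) (latticePoint (q f.2))) :
    ∃ w, z = latticePoint (q w) ∧ (w = e.1 ∨ w = e.2) ∧ (w = f.1 ∨ w = f.2) := by
  have key : ∀ {a b c}, orient (q a) (q b) (q c) ≠ 0 → orient (latticePoint (q a))
      (latticePoint (q b)) (latticePoint (q c)) ≠ 0 := fun h => by
    rw [orient_latticePoint]
    exact_mod_cast h
  rcases h with ⟨h, h'⟩ | ⟨h, h'⟩ | ⟨h, h'⟩ | ⟨h, h'⟩ | h
  · rw [← h] at hz'
    exact ⟨e.1, eq_left_of_mem_segment (key h') hz hz', .inl rfl, .inl h⟩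
  · rw [← h, segment_symm] at hz'
    exact ⟨e.1, eq_left_of_mem_segment (key h') hz hz', .inl rfl, .inr h⟩
  · rw [← h] at hz'
    rw [segment_symm] at hz
    exact ⟨e.2, eq_left_of_mem_segment (key h') hz hz', .inr rfl, .inl h⟩
  · rw [← h, segment_symm] at hz'
    rw [segment_symm] at hz
    exact ⟨e.2, eq_left_of_mem_segment (key h') hz hz', .inr rfl, .inr h⟩
  · exact (h.latticePoint.disjoint hz hz').elim

/-- The height of the lower end of an edge. -/
def bottom (q : V → ℤ × ℤ) (e : V × V) : ℤ := min (q e.1).2 (q e.2).2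

/-- The edge `e` crosses none of the edges in the list, which is ordered by height. -/
def clears [DecidableEq V] (q : V → ℤ × ℤ) (e : V × V) : List (V × V) → Bool
  | [] => true
  | f :: es => (decide ((q e.1).2 < bottom q f) && decide ((q e.2).2 < bottom q f)) ||
      decide (NonCrossing q e f) && clears q e es

/-- The edges in the list are ordered by height and do not cross each other. As soon as an edge is
found to lie entirely below another one, the remaining edges need not be examined. -/
def sweep [DecidableEq V] (q : V → ℤ × ℤ) : List (V × V) → Bool
  | [] => true
  | e :: es => (es.head?.all fun f => bottom q e ≤ bottom q f) && clears q e es && sweep q es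

theorem pairwise_of_sweep [DecidableEq V] {q : V → ℤ × ℤ} {es : List (V × V)} (h : sweep q es) :
    es.Pairwise fun e f => bottom q e ≤ bottom q f ∧ NonCrossing q e f := by
  induction es with
  | nil => exact .nil
  | cons e es ih =>
    simp only [sweep, Bool.and_eq_true] at h
    obtain ⟨⟨h1, h2⟩, h3⟩ := h
    have h4 := ih h3
    have hbot : ∀ f ∈ es, bottom q e ≤ bottom q f := by
      cases es with
      | nil => simp
      | cons f es =>
        have h5 : bottom q e ≤ bottom q f := by simpa using h1
        intro g hg
        rcases List.mem_cons.1 hg with rfl | hg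
        · exact h5
        · exact h5.trans ((List.pairwise_cons.1 h4).1 g hg).1
    have hclear : ∀ f ∈ es, NonCrossing q e f := by
      clear h1 h3 ih hbot
      induction es with
      | nil => simp
      | cons f es ih =>
        rw [List.pairwise_cons] at h4
        simp only [clears, Bool.or_eq_true, Bool.and_eq_true, decide_eq_true_iff] at h2
        intro g hg
        rcases h2 with ⟨h5, h6⟩ | h2
        · have h7 : bottom q f ≤ bottom q g := by
            rcases List.mem_cons.1 hg with rfl | hg
            · exact le_rfl
            · exact (h4.1 g hg).1
          have h8 := h5.trans_le h7
          have h9 := h6.trans_le h7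
          rw [bottom, lt_min_iff] at h8 h9
          exact .inr (.inr (.inr (.inr (.inr (.inr (.inl ⟨h8.1, h8.2, h9.1, h9.2⟩))))))
        · rcases List.mem_cons.1 hg with rfl | hg
          · exact h2.1
          · exact ih h2.2 h4.2 g hg
    exact List.pairwise_cons.2 ⟨fun f hf => ⟨hbot f hf, hclear f hf⟩, h4⟩

/-- The conditions on short cycles and degrees ensure that two vertices, or a vertex and an edge,
do not coincide: a vertex has an edge that has no end in common with a given edge or with some edge
at another vertex. -/
theorem isStraightDrawing_of_sweep [DecidableEq V] {G : SimpleGraph V} {q : V → ℤ × ℤ}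
    {es : List (V × V)} (hes : ∀ u v, G.Adj u v → (u, v) ∈ es ∨ (v, u) ∈ es)
    (hG : NoShortCycle G) (hdeg : ∀ v w, ∃ u, u ≠ w ∧ G.Adj v u)
    (h : sweep q es) : IsStraightDrawing G (latticePoint ∘ q) := by
  replace h : es.Pairwise (NonCrossing q) := (pairwise_of_sweep h).imp And.right
  have key : ∀ e ∈ es, ∀ f ∈ es, e ≠ f → ∀ z,
      z ∈ segment ℝ (latticePoint (q e.1)) (latticePoint (q e.2)) →
      z ∈ segment ℝ (latticePoint (q f.1)) (latticePoint (q f.2)) →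
      ∃ w, z = latticePoint (q w) ∧ (w = e.1 ∨ w = e.2) ∧ (w = f.1 ∨ w = f.2) := by
    intro e he f hf hef z hz hz'
    let R : V × V → V × V → Prop := fun e f => NonCrossing q e f ∨ NonCrossing q f e
    have : Std.Symm R := ⟨fun _ _ => Or.symm⟩
    rcases (h.imp (S := R) Or.inl).forall he hf hef with h | h
    · exact h.exists_eq hz hz'
    · obtain ⟨w, h1, h2, h3⟩ := h.exists_eq hz' hz
      exact ⟨w, h1, h3, h2⟩
  have inter : ∀ u v u' v' z, G.Adj u v → G.Adj u' v' →
      z ∈ segment ℝ (latticePoint (q u)) (latticePoint (q v)) →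
      z ∈ segment ℝ (latticePoint (q u')) (latticePoint (q v')) → s(u, v) ≠ s(u', v') →
      ∃ w, z = latticePoint (q w) ∧ (w = u ∨ w = v) ∧ (w = u' ∨ w = v') := by
    intro u v u' v' z h1 h2 hz hz' hne
    have hne' : ¬ (u = u' ∧ v = v') ∧ ¬ (u = v' ∧ v = u') := by
      rw [ne_eq, Sym2.eq_iff] at hne
      tauto
    rcases hes _ _ h1 with h1 | h1 <;> rcases hes _ _ h2 with h2 | h2
    · exact key _ h1 _ h2 (by simp; tauto) z hz hz'
    · obtain ⟨w, hw, h3, h4⟩ := key _ h1 _ h2 (by simp; tauto) z hz (by rwa [segment_symm])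
      exact ⟨w, hw, h3, h4.symm⟩
    · obtain ⟨w, hw, h3, h4⟩ := key _ h1 _ h2 (by simp; tauto) z (by rwa [segment_symm]) hz'
      exact ⟨w, hw, h3.symm, h4⟩
    · obtain ⟨w, hw, h3, h4⟩ := key _ h1 _ h2 (by simp; tauto) z (by rwa [segment_symm])
        (by rwa [segment_symm])
      exact ⟨w, hw, h3.symm, h4.symm⟩
  -- Distinct vertices have incident edges without a common end.
  have hq : q.Injective := by
    intro u v huv
    by_contra hne
    obtain ⟨a, b, hua, hvb, hav, hbu, hab⟩ : ∃ a b, G.Adj u a ∧ G.Adj v b ∧ a ≠ v ∧ b ≠ u ∧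
        a ≠ b := by
      obtain ⟨a, hav, hua⟩ := hdeg u v
      obtain ⟨b, hbu, hvb⟩ := hdeg v u
      by_cases hab : a = b
      · subst hab
        obtain ⟨c, hca, huc⟩ := hdeg u a
        refine ⟨c, a, huc, hvb, ?_, hbu, hca⟩
        rintro rfl
        exact hG.three u c a huc hvb hua.symm
      · exact ⟨a, b, hua, hvb, hav, hbu, hab⟩
    obtain ⟨w, _, h1, h2⟩ := inter u a v b _ hua hvb (left_mem_segment ℝ _ _)
      (huv ▸ left_mem_segment ℝ _ _) (by
        rw [ne_eq, Sym2.eq_iff]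
        tauto)
    rcases h1 with rfl | rfl
    · exact h2.elim hne fun h => hbu h.symm
    · exact h2.elim hav hab
  refine ⟨latticePoint_injective.comp hq, ?_, ?_⟩
  · intro u v w huv hw
    obtain ⟨x, _, hx⟩ := hdeg w w
    by_contra! hne
    obtain ⟨w', hw', h1, _⟩ := inter u v w x _ huv hx hw (left_mem_segment ℝ _ _) (by
      rw [ne_eq, Sym2.eq_iff]
      tauto)
    obtain rfl : w = w' := hq (latticePoint_injective hw')
    tauto
  · intro u v u' v' z huv huv' hz hz' hne
    obtain ⟨w, hw, _⟩ := inter u v u' v' z huv huv' hz hz' hne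
    exact ⟨w, hw⟩

theorem IsStraightDrawing.translate {G : SimpleGraph V} {p : V → ℝ × ℝ}
    (h : IsStraightDrawing G p) (c : ℝ × ℝ) : IsStraightDrawing G fun v => c + p v where
  injective := (add_right_injective c).comp h.injective
  vertex u v w huv hw := h.vertex u v w huv ((mem_segment_translate ℝ c).1 hw)
  inter u v u' v' z huv huv' hz hz' hne := by
    obtain ⟨w, hw⟩ := h.inter u v u' v' (z - c) huv huv'
      ((mem_segment_translate ℝ c).1 (by simpa using hz))
      ((mem_segment_translate ℝ c).1 (by simpa using hz')) hne
    exact ⟨w, by rw [← hw]; simp⟩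

/-- A drawing of `K` to the left of a vertical strip and a drawing of `L` to its right are joined
by segments that cross the strip in the same order on both sides. -/
theorem IsStraightDrawing.glue {K : SimpleGraph V} {L : SimpleGraph W} {t : Fin 4 → V}
    {t' : Fin 4 → W} {p : V → ℝ × ℝ} {q : W → ℝ × ℝ} {a b : Fin 4 → ℝ}
    (hp : IsStraightDrawing K p) (hq : IsStraightDrawing L q) (hpx : ∀ v, (p v).1 ≤ 0)
    (hqx : ∀ w, 1 ≤ (q w).1) (hpt : ∀ i, p (t i) = (0, a i)) (hqt : ∀ i, q (t' i) = (1, b i))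
    (ha : Monotone a) (hb : StrictMono b) :
    IsStraightDrawing (glue K L t t') (Sum.elim p q) := by
  have hK : ∀ {u v z}, z ∈ segment ℝ (p u) (p v) → z.1 ≤ 0 := fun hz =>
    fst_le_of_mem_segment (hpx _) (hpx _) hz
  have hL : ∀ {u v z}, z ∈ segment ℝ (q u) (q v) → 1 ≤ z.1 := fun hz =>
    le_fst_of_mem_segment (hqx _) (hqx _) hz
  have hcut : ∀ {i z}, z ∈ segment ℝ (p (t i)) (q (t' i)) → 0 ≤ z.1 ∧ z.1 ≤ 1 ∧
      z.2 = (1 - z.1) * a i + z.1 * b i := by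
    intro i z hz
    rw [hpt, hqt] at hz
    obtain ⟨s, s', hs, hs', hss, rfl⟩ := hz
    obtain rfl : s = 1 - s' := by linarith
    simp only [Prod.fst_add, Prod.snd_add, Prod.smul_fst, Prod.smul_snd, smul_eq_mul, mul_zero,
      mul_one, zero_add, and_true]
    exact ⟨hs', by linarith⟩
  have hzero : ∀ {i z}, z ∈ segment ℝ (p (t i)) (q (t' i)) → z.1 ≤ 0 → z = p (t i) := by
    intro i z hz h0
    obtain ⟨h1, _, h2⟩ := hcut hz
    have h3 : z.1 = 0 := le_antisymm h0 h1
    rw [hpt]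
    exact Prod.ext h3 (by rw [h2, h3]; simp)
  have hone : ∀ {i z}, z ∈ segment ℝ (p (t i)) (q (t' i)) → 1 ≤ z.1 → z = q (t' i) := by
    intro i z hz h0
    obtain ⟨_, h1, h2⟩ := hcut hz
    have h3 : z.1 = 1 := le_antisymm h1 h0
    rw [hqt]
    exact Prod.ext h3 (by rw [h2, h3]; simp)
  have hpq : ∀ u v, p u ≠ q v := fun u v h => by
    have h1 := hpx u
    have h2 := hqx v
    rw [h] at h1
    linarith
  have vertex : ∀ i w, Sum.elim p q w ∈ segment ℝ (p (t i)) (q (t' i)) →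
      w = .inl (t i) ∨ w = .inr (t' i) := by
    rintro i (w | w) hw
    · exact .inl (congrArg _ (hp.injective (hzero hw (hpx w))))
    · exact .inr (congrArg _ (hq.injective (hone hw (hqx w))))
  refine ⟨?_, ?_, ?_⟩
  · rintro (u | u) (v | v) h
    · exact congrArg _ (hp.injective h)
    · exact absurd h (hpq _ _)
    · exact absurd h.symm (hpq _ _)
    · exact congrArg _ (hq.injective h)
  · rintro (u | u) (v | v) w huv hw
    · rcases w with w | w
      · simpa using hp.vertex u v w huv hw
      · have h1 := hK (z := q w) hw
        have h2 := hqx w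
        linarith
    · obtain ⟨i, rfl, rfl⟩ := huv
      exact vertex i w hw
    · obtain ⟨i, rfl, rfl⟩ := huv
      exact (vertex i w (by rwa [segment_symm])).symm
    · rcases w with w | w
      · have h1 := hL (z := p w) hw
        have h2 := hpx w
        linarith
      · simpa using hq.vertex u v w huv hw
  · have kinds : ∀ x y z, (_root_.glue K L t t').Adj x y →
        z ∈ segment ℝ (Sum.elim p q x) (Sum.elim p q y) →
        (∃ u v, K.Adj u v ∧ s(x, y) = s(.inl u, .inl v) ∧ z ∈ segment ℝ (p u) (p v)) ∨
        (∃ u v, L.Adj u v ∧ s(x, y) = s(.inr u, .inr v) ∧ z ∈ segment ℝ (q u) (q v)) ∨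
        ∃ i, s(x, y) = s(.inl (t i), .inr (t' i)) ∧ z ∈ segment ℝ (p (t i)) (q (t' i)) := by
      rintro (x | x) (y | y) z hxy hz
      · exact .inl ⟨x, y, hxy, rfl, hz⟩
      · obtain ⟨i, rfl, rfl⟩ := hxy
        exact .inr (.inr ⟨i, rfl, hz⟩)
      · obtain ⟨i, rfl, rfl⟩ := hxy
        exact .inr (.inr ⟨i, Sym2.eq_swap, by rwa [segment_symm]⟩)
      · exact .inr (.inl ⟨x, y, hxy, rfl, hz⟩)
    have cuts : ∀ i j z, i < j → z ∈ segment ℝ (p (t i)) (q (t' i)) →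
        z ∈ segment ℝ (p (t j)) (q (t' j)) → z = p (t i) := by
      intro i j z hij hz hz'
      refine hzero hz ?_
      obtain ⟨h1, h2, h3⟩ := hcut hz
      obtain ⟨_, _, h4⟩ := hcut hz'
      have h5 : 0 ≤ (1 - z.1) * (a j - a i) :=
        mul_nonneg (by linarith) (sub_nonneg.2 (ha hij.le))
      by_contra! h6
      have h7 : 0 < z.1 * (b j - b i) := mul_pos h6 (sub_pos.2 (hb hij))
      linarith
    intro x y x' y' z hxy hxy' hz hz' hne
    rcases kinds x y z hxy hz with ⟨u, v, huv, he, hz⟩ | ⟨u, v, huv, he, hz⟩ | ⟨i, he, hz⟩ <;>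
    rcases kinds x' y' z hxy' hz' with ⟨u', v', huv', he', hz'⟩ | ⟨u', v', huv', he', hz'⟩ |
      ⟨j, he', hz'⟩
    · obtain ⟨w, hw⟩ := hp.inter u v u' v' z huv huv' hz hz' (by
        rintro h
        apply hne
        rw [he, he']
        simpa using h)
      exact ⟨.inl w, hw⟩
    · have h1 := hK hz
      have h2 := hL hz'
      linarith
    · exact ⟨.inl (t j), hzero hz' (hK hz)⟩
    · have h1 := hK hz'
      have h2 := hL hz
      linarith
    · obtain ⟨w, hw⟩ := hq.inter u v u' v' z huv huv' hz hz' (by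
        rintro h
        apply hne
        rw [he, he']
        simpa using h)
      exact ⟨.inr w, hw⟩
    · exact ⟨.inr (t' j), hone hz' (hL hz)⟩
    · exact ⟨.inl (t i), hzero hz (hK hz')⟩
    · exact ⟨.inr (t' i), hone hz (hL hz')⟩
    · rcases lt_trichotomy i j with h | rfl | h
      · exact ⟨.inl (t i), cuts i j z h hz hz'⟩
      · exact absurd (he.trans he'.symm) hne
      · exact ⟨.inl (t j), cuts j i z h hz' hz⟩

end Drawing


/-! ### Growing hypohamiltonian graphs -/

section Growth

variable {V W : Type*} {K : SimpleGraph V} {L : SimpleGraph W} {t : Fin 4 → V} {t' r : Fin 4 → W}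

/-- The closed pole can be drawn in a half plane, with its terminals in order on the boundary. -/
def HasPoleDrawing (K : SimpleGraph V) (t : Fin 4 → V) : Prop :=
  ∃ (p : V → ℝ × ℝ) (a : Fin 4 → ℝ), IsStraightDrawing (close K t) p ∧ (∀ v, (p v).1 ≤ 0) ∧
    (∀ i, p (t i) = (0, a i)) ∧ Monotone a

/-- The link, closed on the right, can be drawn in a strip, with its terminals in order on the
two boundary lines. -/
def HasLinkDrawing (L : SimpleGraph W) (t' r : Fin 4 → W) : Prop :=
  ∃ (q : W → ℝ × ℝ) (T : ℝ) (b c : Fin 4 → ℝ), IsStraightDrawing (close L r) q ∧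
    (∀ w, 1 ≤ (q w).1) ∧ (∀ w, (q w).1 ≤ T) ∧ (∀ i, q (t' i) = (1, b i)) ∧
    (∀ i, q (r i) = (T, c i)) ∧ StrictMono b ∧ Monotone c

theorem HasPoleDrawing.glue (hK : HasPoleDrawing K t) (hL : HasLinkDrawing L t' r) :
    HasPoleDrawing (_root_.glue K L t t') (Sum.inr ∘ r) := by
  obtain ⟨p, a, hp, hpx, hpt, ha⟩ := hK
  obtain ⟨q, T, b, c, hq, hqx, hqT, hqt, hqr, hb, hc⟩ := hL
  have h1T : 1 ≤ T := by
    have h1 := hqx (r 0)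
    have h2 := hqT (r 0)
    linarith
  refine ⟨fun x => ((-T, 0) : ℝ × ℝ) + Sum.elim p q x, c, ?_, ?_, ?_, hc⟩
  · rw [close_glue]
    exact ((hp.mono le_close).glue hq hpx hqx hpt hqt ha hb).translate _
  · rintro (x | x)
    · simpa using (hpx x).trans (by linarith)
    · simpa using hqT x
  · intro i
    simp [hqr]

theorem hasPoleDrawing_edge : HasPoleDrawing (⊤ : SimpleGraph (Fin 2)) edgeTerminal := by
  have hinj : Function.Injective fun v : Fin 2 => ((0, (v : ℕ)) : ℝ × ℝ) := by
    intro u v h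
    simpa [Fin.ext_iff] using h
  refine ⟨fun v => (0, (v : ℕ)), fun i => ((edgeTerminal i : Fin 2) : ℕ), ⟨hinj, ?_, ?_⟩,
    fun _ => le_rfl, fun _ => rfl, ?_⟩
  · intro u v w huv _
    have := huv.ne
    omega
  · intro u v u' v' z huv huv' _ _ h
    have h1 := huv.ne
    have h2 := huv'.ne
    rw [ne_eq, Sym2.eq_iff] at h
    omega
  · intro i j hij
    have : edgeTerminal i ≤ edgeTerminal j := by
      revert i j
      decide
    show ((edgeTerminal i : ℕ) : ℝ) ≤ ((edgeTerminal j : ℕ) : ℝ)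
    exact_mod_cast this

/-- The pole obtained from a planar cubic hypohamiltonian graph of girth 5 by removing two edges,
between `t 0` and `t 1` and between `t 2` and `t 3`. -/
structure IsGoodPole (K : SimpleGraph V) (t : Fin 4 → V) : Prop where
  isPole : IsPole K t
  injective : t.Injective
  not_adj : ∀ i j, ¬ K.Adj (t i) (t j)
  degree : ∀ v, (K.neighborSet v).ncard + {i | t i = v}.ncard = 3
  not_hasSpanningCycle : ¬ HasSpanningCycle (close K t) Set.univ
  noShortCycle : NoShortCycle (close K t)
  hasFiveCycle : HasFiveCycle K
  hasPoleDrawing : HasPoleDrawing K t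

/-- The link obtained from a planar cubic hypohamiltonian graph of girth 5 by removing two adjacent
vertices, whose other neighbours are the terminals `t'`, and two edges, between `r 0` and `r 1` and
between `r 2` and `r 3`. -/
structure IsGoodLink (L : SimpleGraph W) (t' r : Fin 4 → W) : Prop where
  isLink : IsLink L t' r
  injective_left : t'.Injective
  injective_right : r.Injective
  ne : ∀ i j, t' i ≠ r j
  not_adj_left : ∀ i j, ¬ L.Adj (t' i) (t' j)
  not_adj_right : ∀ i j, ¬ L.Adj (r i) (r j)
  degree : ∀ w, (L.neighborSet w).ncard + {i | t' i = w}.ncard + {i | r i = w}.ncard = 3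
  not_hasSpanningCycle : ¬ HasSpanningCycle
    (glue (⊤ : SimpleGraph (Fin 2)) (close L r) edgeTerminal t') Set.univ
  noShortCycle : NoShortCycle (glue (⊤ : SimpleGraph (Fin 2)) (close L r) edgeTerminal t')
  hasFiveCycle : HasFiveCycle L
  hasLinkDrawing : HasLinkDrawing L t' r

theorem degree_glue [Finite V] [Finite W] (hL : IsGoodLink L t' r)
    (hK : ∀ v, (K.neighborSet v).ncard + {i | t i = v}.ncard = 3) (x : V ⊕ W) :
    ((glue K L t t').neighborSet x).ncard + {i | (Sum.inr ∘ r) i = x}.ncard = 3 := by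
  rcases x with x | x
  · rw [ncard_neighborSet_glue hL.injective_left, hK]
    simp
  · rw [ncard_neighborSet_glue_right hL.injective_left, ← hL.degree x]
    simp

/-- The base of the construction: the graph from which a link was cut out. -/
theorem IsGoodLink.isGoodPole [Finite W] (hL : IsGoodLink L t' r) :
    IsGoodPole (glue (⊤ : SimpleGraph (Fin 2)) L edgeTerminal t') (Sum.inr ∘ r) where
  isPole := isPole_edge.glue hL.isLink
  injective := Sum.inr_injective.comp hL.injective_right
  not_adj := hL.not_adj_right
  degree := degree_glue hL fun v => by
    have h1 : (⊤ : SimpleGraph (Fin 2)).neighborSet v = {v + 1} := by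
      ext w
      simp
      omega
    have h2 : {i | edgeTerminal i = v} = if v = 0 then {0, 1} else {2, 3} := by
      ext i
      have : edgeTerminal i = v ↔ i ∈ ((if v = 0 then {0, 1} else {2, 3}) : Finset (Fin 4)) := by
        clear h1
        revert i v
        decide
      split_ifs at this ⊢ <;> simpa using this
    rw [h1, h2, Set.ncard_singleton]
    split_ifs <;> rw [Set.ncard_pair (by decide)]
  not_hasSpanningCycle := by
    rw [close_glue]
    exact hL.not_hasSpanningCycle
  noShortCycle := by
    rw [close_glue]
    exact hL.noShortCycle
  hasFiveCycle := hL.hasFiveCycle.map Sum.inr Sum.inr_injective fun _ _ h => h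
  hasPoleDrawing := hasPoleDrawing_edge.glue hL.hasLinkDrawing

theorem IsGoodPole.glue [Finite V] [Finite W] (hK : IsGoodPole K t) (hL : IsGoodLink L t' r) :
    IsGoodPole (_root_.glue K L t t') (Sum.inr ∘ r) where
  isPole := hK.isPole.glue hL.isLink
  injective := Sum.inr_injective.comp hL.injective_right
  not_adj := hL.not_adj_right
  degree := degree_glue hL hK.degree
  not_hasSpanningCycle := by
    rw [close_glue]
    exact not_hasSpanningCycle_glue hK.injective hL.injective_left hK.not_hasSpanningCycle
      hL.not_hasSpanningCycle
  noShortCycle := by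
    rw [close_glue]
    refine NoShortCycle.glue (hK.noShortCycle.comap id Function.injective_id fun _ _ h =>
      le_close h) (hL.noShortCycle.comap Sum.inr Sum.inr_injective fun _ _ h => h)
      hK.injective hL.injective_left fun i j h => ?_
    have h1 := hL.not_adj_left i j
    have h2 := hL.ne i
    have h3 := hL.ne j
    rw [close_adj] at h
    grind
  hasFiveCycle := hK.hasFiveCycle.map Sum.inl Sum.inl_injective fun _ _ h => h
  hasPoleDrawing := hK.hasPoleDrawing.glue hL.hasLinkDrawing

theorem Spans.connected {G : SimpleGraph V} {u v : V} (h : Spans G Set.univ [(u, v)]) :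
    G.Connected := by
  obtain ⟨ls, hls, _, hmem⟩ := h
  obtain ⟨l, hl, rfl⟩ : ∃ l, IsListPath G l u v ∧ ls = [l] := by
    cases hls with
    | cons hl hls => cases hls; exact ⟨_, hl, rfl⟩
  have : Trans G.Reachable G.Reachable G.Reachable := ⟨fun h h' => h.trans h'⟩
  have hp : l.Pairwise G.Reachable :=
    List.isChain_iff_pairwise.1 (hl.chain.imp fun _ _ h => h.reachable)
  have : Std.Symm G.Reachable := ⟨fun _ _ h => h.symm⟩
  have hmem' : ∀ w, w ∈ l := by simpa using hmem
  have : Nonempty V := ⟨u⟩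
  refine ⟨fun x y => ?_⟩
  by_cases hxy : x = y
  · rw [hxy]
  · exact hp.forall (hmem' x) (hmem' y) hxy

theorem IsGoodPole.isPlanarCubicHypohamiltonianOfGirthFive [Fintype V] (hK : IsGoodPole K t) :
    IsPlanarCubicHypohamiltonianOfGirthFive (close K t) where
  connected := (hK.isPole.cross 0 2 (by decide)).connected.mono le_close
  planar := by
    obtain ⟨p, a, hp, _⟩ := hK.hasPoleDrawing
    exact hp.isPlanar
  cubic v := by rw [ncard_neighborSet_close hK.injective hK.not_adj, hK.degree]
  hypohamiltonian := by
    classical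
    have hcard : 4 ≤ Fintype.card V := by
      simpa using Fintype.card_le_of_injective t hK.injective
    refine ⟨fun h => hK.not_hasSpanningCycle (.of_isHamiltonian h (by omega)), fun v => ?_⟩
    apply HasSpanningCycle.isHamiltonian_induce
    · have h : ({w : V | w ≠ v}) = {v}ᶜ := rfl
      rw [h]
      have hne : ∀ {i j}, i ≠ j → t i ≠ t j := fun h => hK.injective.ne h
      rcases hK.isPole.delete v with h | h
      · exact ⟨_, _, by simp [close_adj, hne], h.mono le_close⟩
      · exact ⟨_, _, by simp [close_adj, hne], h.mono le_close⟩
    · simp only [Set.coe_ofPred, ne_eq, Fintype.card_subtype_compl, Fintype.card_subtype_eq]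
      omega
  girth_eq := girth_eq_five hK.noShortCycle
    (hK.hasFiveCycle.map id Function.injective_id fun _ _ h => le_close h)

theorem IsPlanar.of_iso {G : SimpleGraph V} {H : SimpleGraph W} (hG : IsPlanar G) (e : G ≃g H) :
    IsPlanar H := by
  obtain ⟨p, arc, h1, h2, h3, h4⟩ := hG
  refine ⟨p ∘ e.symm, arc ∘ Sym2.map e.symm, h1.comp e.symm.injective, ?_, ?_, ?_⟩
  · intro u v huv
    exact h2 _ _ (e.symm.map_adj_iff.2 huv)
  · intro f hf w hw
    have := h3 _ (e.symm.map_mem_edgeSet_iff.2 hf) _ hw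
    rw [Sym2.mem_map] at this
    obtain ⟨x, hx, hxw⟩ := this
    rwa [← e.symm.injective hxw]
  · intro f hf f' hf' hne z hz
    obtain ⟨x, ⟨hx, hx'⟩, rfl⟩ := h4 _ (e.symm.map_mem_edgeSet_iff.2 hf) _
      (e.symm.map_mem_edgeSet_iff.2 hf') ((Sym2.map.injective e.symm.injective).ne hne) hz
    refine ⟨e x, ⟨?_, ?_⟩, by simp⟩
    · obtain ⟨y, hy, rfl⟩ := Sym2.mem_map.1 hx
      simpa using hy
    · obtain ⟨y, hy, rfl⟩ := Sym2.mem_map.1 hx'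
      simpa using hy

theorem SimpleGraph.IsHamiltonian.of_iso [Fintype V] [Fintype W] [DecidableEq V] [DecidableEq W]
    {G : SimpleGraph V} {H : SimpleGraph W} (hG : G.IsHamiltonian) (e : G ≃g H) :
    H.IsHamiltonian := by
  intro hW
  obtain ⟨a, p, hp⟩ := hG (by rwa [Fintype.card_congr e.toEquiv])
  exact ⟨_, p.map e.toHom, hp.map e.bijective⟩

theorem IsPlanarCubicHypohamiltonianOfGirthFive.of_iso [Fintype V] [Fintype W]
    {G : SimpleGraph V} {H : SimpleGraph W} (hG : IsPlanarCubicHypohamiltonianOfGirthFive G)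
    (e : G ≃g H) : IsPlanarCubicHypohamiltonianOfGirthFive H where
  connected := e.connected_iff.1 hG.connected
  planar := hG.planar.of_iso e
  cubic w := by
    have h : H.neighborSet w = e '' G.neighborSet (e.symm w) := by
      ext x
      obtain ⟨y, rfl⟩ := e.surjective x
      simp [← e.symm.map_adj_iff (v := w)]
    rw [h, Set.ncard_image_of_injective _ e.injective]
    exact hG.cubic _
  hypohamiltonian := by
    classical
    refine ⟨fun h => hG.hypohamiltonian.1 ?_, fun w => ?_⟩
    · convert h.of_iso e.symm
    · have h := hG.hypohamiltonian.2 (e.symm w)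
      have hb : Set.BijOn e {x | x ≠ e.symm w} {x | x ≠ w} := by
        refine ⟨fun x hx h => hx ?_, e.injective.injOn, fun x hx => ⟨e.symm x, fun h => hx ?_, ?_⟩⟩
        · rw [← h, e.symm_apply_apply]
        · exact e.symm.injective h
        · exact e.apply_symm_apply x
      convert h.of_iso (e.induce hb)
  girth_eq := e.girth_eq.symm.trans hG.girth_eq

/-- A link with `n` vertices allows to build arbitrarily large good poles on any good pole. -/
theorem IsGoodPole.exists_card {n : ℕ} {L : SimpleGraph (Fin n)} {t' r : Fin 4 → Fin n}
    (hL : IsGoodLink L t' r) (k : ℕ) :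
    ∀ {V : Type} [Fintype V] {K : SimpleGraph V} {t : Fin 4 → V}, IsGoodPole K t →
      ∃ G : SimpleGraph (Fin (n * k + Fintype.card V)),
        IsPlanarCubicHypohamiltonianOfGirthFive G := by
  induction k with
  | zero =>
    intro V _ K t hK
    have h : Fintype.card V = n * 0 + Fintype.card V := by omega
    exact ⟨_, hK.isPlanarCubicHypohamiltonianOfGirthFive.of_iso
      ((close K t).overFinIso h)⟩
  | succ k ih =>
    intro V _ K t hK
    obtain ⟨G, hG⟩ := ih (hK.glue hL)
    have h : n * k + Fintype.card (V ⊕ Fin n) = n * (k + 1) + Fintype.card V := by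
      rw [Fintype.card_sum, Fintype.card_fin]
      ring
    rw [← h]
    exact ⟨G, hG⟩

end Growth


/-! ### Refuting sidednesses -/

section Refutation

open Finset

variable {V : Type*} [Fintype V] {G : SimpleGraph V} {m : ℕ}

/-- The faces in the bit mask `A` are among those in the bit mask `P`. -/
def maskLE (A P : ℕ) : Bool := Nat.beq (Nat.land A P) A

theorem testBit_of_maskLE {A P i : ℕ} (h : maskLE A P) (hi : A.testBit i) : P.testBit i := by
  have h1 : A &&& P = A := Nat.eq_of_beq_eq_true h
  rw [← h1, Nat.testBit_and] at hi
  simp_all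

/-- Data for a proof that no colouring of the `m` faces is a sidedness. -/
structure Refutation where
  /-- The sets of the three faces at the vertices, as bit masks. -/
  corners : List ℕ
  /-- Faces whose size is not 2 modulo 3, with the excess of their size over 2 modulo 3. -/
  exceptional : List (ℕ × ℕ)
  /-- Sets of faces, as bit masks, each with a set that contains all faces adjacent to it. -/
  closed : List (ℕ × ℕ)
  /-- The number of vertices minus two, modulo 3. -/
  residue : ℕ

namespace Refutation

variable (R : Refutation)

/-- Some vertex has all its faces in `P`. -/
def mono (P : ℕ) : Bool :=
  R.corners.any fun t => maskLE t P

/-- Some set of faces lies in `P` while the faces around it lie in `Q`. -/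
def isolated (P Q : ℕ) : Bool :=
  R.closed.any fun c => maskLE c.1 P && maskLE c.2 Q

/-- All exceptional faces are coloured, and Grinberg's equation fails modulo 3. -/
def unbalanced (P Q : ℕ) : Bool :=
  (R.exceptional.all fun e => P.testBit e.1 || Q.testBit e.1) &&
    (R.exceptional.map fun e => if P.testBit e.1 then e.2 else 0).sum % 3 != R.residue % 3

/-- Some pair in the list has one member in `P` and the other in `Q`. -/
def splits (same : List (ℕ × ℕ)) (P Q : ℕ) : Bool :=
  same.any fun e => P.testBit e.1 && Q.testBit e.2 || Q.testBit e.1 && P.testBit e.2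

/-- No sidedness has the faces in `P` on one side and the faces in `Q` on the other, and the two
faces of each pair in `same` on one side. -/
def bad (same : List (ℕ × ℕ)) (P Q : ℕ) : Bool :=
  splits same P Q || R.mono P || R.mono Q || R.isolated P Q || R.isolated Q P || R.unbalanced P Q

/-- A search through the colourings of the faces in the list, given that those in `P` and `Q` are
already coloured; the result is `true` if the search finds that there is no sidedness that agrees
on the pairs in `same`. -/
def search (same : List (ℕ × ℕ)) : List ℕ → ℕ → ℕ → Bool
  | [], P, Q => R.bad same P Q
  | f :: fs, P, Q => R.bad same P Q ||
      (search same fs (P ||| 1 <<< f) Q && search same fs P (Q ||| 1 <<< f))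

/-- The first set of the pair is closed up to the second one under passing to an adjacent face, and
it is neither empty nor does it meet the set of faces at every vertex. -/
def isClosed (c : ℕ × ℕ) : Bool :=
  (R.corners.all fun t => Nat.beq (Nat.land t c.1) 0 || maskLE t (c.1 ||| c.2)) &&
    (R.corners.any fun t => !Nat.beq (Nat.land t c.1) 0) &&
      R.corners.any fun t => Nat.beq (Nat.land t c.1) 0

/-- The set of the faces at a vertex, as a bit mask. -/
def cornerMask (Φ : FaceSystem G (Fin m)) (v : V) : ℕ :=
  1 <<< (Φ.corner v 0 : ℕ) ||| 1 <<< (Φ.corner v 1 : ℕ) ||| 1 <<< (Φ.corner v 2 : ℕ)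

theorem testBit_cornerMask {Φ : FaceSystem G (Fin m)} {v : V} {f : ℕ} :
    (cornerMask Φ v).testBit f ↔ ∃ i, (Φ.corner v i : ℕ) = f := by
  simp only [cornerMask, Nat.one_shiftLeft, Nat.testBit_or, Nat.testBit_two_pow, Bool.or_eq_true,
    decide_eq_true_iff, Fin.exists_fin_succ]
  simp [or_assoc]

/-- The data belong to the given face system. -/
structure Fits (Φ : FaceSystem G (Fin m)) : Prop where
  mem_corners : ∀ t ∈ R.corners, ∃ v, cornerMask Φ v = t
  cornerMask_mem : ∀ v, cornerMask Φ v ∈ R.corners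
  closed_spec : ∀ c ∈ R.closed, R.isClosed c
  lt : ∀ e ∈ R.exceptional, e.1 < m
  degree : ∀ f : Fin m, #{x : V × Fin 3 | Φ.corner x.1 x.2 = f} % 3 =
    (2 + (R.exceptional.map fun e => if e.1 = (f : ℕ) then e.2 else 0).sum) % 3
  residue_eq : Fintype.card V % 3 = (R.residue + 2) % 3

variable {R} {Φ : FaceSystem G (Fin m)} {s : Fin m → Bool} {P Q : ℕ} {b : Bool}
  {same : List (ℕ × ℕ)}

theorem not_splits (hsame : ∀ e ∈ same, ∀ f g : Fin m, e = ((f : ℕ), (g : ℕ)) → s f = s g)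
    (hlt : ∀ e ∈ same, e.1 < m ∧ e.2 < m) (hP : ∀ f : Fin m, P.testBit f → s f = true)
    (hQ : ∀ f : Fin m, Q.testBit f → s f = false) : splits same P Q = false := by
  by_contra h
  simp only [splits, Bool.not_eq_false, List.any_eq_true, Bool.and_eq_true, Bool.or_eq_true] at h
  obtain ⟨⟨f, g⟩, he, h⟩ := h
  obtain ⟨hf, hg⟩ := hlt _ he
  have h1 := hsame _ he ⟨f, hf⟩ ⟨g, hg⟩ rfl
  rcases h with ⟨h2, h3⟩ | ⟨h2, h3⟩
  · rw [hP ⟨f, hf⟩ h2, hQ ⟨g, hg⟩ h3] at h1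
    cases h1
  · rw [hQ ⟨f, hf⟩ h2, hP ⟨g, hg⟩ h3] at h1
    cases h1

theorem Fits.not_mono (hR : R.Fits Φ) (hs : Φ.IsSidedness s)
    (hP : ∀ f : Fin m, P.testBit f → s f = b) : R.mono P = false := by
  by_contra h
  simp only [mono, Bool.not_eq_false, List.any_eq_true] at h
  obtain ⟨t, ht, h⟩ := h
  obtain ⟨v, rfl⟩ := hR.mem_corners t ht
  obtain ⟨i, hi⟩ := hs.not_mono v (!b)
  have h3 : s (Φ.corner v i) = b :=
    hP _ (testBit_of_maskLE h (testBit_cornerMask.2 ⟨i, rfl⟩))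
  simp [hi] at h3

theorem Fits.not_isolated (hR : R.Fits Φ) (hs : Φ.IsSidedness s)
    (hP : ∀ f : Fin m, P.testBit f → s f = b) (hQ : ∀ f : Fin m, Q.testBit f → s f = !b) :
    R.isolated P Q = false := by
  by_contra h
  simp only [isolated, Bool.not_eq_false, List.any_eq_true, Bool.and_eq_true] at h
  obtain ⟨c, hc, h1, h2⟩ := h
  have h3 := hR.closed_spec c hc
  simp only [isClosed, Bool.and_eq_true, List.all_eq_true, List.any_eq_true, Bool.or_eq_true,
    Bool.not_eq_true', Nat.beq_eq] at h3
  obtain ⟨⟨h3, t, ht, hne⟩, t', ht', heq⟩ := h3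
  obtain ⟨w, rfl⟩ := hR.mem_corners t' ht'
  have hout : ∀ {t f : ℕ}, t &&& c.1 = 0 → t.testBit f → ¬ c.1.testBit f := by
    intro t f ht hf hf'
    rw [Nat.eq_iff_testBit_eq] at ht
    simpa [hf, hf'] using ht f
  have hne' : t &&& c.1 ≠ 0 := fun h => by
    rw [show Nat.land t c.1 = 0 from h] at hne
    cases hne
  obtain ⟨f, hf⟩ := Nat.exists_testBit_of_ne_zero hne'
  rw [Nat.testBit_and, Bool.and_eq_true] at hf
  obtain ⟨v, rfl⟩ := hR.mem_corners t ht
  obtain ⟨i, rfl⟩ := testBit_cornerMask.1 hf.1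
  obtain ⟨j, hj⟩ := hs.not_mono w b
  refine hout heq (testBit_cornerMask.2 ⟨j, rfl⟩) (hs.connected b {f | c.1.testBit f} ⟨_, hf.2⟩
    (fun f hf => hP f (testBit_of_maskLE h1 hf)) ?_ _ hj)
  intro v i j hi hj
  rcases h3 _ (hR.cornerMask_mem v) with h4 | h4
  · exact (hout h4 (testBit_cornerMask.2 ⟨i, rfl⟩) hi).elim
  · have h5 := testBit_of_maskLE h4 (testBit_cornerMask.2 ⟨j, rfl⟩)
    rw [Nat.testBit_or, Bool.or_eq_true] at h5
    refine h5.resolve_right fun h5 => ?_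
    have := hQ _ (testBit_of_maskLE h2 h5)
    simp [hj] at this

/-- Over the faces on the side `true`, the excesses sum up to those of the exceptional faces in
`P`. -/
theorem sum_filter_exceptional (l : List (ℕ × ℕ)) (hl : ∀ e ∈ l, e.1 < m)
    (hs : ∀ e ∈ l, ∀ f : Fin m, e.1 = (f : ℕ) → (s f = true ↔ P.testBit e.1)) :
    ∑ f with s f = true, (l.map fun e => if e.1 = (f : ℕ) then e.2 else 0).sum =
      (l.map fun e => if P.testBit e.1 then e.2 else 0).sum := by
  induction l with
  | nil => simp
  | cons e l ih =>
    simp only [List.map_cons, List.sum_cons, Finset.sum_add_distrib]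
    rw [ih (fun e he => hl e (.tail _ he)) (fun e he => hs e (.tail _ he))]
    congr 1
    have he := hl e (.head _)
    have h1 : ∀ f : Fin m, e.1 = (f : ℕ) ↔ f = ⟨e.1, he⟩ := fun f => by
      rw [Fin.ext_iff, eq_comm]
    simp only [h1, Finset.sum_ite_eq', Finset.mem_filter, Finset.mem_univ, true_and]
    simp only [hs e (.head _) ⟨e.1, he⟩ rfl]

theorem Fits.not_unbalanced (hR : R.Fits Φ) (hs : Φ.IsSidedness s)
    (hP : ∀ f : Fin m, P.testBit f → s f = true) (hQ : ∀ f : Fin m, Q.testBit f → s f = false) :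
    R.unbalanced P Q = false := by
  by_contra h
  simp only [unbalanced, Bool.not_eq_false, List.all_eq_true, Bool.and_eq_true, Bool.or_eq_true,
    bne_iff_ne, ne_eq] at h
  obtain ⟨h1, h2⟩ := h
  apply h2
  rw [← sum_filter_exceptional (s := s) R.exceptional hR.lt]
  · have h3 := hs.grinberg true
    rw [Finset.card_eq_sum_card_fiberwise (f := fun x => Φ.corner x.1 x.2)
      (t := Finset.univ.filter fun f => s f = true) (by intro x; simp)] at h3
    have h4 : ∀ f ∈ Finset.univ.filter (fun f => s f = true),
        #{x ∈ (Finset.univ : Finset (V × Fin 3)).filter (fun x => s (Φ.corner x.1 x.2) = true) |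
          Φ.corner x.1 x.2 = f} ≡
        2 + (R.exceptional.map fun e => if e.1 = (f : ℕ) then e.2 else 0).sum [MOD 3] := by
      intro f hf
      refine Nat.ModEq.trans ?_ (hR.degree f)
      rw [Finset.filter_filter]
      refine congrArg (fun A : Finset _ => #A % 3) ?_
      ext x
      simp only [Finset.mem_filter, Finset.mem_univ, true_and] at hf ⊢
      constructor
      · exact fun h => h.2
      · exact fun h => ⟨h ▸ hf, h⟩
    have h5 := Nat.ModEq.sum h4
    rw [Finset.sum_add_distrib, Finset.sum_const, smul_eq_mul] at h5
    have h6 := hR.residue_eq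
    unfold Nat.ModEq at h5
    omega
  · intro e he f hef
    constructor
    · intro h
      rcases h1 e he with h' | h'
      · exact h'
      · rw [hef] at h'
        simp [hQ f h'] at h
    · intro h
      exact hP f (hef ▸ h)

theorem Fits.not_bad (hR : R.Fits Φ) (hs : Φ.IsSidedness s)
    (hsame : ∀ e ∈ same, ∀ f g : Fin m, e = ((f : ℕ), (g : ℕ)) → s f = s g)
    (hlt : ∀ e ∈ same, e.1 < m ∧ e.2 < m)
    (hP : ∀ f : Fin m, P.testBit f → s f = true) (hQ : ∀ f : Fin m, Q.testBit f → s f = false) :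
    R.bad same P Q = false := by
  rw [bad, not_splits hsame hlt hP hQ, hR.not_mono hs hP, hR.not_mono hs hQ,
    hR.not_isolated hs hP hQ,
    hR.not_isolated hs hQ hP, hR.not_unbalanced hs hP hQ]
  rfl

theorem Fits.not_search (hR : R.Fits Φ) (hs : Φ.IsSidedness s)
    (hsame : ∀ e ∈ same, ∀ f g : Fin m, e = ((f : ℕ), (g : ℕ)) → s f = s g)
    (hlt : ∀ e ∈ same, e.1 < m ∧ e.2 < m) (fs : List ℕ) :
    ∀ P Q : ℕ, (∀ f : Fin m, P.testBit f → s f = true) →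
      (∀ f : Fin m, Q.testBit f → s f = false) → R.search same fs P Q = false := by
  have hbit : ∀ {A f : ℕ} {g : Fin m}, (A ||| 1 <<< f).testBit g → A.testBit g ∨ f = (g : ℕ) := by
    intro A f g h
    rw [Nat.one_shiftLeft, Nat.testBit_or, Nat.testBit_two_pow] at h
    simpa using h
  induction fs with
  | nil => exact fun P Q hP hQ => hR.not_bad hs hsame hlt hP hQ
  | cons f fs ih =>
    intro P Q hP hQ
    rw [search, hR.not_bad hs hsame hlt hP hQ, Bool.false_or, Bool.and_eq_false_iff]
    by_cases hf : ∀ g : Fin m, f = (g : ℕ) → s g = true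
    · exact .inl (ih _ _ (fun g hg => (hbit hg).elim (hP g) (hf g)) hQ)
    · push Not at hf
      obtain ⟨g, rfl, hg⟩ := hf
      refine .inr (ih _ _ hP fun g' hg' => (hbit hg').elim (hQ g') fun h => ?_)
      rw [← Fin.ext h]
      simpa using hg

/-- A successful search shows that the graph has no Hamiltonian cycle that avoids the edges between
the faces in the list `same`. The face `f` may be assumed to lie on a given side. -/
theorem Fits.not_isHamiltonian [DecidableEq V] (hR : R.Fits Φ) (f : ℕ) (fs : List ℕ)
    (h : R.search same fs (1 <<< f) 0 = true) (hV : Fintype.card V ≠ 1) {H : SimpleGraph V}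
    (hHG : H ≤ G) (hsame : ∀ e ∈ same, ∃ v i, ¬ H.Adj v (Φ.nbr v i) ∧
      e = ((Φ.corner v (i + 1) : ℕ), (Φ.corner v (i + 2) : ℕ))) : ¬ H.IsHamiltonian := by
  intro hH
  obtain ⟨s, hs, hs'⟩ := Φ.exists_isSidedness hHG hH hV
  obtain ⟨s, hs, hs', hf⟩ : ∃ s, Φ.IsSidedness s ∧ (∀ v i, ¬ H.Adj v (Φ.nbr v i) →
      s (Φ.corner v (i + 1)) = s (Φ.corner v (i + 2))) ∧
      ∀ g : Fin m, f = (g : ℕ) → s g = true := by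
    by_cases hf : ∀ g : Fin m, f = (g : ℕ) → s g = true
    · exact ⟨s, hs, hs', hf⟩
    · push Not at hf
      obtain ⟨g, rfl, hg⟩ := hf
      refine ⟨_, hs.not, fun v i hi => by rw [hs' v i hi], fun g' hg' => ?_⟩
      rw [← Fin.ext hg']
      simpa using hg
  rw [hR.not_search hs ?_ ?_ fs _ 0 ?_ (by simp)] at h
  · cases h
  · intro e he f g hfg
    obtain ⟨v, i, hv, he'⟩ := hsame e he
    rw [hfg, Prod.mk.injEq, ← Fin.ext_iff, ← Fin.ext_iff] at he'
    rw [he'.1, he'.2, hs' v i hv]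
  · intro e he
    obtain ⟨v, i, _, rfl⟩ := hsame e he
    exact ⟨Fin.is_lt _, Fin.is_lt _⟩
  · intro g hg
    rw [Nat.one_shiftLeft, Nat.testBit_two_pow] at hg
    exact hf g (by simpa using hg)

end Refutation

end Refutation


/-! ### Cubic graphs given by tables -/

section Table

open Finset

/-- The graph in which `nbr u 0`, `nbr u 1` and `nbr u 2` are the neighbours of `u`. -/
def nbrGraph {V : Type*} (nbr : V → Fin 3 → V) : SimpleGraph V :=
  SimpleGraph.fromRel fun u v => ∃ i, nbr u i = v

/-- The conditions on `nbr` under which the graph `nbrGraph nbr` is cubic with the given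
neighbours. -/
structure IsNbrTable {V : Type*} (nbr : V → Fin 3 → V) : Prop where
  injective : ∀ u i j, nbr u i = nbr u j → i = j
  ne : ∀ u i, nbr u i ≠ u
  symm : ∀ u i, ∃ j, nbr (nbr u i) j = u

namespace IsNbrTable

variable {V : Type*} {nbr : V → Fin 3 → V} (h : IsNbrTable nbr)

include h

theorem adj_iff (u v : V) : (nbrGraph nbr).Adj u v ↔ ∃ i, nbr u i = v := by
  rw [nbrGraph, SimpleGraph.fromRel_adj]
  constructor
  · rintro ⟨_, h1 | ⟨i, rfl⟩⟩
    · exact h1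
    · exact h.symm v i
  · rintro ⟨i, rfl⟩
    exact ⟨(h.ne u i).symm, .inl ⟨i, rfl⟩⟩

theorem ncard_neighborSet (u : V) : ((nbrGraph nbr).neighborSet u).ncard = 3 := by
  have h1 : (nbrGraph nbr).neighborSet u = nbr u '' Set.univ := by
    ext v
    simp [h.adj_iff]
  rw [h1, Set.ncard_image_of_injective _ fun i j => h.injective u i j]
  simp

theorem noShortCycle (three : ∀ u i j k, nbr (nbr (nbr u i) j) k ≠ u)
    (four : ∀ u i i' j j', i < i' → nbr (nbr u i) j = nbr (nbr u i') j' →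
      nbr (nbr u i) j = u) : NoShortCycle (nbrGraph nbr) where
  three a b c := by
    simp only [h.adj_iff]
    rintro ⟨i, rfl⟩ ⟨j, rfl⟩ ⟨k, h1⟩
    exact three a i j k h1
  four a b c d hac hbd hab hbc hcd hda := by
    obtain ⟨i, rfl⟩ := (h.adj_iff _ _).1 hab
    obtain ⟨i', rfl⟩ := (h.adj_iff _ _).1 hda.symm
    obtain ⟨j, rfl⟩ := (h.adj_iff _ _).1 hbc
    obtain ⟨j', h1⟩ := (h.adj_iff _ _).1 hcd.symm
    rcases lt_trichotomy i i' with h2 | rfl | h2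
    · exact hac (four a i i' j j' h2 h1.symm).symm
    · exact hbd rfl
    · exact hac ((four a i' i j' j h2 h1).symm.trans h1)

end IsNbrTable

/-- The graph `G` without the edges between `r 0` and `r 1` and between `r 2` and `r 3`. -/
def unclose {V : Type*} (G : SimpleGraph V) (r : Fin 4 → V) : SimpleGraph V :=
  G.deleteEdges {s(r 0, r 1), s(r 2, r 3)}

theorem close_unclose {V : Type*} {G : SimpleGraph V} {r : Fin 4 → V} (h01 : G.Adj (r 0) (r 1))
    (h23 : G.Adj (r 2) (r 3)) : close (unclose G r) r = G := by
  ext u v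
  have := SimpleGraph.adj_comm G
  have hu := G.ne_of_adj (a := u) (b := v)
  rw [close_adj, unclose, SimpleGraph.deleteEdges_adj]
  simp only [Set.mem_insert_iff, Set.mem_singleton_iff, Sym2.eq_iff]
  grind

theorem not_adj_unclose {V : Type*} {G : SimpleGraph V} {r : Fin 4 → V} (hr : r.Injective)
    (hG : ∀ i j, i < 2 → 2 ≤ j → ¬ G.Adj (r i) (r j)) (i j : Fin 4) :
    ¬ (unclose G r).Adj (r i) (r j) := by
  intro hij
  rw [unclose, SimpleGraph.deleteEdges_adj] at hij
  obtain ⟨h2, h3⟩ := hij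
  simp only [Set.mem_insert_iff, Set.mem_singleton_iff, Sym2.eq_iff, hr.eq_iff] at h3
  have h4 := hG i j
  have h5 := hG j i
  have h6 := h2.symm
  have h7 := G.ne_of_adj h2
  rw [hr.ne_iff] at h7
  have : (i < 2 ∧ 2 ≤ j) ∨ (j < 2 ∧ 2 ≤ i) := by
    clear h2 h4 h5 h6
    revert i j
    decide
  rcases this with ⟨hi, hj⟩ | ⟨hi, hj⟩
  · exact h4 hi hj h2
  · exact h5 hi hj h6

/-- The part of the graph `H` on `n + 2` vertices that is spanned by its first `n` vertices,
without the edges between `r 0` and `r 1` and between `r 2` and `r 3`. -/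
def cut {n : ℕ} (H : SimpleGraph (Fin (n + 2))) (r : Fin 4 → Fin n) : SimpleGraph (Fin n) :=
  unclose (H.comap (Fin.castAdd 2)) r

/-- The last two vertices of `H` are adjacent and have `t'` as their other neighbours, and the edges
to be removed from the remaining graph are far enough from each other and from `t'`. -/
structure IsCut {n : ℕ} (H : SimpleGraph (Fin (n + 2))) (t' r : Fin 4 → Fin n) : Prop where
  injective_left : t'.Injective
  injective_right : r.Injective
  ne : ∀ i j, t' i ≠ r j
  not_adj_left : ∀ i j, ¬ H.Adj (Fin.castAdd 2 (t' i)) (Fin.castAdd 2 (t' j))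
  not_adj_right : ∀ i j, i < 2 → 2 ≤ j → ¬ H.Adj (Fin.castAdd 2 (r i)) (Fin.castAdd 2 (r j))
  adj_right : ∀ i j, i + 1 = j → i ≠ 1 → j ≠ 0 → H.Adj (Fin.castAdd 2 (r i)) (Fin.castAdd 2 (r j))
  adj : H.Adj (Fin.natAdd n 0) (Fin.natAdd n 1)
  adj_left : ∀ i w, H.Adj (Fin.natAdd n i) (Fin.castAdd 2 w) ↔
    ∃ j, edgeTerminal j = i ∧ t' j = w

namespace IsCut

variable {n : ℕ} {H : SimpleGraph (Fin (n + 2))} {t' r : Fin 4 → Fin n}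

theorem close_cut (h : IsCut H t' r) : close (cut H r) r = H.comap (Fin.castAdd 2) :=
  close_unclose (G := H.comap (Fin.castAdd 2)) (h.adj_right 0 1 (by decide) (by decide) (by decide))
    (h.adj_right 2 3 (by decide) (by decide) (by decide))

theorem not_adj_cut_right (h : IsCut H t' r) (i j : Fin 4) : ¬ (cut H r).Adj (r i) (r j) :=
  not_adj_unclose (G := H.comap (Fin.castAdd 2)) h.injective_right h.not_adj_right i j

/-- Gluing a single edge to the cut graph gives back the graph. -/
def iso (h : IsCut H t' r) :
    glue (⊤ : SimpleGraph (Fin 2)) (close (cut H r) r) edgeTerminal t' ≃g H where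
  toEquiv := (Equiv.sumComm _ _).trans finSumFinEquiv
  map_rel_iff' := by
    rw [h.close_cut]
    rintro (x | x) (y | y)
    · have := h.adj
      simp
      fin_cases x <;> fin_cases y <;> simp_all [H.adj_comm]
    · simpa using h.adj_left x y
    · simpa [H.adj_comm] using h.adj_left y x
    · rfl

end IsCut

end Table


/-! ### Certificates for spanning paths -/

section Certificate

variable {n : ℕ}

/-- The list `l` has no repetitions, avoids the vertices in the bit mask `m`, and contains all the
other vertices. -/
def exhausts : List (Fin n) → ℕ → Bool
  | [], m => m == 2 ^ n - 1
  | v :: l, m => !m.testBit v && exhausts l (m ||| 1 <<< (v : ℕ))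

theorem testBit_or_shiftLeft {m : ℕ} {v w : Fin n} :
    (m ||| 1 <<< (v : ℕ)).testBit w ↔ m.testBit w ∨ w = v := by
  rw [Nat.one_shiftLeft, Nat.testBit_or, Nat.testBit_two_pow, Bool.or_eq_true, decide_eq_true_iff,
    ← Fin.ext_iff, eq_comm (a := v)]

theorem exhausts_spec {l : List (Fin n)} {m : ℕ} (h : exhausts l m) :
    l.Nodup ∧ ∀ w, w ∈ l ↔ ¬ m.testBit w := by
  induction l generalizing m with
  | nil =>
    have h1 : m = 2 ^ n - 1 := by simpa [exhausts] using h
    simp [h1]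
  | cons v l ih =>
    simp only [exhausts, Bool.and_eq_true, Bool.not_eq_true'] at h
    obtain ⟨h1, h2⟩ := ih h.2
    simp only [testBit_or_shiftLeft] at h2
    refine ⟨List.nodup_cons.2 ⟨by simp [h2], h1⟩, fun w => ?_⟩
    rw [List.mem_cons, h2]
    by_cases hw : w = v
    · simp [hw, h.1]
    · simp [hw]

/-- Consecutive entries of the list are in relation `R`. -/
def isChain {α : Type*} (R : α → α → Bool) : List α → Bool
  | a :: b :: l => R a b && isChain R (b :: l)
  | _ => true

theorem isChain_spec {α : Type*} {R : α → α → Bool} {G : SimpleGraph α}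
    (hR : ∀ u v, R u v → G.Adj u v) : ∀ {l : List α}, isChain R l → l.IsChain G.Adj
  | [], _ => .nil
  | [_], _ => .singleton _
  | a :: b :: l, h => by
    simp only [isChain, Bool.and_eq_true] at h
    exact .cons_cons (hR a b h.1) (isChain_spec hR h.2)

/-- The lists `ls.1` and `ls.2` run along paths from `p` to `a` and from `b` to `q`, and
together they cover each vertex outside the bit mask `m` once. -/
def isPathPair (R : Fin n → Fin n → Bool) (m : ℕ) (ls : List (Fin n) × List (Fin n))
    (p a b q : Fin n) : Bool :=
  isChain R ls.1 && isChain R ls.2 && ls.1.head? == some p && ls.1.getLast? == some a &&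
    ls.2.head? == some b && ls.2.getLast? == some q && exhausts (ls.1 ++ ls.2) m

theorem isPathPair_spec {R : Fin n → Fin n → Bool} {G : SimpleGraph (Fin n)}
    (hR : ∀ u v, R u v → G.Adj u v) {m : ℕ} {ls : List (Fin n) × List (Fin n)} {p a b q : Fin n}
    (h : isPathPair R m ls p a b q) : Spans G {w | ¬ m.testBit w} [(p, a), (b, q)] := by
  simp only [isPathPair, Bool.and_eq_true, beq_iff_eq] at h
  obtain ⟨⟨⟨⟨⟨⟨h1, h2⟩, h3⟩, h4⟩, h5⟩, h6⟩, h7⟩ := h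
  obtain ⟨h8, h9⟩ := exhausts_spec h7
  exact ⟨[ls.1, ls.2], .cons ⟨isChain_spec hR h1, h3, h4⟩
    (.cons ⟨isChain_spec hR h2, h5, h6⟩ .nil), by simpa using h8, by simpa using h9⟩

theorem Spans.of_mask_zero {G : SimpleGraph (Fin n)} {ps : List (Fin n × Fin n)}
    (h : Spans G {w | ¬ (0 : ℕ).testBit w} ps) : Spans G Set.univ ps := by
  convert h
  ext w
  simp

theorem Spans.of_mask_single {G : SimpleGraph (Fin n)} {ps : List (Fin n × Fin n)} {v : Fin n}
    (h : Spans G {w | ¬ (1 <<< (v : ℕ)).testBit w} ps) : Spans G {v}ᶜ ps := by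
  convert h
  ext w
  have h1 := testBit_or_shiftLeft (m := 0) (v := v) (w := w)
  rw [Nat.zero_or, Nat.zero_testBit] at h1
  simp only [Set.mem_compl_iff, Set.mem_singleton_iff, Set.mem_ofPred_eq, h1]
  simp

/-- The first `k` vertices of the walk that enters `v` from `u` and turns at each vertex according
to a binary digit of `c`. -/
def walk (nbr : ℕ → ℕ → ℕ) : ℕ → ℕ → ℕ → ℕ → List ℕ
  | 0, _, _, _ => []
  | k + 1, c, u, v => v :: walk nbr k (c / 2) v
      (nbr v ((if nbr v 0 == u then 1 + c % 2 else if nbr v 1 == u then 2 + c % 2 else c % 2) % 3))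

/-- The relation of being joined by an edge that is neither between `r 0` and `r 1` nor between
`r 2` and `r 3`. -/
def step (nbr : ℕ → ℕ → ℕ) (r : Fin 4 → Fin n) (u v : Fin n) : Bool :=
  (nbr u 0 == v || nbr u 1 == v || nbr u 2 == v) &&
    !(r 0 == u && r 1 == v || r 0 == v && r 1 == u || r 2 == u && r 3 == v ||
      r 2 == v && r 3 == u)

/-- The vertices below `n` of a walk, divided at the first vertex that is not below `n`. -/
def splitWalk (n : ℕ) [NeZero n] (l : List ℕ) : List (Fin n) × List (Fin n) :=
  ((l.takeWhile (· < n)).map (Fin.ofNat n),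
    ((l.dropWhile (· < n)).dropWhile (n ≤ ·)).map (Fin.ofNat n))

/-- Encoded paths for a proof that a graph is a link. Each code contains the turns of a walk in its
binary digits. The walks for the deletion of a vertex start at the terminal `r 0` or `r 2`, as the
lowest digit of the code tells. -/
structure LinkCertificate where
  /-- For each pair of terminals on different sides a walk through all vertices. -/
  cross : List ℕ
  /-- For each vertex `v` a walk through all vertices but `v`. -/
  delete : List ℕ
  /-- A walk through all vertices that uses only `t' 0` and `t' 1`. -/
  left : ℕ
  /-- A walk through all vertices that uses only `t' 2` and `t' 3`. -/
  right : ℕ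

namespace LinkCertificate

variable [NeZero n] (c : LinkCertificate) (nbr : ℕ → ℕ → ℕ) (t' r : Fin 4 → Fin n)

/-- The walk with the given code that starts at `r i`, as if it came from `r j`. -/
def decode (i j : Fin 4) (len code : ℕ) : List (Fin n) × List (Fin n) :=
  splitWalk n (walk nbr len code (r j) (r i))

/-- The terminal among `t' 0, …, t' 3` at which the walk leaves the link. -/
def portOut (ls : List (Fin n) × List (Fin n)) : Fin 4 :=
  ((List.finRange 4).find? fun i => some (t' i) == ls.1.getLast?).getD 0

/-- The terminal among `t' 0, …, t' 3` at which the walk enters the link again. -/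
def portIn (ls : List (Fin n) × List (Fin n)) : Fin 4 :=
  ((List.finRange 4).find? fun i => some (t' i) == ls.2.head?).getD 0

/-- The walk becomes a path from `p` to `q` with two crossing terminals in between. -/
def isTransit (m : ℕ) (ls : List (Fin n) × List (Fin n)) (p q : Fin n) : Bool :=
  decide (Crossing (portOut t' ls) (portIn t' ls)) &&
    isPathPair (step nbr r) m ls p (t' (portOut t' ls)) (t' (portIn t' ls)) q

/-- The certificate contains a walk that shows how to pass through all vertices of the link on
the way from `r i` to `r j`. -/
def checkCross (i j : Fin 4) : Bool :=
  isTransit nbr t' r 0 (decode nbr r i (if i = 0 then 1 else 0) (n + 2)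
    (c.cross.getD (2 * (i : ℕ) + (j : ℕ) - 2) 0)) (r i) (r j)

/-- The certificate contains a walk that shows how to pass through all vertices of the link but `v`
between two terminals on the same side. -/
def checkDelete (v : Fin n) : Bool :=
  let code := c.delete.getD v 0
  bif code % 2 == 0 then
    isTransit nbr t' r (1 <<< (v : ℕ)) (decode nbr r 0 1 (n + 1) (code / 2)) (r 0) (r 1)
  else isTransit nbr t' r (1 <<< (v : ℕ)) (decode nbr r 2 3 (n + 1) (code / 2)) (r 2) (r 3)

/-- The walk with the given code passes from `t' i` to `t' j`. -/
def checkSide (code : ℕ) (i j : Fin 4) : Bool :=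
  bif code % 2 == 0 then
    isPathPair (step nbr r) 0 (decode nbr r 0 1 (n + 1) (code / 2)) (r 0) (t' i) (t' j) (r 1)
  else
    isPathPair (step nbr r) 0 (decode nbr r 2 3 (n + 1) (code / 2)) (r 2) (t' i) (t' j) (r 3)

/-- The certificate proves that the graph is a link. -/
structure Valid : Prop where
  cross : ∀ i j : Fin 4, i < 2 → 2 ≤ j → c.checkCross nbr t' r i j
  delete : ∀ v : Fin n, c.checkDelete nbr t' r v
  left : checkSide nbr t' r c.left 0 1
  right : checkSide nbr t' r c.right 2 3

variable {nbr t' r} {L : SimpleGraph (Fin n)}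

omit [NeZero n] in
theorem transit_of_isTransit (hL : ∀ u v, step nbr r u v → L.Adj u v) {m : ℕ}
    {ls : List (Fin n) × List (Fin n)} {p q : Fin n} (h : isTransit nbr t' r m ls p q) :
    Transit L t' {w | ¬ m.testBit w} p q := by
  simp only [isTransit, Bool.and_eq_true, decide_eq_true_iff] at h
  exact ⟨_, _, h.1, isPathPair_spec hL h.2⟩

theorem Valid.isLink {c : LinkCertificate} (hc : c.Valid nbr t' r)
    (hL : ∀ u v, step nbr r u v → L.Adj u v) : IsLink L t' r where
  cross i j hi hj := by
    obtain ⟨k, l, hkl, h⟩ := transit_of_isTransit hL (hc.cross i j hi hj)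
    exact ⟨k, l, hkl, h.of_mask_zero⟩
  delete v := by
    have key : ∀ {p q}, Transit L t' {w | ¬ (1 <<< (v : ℕ)).testBit w} p q →
        Transit L t' {v}ᶜ p q := by
      rintro p q ⟨k, l, hkl, h⟩
      exact ⟨k, l, hkl, h.of_mask_single⟩
    have h := hc.delete v
    simp only [checkDelete] at h
    cases h1 : c.delete.getD v 0 % 2 == 0
    · rw [h1, cond_false] at h
      exact .inr (key (transit_of_isTransit hL h))
    · rw [h1, cond_true] at h
      exact .inl (key (transit_of_isTransit hL h))
  delete_left := by
    have h := hc.left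
    simp only [checkSide] at h
    cases h1 : c.left % 2 == 0
    · rw [h1, cond_false] at h
      exact .inr (isPathPair_spec hL h).of_mask_zero
    · rw [h1, cond_true] at h
      exact .inl (isPathPair_spec hL h).of_mask_zero
  delete_right := by
    have h := hc.right
    simp only [checkSide] at h
    cases h1 : c.right % 2 == 0
    · rw [h1, cond_false] at h
      exact .inr (isPathPair_spec hL h).of_mask_zero
    · rw [h1, cond_true] at h
      exact .inl (isPathPair_spec hL h).of_mask_zero

end LinkCertificate

/-- The walk from `v` whose next `k` steps go to the neighbours with the numbers given by the
ternary digits of `c` ends at `q`, and it visits each vertex outside the bit mask `m` once. -/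
def traces (n : ℕ) (nbr : ℕ → ℕ → ℕ) (q : ℕ) : ℕ → ℕ → ℕ → ℕ → Bool
  | 0, _, v, m => v == q && m == 2 ^ n - 1
  | k + 1, c, v, m =>
    let w := nbr v (c % 3)
    !m.testBit w && traces n nbr q k (c / 3) w (m ||| 1 <<< w)

theorem traces_spec {nbr : ℕ → ℕ → ℕ} {K : SimpleGraph (Fin n)}
    (hK : ∀ (v : Fin n) (i : Fin 3), ∃ w : Fin n, nbr v i = w ∧ (w = v ∨ K.Adj v w)) {q : Fin n} :
    ∀ {k c : ℕ} {v : Fin n} {m : ℕ}, m.testBit v → traces n nbr q k c v m →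
      ∃ l : List (Fin n), (v :: l).IsChain K.Adj ∧ (v :: l).getLast? = some q ∧ (v :: l).Nodup ∧
        ∀ w, w ∈ l ↔ ¬ m.testBit w
  | 0, c, v, m, _, h => by
    simp only [traces, Bool.and_eq_true, beq_iff_eq, ← Fin.ext_iff] at h
    obtain ⟨rfl, rfl⟩ := h
    exact ⟨[], .singleton _, rfl, by simp, by simp⟩
  | k + 1, c, v, m, hv, h => by
    obtain ⟨w, hw, hvw⟩ := hK v ⟨c % 3, Nat.mod_lt _ (by decide)⟩
    simp only [traces, Bool.and_eq_true, Bool.not_eq_true'] at h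
    simp only at hw
    rw [hw] at h
    obtain ⟨l, h1, h2, h3, h4⟩ := traces_spec hK (testBit_or_shiftLeft.2 (.inr rfl)) h.2
    have hne : w ≠ v := by
      rintro rfl
      simp [hv] at h
    have h5 : ∀ x, x ∈ w :: l ↔ ¬ m.testBit x := by
      intro x
      rw [List.mem_cons, h4, testBit_or_shiftLeft]
      by_cases hx : x = w
      · simp [hx, h.1]
      · simp [hx]
    refine ⟨w :: l, .cons_cons (hvw.resolve_left hne) h1, by simpa using h2, ?_, h5⟩
    exact List.nodup_cons.2 ⟨fun h => (h5 v).1 h hv, h3⟩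

/-- Encoded paths for a proof that a graph is a pole. Each path is given by the number whose ternary
digits are the numbers of the successive steps at their vertices. The paths that omit a vertex start
at the terminal `r 0` or `r 2`, as the parity of the code tells. -/
structure PoleCertificate where
  /-- For each pair of terminals on different sides a path through all vertices. -/
  cross : List ℕ
  /-- For each vertex `v` a path through all vertices but `v`. -/
  delete : List ℕ

namespace PoleCertificate

variable (c : PoleCertificate) (nbr : ℕ → ℕ → ℕ) (r : Fin 4 → Fin n)

/-- The certificate contains a path from `r i` to `r j` through all vertices. -/
def checkCross (i j : Fin 4) : Bool :=
  traces n nbr (r j) (n - 1) (c.cross.getD (2 * (i : ℕ) + (j : ℕ) - 2) 0) (r i) (1 <<< (r i : ℕ))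

/-- The certificate contains a path through all vertices but `v` between two terminals on the same
side. -/
def checkDelete (v : Fin n) : Bool :=
  let code := c.delete.getD v 0
  bif code % 2 == 0 then
    v != r 0 && traces n nbr (r 1) (n - 2) (code / 2) (r 0) (1 <<< (v : ℕ) ||| 1 <<< (r 0 : ℕ))
  else v != r 2 && traces n nbr (r 3) (n - 2) (code / 2) (r 2) (1 <<< (v : ℕ) ||| 1 <<< (r 2 : ℕ))

/-- The certificate proves that the graph is a pole. -/
structure Valid : Prop where
  cross : ∀ i j : Fin 4, i < 2 → 2 ≤ j → c.checkCross nbr r i j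
  delete : ∀ v : Fin n, c.checkDelete nbr r v

variable {nbr r} {K : SimpleGraph (Fin n)}

theorem spans_of_traces (hK : ∀ (v : Fin n) (i : Fin 3), ∃ w : Fin n, nbr v i = w ∧
    (w = v ∨ K.Adj v w)) {k c m : ℕ} {p q : Fin n} (hp : ¬ m.testBit p)
    (h : traces n nbr q k c p (m ||| 1 <<< (p : ℕ))) : Spans K {w | ¬ m.testBit w} [(p, q)] := by
  obtain ⟨l, h1, h2, h3, h4⟩ := traces_spec hK (testBit_or_shiftLeft.2 (.inr rfl)) h
  refine ⟨[p :: l], .cons ⟨h1, rfl, h2⟩ .nil, by simpa using h3, fun w => ?_⟩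
  simp only [List.flatten_cons, List.flatten_nil, List.append_nil, List.mem_cons, h4,
    testBit_or_shiftLeft, Set.mem_ofPred_eq]
  by_cases hw : w = p
  · simp [hw, hp]
  · simp [hw]

theorem Valid.isPole {c : PoleCertificate} (hc : c.Valid nbr r)
    (hK : ∀ (v : Fin n) (i : Fin 3), ∃ w : Fin n, nbr v i = w ∧ (w = v ∨ K.Adj v w)) :
    IsPole K r where
  cross := by
    have key : ∀ i j, i < 2 → 2 ≤ j → Spans K Set.univ [(r i, r j)] := fun i j hi hj =>
      (spans_of_traces hK (m := 0) (by simp)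
        (by rw [Nat.zero_or]; exact hc.cross i j hi hj)).of_mask_zero
    rintro i j (⟨hi, hj⟩ | ⟨hi, hj⟩)
    · exact key i j hi hj
    · exact (key j i hi hj).reverse_head
  delete v := by
    have h := hc.delete v
    have key : ∀ {w : Fin n}, v ≠ w → ¬ (1 <<< (v : ℕ)).testBit w := by
      intro w hw h
      have := testBit_or_shiftLeft (m := 0) (v := v) (w := w)
      rw [Nat.zero_or, Nat.zero_testBit] at this
      exact hw ((this.1 h).resolve_left (by simp)).symm
    simp only [checkDelete] at h
    cases h1 : c.delete.getD v 0 % 2 == 0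
    · rw [h1, cond_false, Bool.and_eq_true, bne_iff_ne] at h
      exact .inr (spans_of_traces hK (key h.1) h.2).of_mask_single
    · rw [h1, cond_true, Bool.and_eq_true, bne_iff_ne] at h
      exact .inl (spans_of_traces hK (key h.1) h.2).of_mask_single

end PoleCertificate

end Certificate


/-! ### Packed tables -/

section Link

/-- The numbers in the list, all below 256, packed into one number. Arithmetic with such a number is
faster in the kernel than access to a list. -/
def pack (l : List ℕ) : ℕ := l.foldr (fun a T => a + 256 * T) 0

/-- The `i`-th entry of the packed list `T`. -/
def entry (T i : ℕ) : ℕ := T / 256 ^ i % 256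

/-- The packed list `T` as a table with three columns and entries below `k`. -/
def tableFun (T k : ℕ) [NeZero k] {N : ℕ} (v : Fin N) (i : Fin 3) : Fin k :=
  Fin.ofNat k (entry T (3 * v + i))

instance {V : Type*} [DecidableEq V] (nbr : V → Fin 3 → V) : DecidableRel (nbrGraph nbr).Adj :=
  fun u v => inferInstanceAs (Decidable (u ≠ v ∧ (_ ∨ _)))

theorem HasSpanningCycle.isHamiltonian {V : Type*} [Fintype V] [DecidableEq V]
    {G : SimpleGraph V} (h : HasSpanningCycle G Set.univ) (hV : 3 ≤ Fintype.card V) :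
    G.IsHamiltonian := by
  have := h.isHamiltonian_induce (by simpa using hV)
  exact this.of_iso (SimpleGraph.induceUnivIso G)

variable {n m : ℕ}

theorem adj_of_step {N : ℕ} [NeZero N] {T : ℕ} (hnN : n ≤ N) {r : Fin 4 → Fin n}
    (hT : IsNbrTable (tableFun T N : Fin N → Fin 3 → Fin N)) (u v : Fin n)
    (h : step (fun v i => entry T (3 * v + i)) r u v) :
    (unclose ((nbrGraph (tableFun T N)).comap (Fin.castLE hnN)) r).Adj u v := by
  have key : ∀ i : Fin 3, entry T (3 * u + i) = v →
      tableFun T N (Fin.castLE hnN u) i = Fin.castLE hnN v := by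
    intro i hi
    have hi' : entry T (3 * ((Fin.castLE hnN u : Fin N) : ℕ) + i) = v := hi
    rw [tableFun, hi', Fin.ext_iff, Fin.val_ofNat, Fin.val_castLE]
    exact Nat.mod_eq_of_lt (by omega)
  simp only [step, Bool.and_eq_true, Bool.or_eq_true, beq_iff_eq,
    Bool.not_eq_true', Bool.or_eq_false_iff, Bool.and_eq_false_iff, beq_eq_false_iff_ne] at h
  rw [unclose, SimpleGraph.deleteEdges_adj, SimpleGraph.comap_adj, hT.adj_iff]
  refine ⟨?_, ?_⟩
  · rcases h.1 with (h | h) | h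
    exacts [⟨0, key 0 h⟩, ⟨1, key 1 h⟩, ⟨2, key 2 h⟩]
  · simp only [Set.mem_insert_iff, Set.mem_singleton_iff, Sym2.eq_iff]
    grind

/-- The graph with two adjacent vertices put back into the link is the given graph, up to the order
of the vertices. -/
theorem IsGoodLink.of_cut {H : SimpleGraph (Fin (n + 2))} {t' r : Fin 4 → Fin n}
    (hH : ∀ v, (H.neighborSet v).ncard = 3) (hH' : NoShortCycle H) (hcut : IsCut H t' r)
    (hL : IsLink (cut H r) t' r) (hn : ¬ H.IsHamiltonian) (h5 : HasFiveCycle (cut H r))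
    (hd : HasLinkDrawing (cut H r) t' r) : IsGoodLink (cut H r) t' r where
  isLink := hL
  injective_left := hcut.injective_left
  injective_right := hcut.injective_right
  ne := hcut.ne
  not_adj_left i j h := hcut.not_adj_left i j (SimpleGraph.deleteEdges_adj.1 h).1
  not_adj_right := hcut.not_adj_cut_right
  degree w := by
    have h1 := ncard_neighborSet_close hcut.injective_right hcut.not_adj_cut_right w
    have h2 := ncard_neighborSet_glue_right (K := (⊤ : SimpleGraph (Fin 2)))
      (L := close (cut H r) r) (t := edgeTerminal) hcut.injective_left w
    have h3 : ((glue (⊤ : SimpleGraph (Fin 2)) (close (cut H r) r) edgeTerminal t').neighborSet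
        (.inr w)).ncard = (H.neighborSet (hcut.iso (.inr w))).ncard := by
      rw [← Set.ncard_image_of_injective _ hcut.iso.injective]
      congr 1
      ext x
      obtain ⟨y, rfl⟩ := hcut.iso.surjective x
      simp only [SimpleGraph.mem_neighborSet, hcut.iso.injective.mem_set_image]
      exact hcut.iso.map_adj_iff.symm
    have h4 := hH (hcut.iso (.inr w))
    omega
  not_hasSpanningCycle h := by
    classical
    exact hn ((h.isHamiltonian (by simp; have := (r 0).pos; omega)).of_iso hcut.iso)
  noShortCycle := hH'.comap hcut.iso hcut.iso.injective fun _ _ h => hcut.iso.map_adj_iff.2 h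
  hasFiveCycle := h5
  hasLinkDrawing := hd

/-- The face system given by a table of the corners. The faces are connected, as each face but the
first one is at a vertex together with a face with a smaller number. -/
def FaceSystem.ofTable {N : ℕ} {nbr : Fin N → Fin 3 → Fin N} (hnbr : IsNbrTable nbr)
    (corner : Fin N → Fin 3 → Fin (m + 1))
    (hcorner : ∀ v i j, nbr (nbr v i) j = v →
      s(corner v (i + 1), corner v (i + 2)) =
        s(corner (nbr v i) (j + 1), corner (nbr v i) (j + 2)))
    (heuler : 2 * (m + 1) = N + 4)
    (hconn : ∀ f, f ≠ 0 → ∃ v i j, corner v i = f ∧ corner v j < f) :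
    FaceSystem (nbrGraph nbr) (Fin (m + 1)) where
  nbr := nbr
  corner := corner
  adj_iff := hnbr.adj_iff
  nbr_injective u i j := hnbr.injective u i j
  corner_edge := hcorner
  euler := by simpa using heuler
  connected S hS h := by
    have h1 : ∀ f : Fin (m + 1), (f ∈ S ↔ 0 ∈ S) := by
      intro f
      induction f using WellFoundedLT.induction with
      | _ f ih =>
        by_cases hf : f = 0
        · rw [hf]
        · obtain ⟨v, i, j, rfl, hj⟩ := hconn f hf
          rw [← ih _ hj]
          exact ⟨h v i j, h v j i⟩
    obtain ⟨f, hf⟩ := hS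
    exact Set.eq_univ_of_forall fun g => (h1 g).2 ((h1 f).1 hf)

end Link


/-! ### Poles and links from drawn graphs -/

section Lattice

open Finset

variable {V : Type*} {G : SimpleGraph V}

theorem exists_adj_ne_of_ncard (hG : ∀ v, (G.neighborSet v).ncard = 3) (v w : V) :
    ∃ u, u ≠ w ∧ G.Adj v u := by
  by_contra! h
  have h1 : G.neighborSet v ⊆ {w} := fun u hu => by_contra fun hne => h u hne hu
  have h2 := Set.ncard_le_ncard h1 (Set.toFinite _)
  rw [hG, Set.ncard_singleton] at h2
  omega

variable [DecidableEq V]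

/-- A drawing of a graph on lattice points gives a pole drawing if the ends of the removed edges are
in order on a vertical line and no vertex is to the right of this line. -/
theorem hasPoleDrawing_unclose {r : Fin 4 → V} (h01 : G.Adj (r 0) (r 1)) (h23 : G.Adj (r 2) (r 3))
    (hG : ∀ v, (G.neighborSet v).ncard = 3) (hG' : NoShortCycle G) (q : V → ℤ × ℤ)
    {es : List (V × V)} (hes : ∀ u v, G.Adj u v → (u, v) ∈ es ∨ (v, u) ∈ es)
    (hc : sweep q es) (T : ℤ) (hmax : ∀ v, (q v).1 ≤ T)
    (hright : ∀ i, (q (r i)).1 = T) (hmono : Monotone fun i => (q (r i)).2) :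
    HasPoleDrawing (unclose G r) r := by
  refine ⟨fun v => ((-T, 0) : ℝ × ℝ) + latticePoint (q v), fun i => ((q (r i)).2 : ℝ), ?_, ?_, ?_,
    fun i j hij => by simpa using hmono hij⟩
  · rw [close_unclose h01 h23]
    exact (isStraightDrawing_of_sweep hes hG' (exists_adj_ne_of_ncard hG) hc).translate _
  · intro v
    simpa [latticePoint] using (by exact_mod_cast hmax v : ((q v).1 : ℝ) ≤ T)
  · intro i
    simp [latticePoint, hright]

/-- A drawing of a cut graph on lattice points in a strip gives a link drawing if its terminals are
in order on the two borders. Each vertex of the cut graph keeps a neighbour other than a given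
vertex: otherwise it would be adjacent to both deleted vertices and form a triangle with them. -/
theorem IsCut.hasLinkDrawing {n : ℕ} {H : SimpleGraph (Fin (n + 2))} {t' r : Fin 4 → Fin n}
    (h : IsCut H t' r) (hH : ∀ v, (H.neighborSet v).ncard = 3) (hH' : NoShortCycle H)
    (q : Fin n → ℤ × ℤ) {es : List (Fin n × Fin n)}
    (hes : ∀ u v, (H.comap (Fin.castAdd 2)).Adj u v → (u, v) ∈ es ∨ (v, u) ∈ es)
    (hc : sweep q es) (T : ℤ) (hmin : ∀ v, 1 ≤ (q v).1)
    (hmax : ∀ v, (q v).1 ≤ T) (hleft : ∀ i, (q (t' i)).1 = 1) (hright : ∀ i, (q (r i)).1 = T)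
    (hb : StrictMono fun i => (q (t' i)).2) (hc' : Monotone fun i => (q (r i)).2) :
    HasLinkDrawing (cut H r) t' r := by
  refine ⟨latticePoint ∘ q, T, fun i => ((q (t' i)).2 : ℝ), fun i => ((q (r i)).2 : ℝ), ?_,
    fun v => by simpa [latticePoint] using (by exact_mod_cast hmin v : (1 : ℝ) ≤ (q v).1),
    fun v => by simpa [latticePoint] using (by exact_mod_cast hmax v : ((q v).1 : ℝ) ≤ T),
    fun i => by simp [latticePoint, hleft], fun i => by simp [latticePoint, hright],
    fun i j hij => by simpa using hb hij, fun i j hij => by simpa using hc' hij⟩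
  rw [h.close_cut]
  refine isStraightDrawing_of_sweep hes (hH'.comap _ (Fin.castAdd_injective n 2) fun _ _ h => h)
    (fun v w => ?_) hc
  by_contra! hv
  have hsub : H.neighborSet (Fin.castAdd 2 v) ⊆
      {Fin.castAdd 2 w, Fin.natAdd n 0, Fin.natAdd n 1} := by
    intro u hu
    induction u using Fin.addCases with
    | left u =>
      by_cases hu' : u = w
      · simp [hu']
      · exact (hv u hu' hu).elim
    | right u => fin_cases u <;> simp
  have heq := Set.eq_of_subset_of_ncard_le hsub (by
    rw [hH]
    refine (Set.ncard_insert_le _ _).trans ?_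
    have := Set.ncard_insert_le (Fin.natAdd n (0 : Fin 2)) {Fin.natAdd n (1 : Fin 2)}
    simp only [Set.ncard_singleton] at this
    omega) (Set.toFinite _)
  have h0 : Fin.natAdd n 0 ∈ H.neighborSet (Fin.castAdd 2 v) := by simp [heq]
  have h1 : Fin.natAdd n 1 ∈ H.neighborSet (Fin.castAdd 2 v) := by simp [heq]
  exact hH'.three _ _ _ h0 h.adj h1.symm

end Lattice

/-! ### Graphs with a four-edge cut -/

section Join

open Finset

variable {V W : Type*} {G : SimpleGraph V}

theorem IsGoodPole.of_unclose [Finite V] {r : Fin 4 → V} (hr : r.Injective)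
    (h01 : G.Adj (r 0) (r 1)) (h23 : G.Adj (r 2) (r 3))
    (hr' : ∀ i j, i < 2 → 2 ≤ j → ¬ G.Adj (r i) (r j)) (hG : ∀ v, (G.neighborSet v).ncard = 3)
    (hG' : NoShortCycle G) (hP : IsPole (unclose G r) r) (hn : ¬ HasSpanningCycle G Set.univ)
    (h5 : HasFiveCycle (unclose G r)) (hd : HasPoleDrawing (unclose G r) r) :
    IsGoodPole (unclose G r) r where
  isPole := hP
  injective := hr
  not_adj := not_adj_unclose hr hr'
  degree v := by
    rw [← ncard_neighborSet_close hr (not_adj_unclose hr hr'), close_unclose h01 h23, hG]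
  not_hasSpanningCycle := by rwa [close_unclose h01 h23]
  noShortCycle := by rwa [close_unclose h01 h23]
  hasFiveCycle := h5
  hasPoleDrawing := hd

variable {K : SimpleGraph V} {L : SimpleGraph W} {t : Fin 4 → V} {t' : Fin 4 → W}

theorem Spans.reverse_tail {S : Set V} {a b c d : V} (h : Spans K S [(a, b), (c, d)]) :
    Spans K S [(a, b), (d, c)] :=
  ((h.perm (.swap _ _ _)).reverse_head).perm (.swap _ _ _)

/-- Sufficient conditions on the two sides of a glued graph for it to have no Hamiltonian cycle. A
cycle through two of the connecting edges leaves spanning paths between terminals with the same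
numbers on both sides. A cycle through all four of them leaves spanning pairs of paths, and the two
sides then pair the terminals differently, so that at most one of them has the pairs of terminals
whose numbers sum up to 3. -/
theorem not_hasSpanningCycle_glue_of_not_spans (ht : t.Injective) (ht' : t'.Injective)
    (h02 : ¬ Spans K Set.univ [(t 0, t 2)]) (h13 : ¬ Spans K Set.univ [(t 1, t 3)])
    (h12 : ¬ Spans K Set.univ [(t 1, t 2)]) (h30 : ¬ Spans K Set.univ [(t 3, t 0)])
    (h0123 : ¬ Spans K Set.univ [(t 0, t 1), (t 2, t 3)])
    (h0213 : ¬ Spans K Set.univ [(t 0, t 2), (t 1, t 3)])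
    (k01 : ¬ Spans L Set.univ [(t' 0, t' 1)]) (k23 : ¬ Spans L Set.univ [(t' 2, t' 3)])
    (k0123 : ¬ Spans L Set.univ [(t' 0, t' 1), (t' 2, t' 3)])
    (k0213 : ¬ Spans L Set.univ [(t' 0, t' 2), (t' 1, t' 3)]) :
    ¬ HasSpanningCycle (glue K L t t') Set.univ := by
  intro h
  rcases h.of_glue ht ht' with ⟨i, j, hij, hK, hL⟩ | ⟨i, j, k, l, hn, hK, hL⟩
  · have hK' := hK.reverse_head
    have hL' := hL.reverse_head
    fin_cases i <;> fin_cases j <;> first | exact hij rfl | contradiction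
  · -- A pairing of the terminals is one of three, in whichever order it is written down.
    have key : ∀ S : Fin 4 → Fin 4 → Fin 4 → Fin 4 → Prop,
        (∀ i j k l, S i j k l → S j i k l) → (∀ i j k l, S i j k l → S i j l k) →
        (∀ i j k l, S i j k l → S k l i j) → ∀ i j k l, [i, j, k, l].Nodup → S i j k l →
        S 0 1 2 3 ∨ S 0 2 1 3 ∨ (i : ℕ) + j = 3 := by
      intro S h1 h2 h3 i j k l hn h
      have h4 := h1 _ _ _ _ h
      have h5 := h2 _ _ _ _ h
      have h6 := h2 _ _ _ _ h4
      have h7 := h3 _ _ _ _ h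
      have h8 := h3 _ _ _ _ h4
      have h9 := h3 _ _ _ _ h5
      have h10 := h3 _ _ _ _ h6
      clear h1 h2 h3
      by_cases h03 : (i : ℕ) + j = 3
      · exact .inr (.inr h03)
      fin_cases i <;> fin_cases j <;> try contradiction
      all_goals fin_cases k <;> fin_cases l <;> first | contradiction | tauto
    have h1 := key (fun i j k l => Spans K Set.univ [(t i, t j), (t k, t l)])
      (fun _ _ _ _ => Spans.reverse_head) (fun _ _ _ _ => Spans.reverse_tail)
      (fun _ _ _ _ h => h.perm (.swap _ _ _)) i j k l hn hK
    have h2 := key (fun i j k l => Spans L Set.univ [(t' i, t' j), (t' k, t' l)])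
      (fun _ _ _ _ => Spans.reverse_head) (fun _ _ _ _ => Spans.reverse_tail)
      (fun _ _ _ _ h => h.perm (.swap _ _ _)) j k l i (hn.perm (List.perm_append_comm
        (l₁ := [i]) (l₂ := [j, k, l]))) hL
    have h3 : i ≠ k := by
      rintro rfl
      simp at hn
    rw [ne_eq, Fin.ext_iff] at h3
    rcases h1 with h1 | h1 | h1
    · exact h0123 h1
    · exact h0213 h1
    · rcases h2 with h2 | h2 | h2
      · exact k0123 h2
      · exact k0213 h2
      · omega

theorem HasSpanningCycle.of_pair {a b c d : V} (h : Spans K Set.univ [(a, b), (c, d)])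
    (hbc : K.Adj b c) (hda : K.Adj d a) : HasSpanningCycle K Set.univ :=
  ⟨a, d, hda, h.join hbc⟩

variable {n : ℕ} {L : SimpleGraph (Fin n)} {H : SimpleGraph (Fin (n + 2))}

theorem Spans.castAdd (hLH : ∀ u v, L.Adj u v → H.Adj (Fin.castAdd 2 u) (Fin.castAdd 2 v))
    {ps : List (Fin n × Fin n)} (h : Spans L Set.univ ps) {qs : List (Fin (n + 2) × Fin (n + 2))}
    (hqs : Spans H {Fin.natAdd n 0, Fin.natAdd n 1} qs) :
    Spans H Set.univ (ps.map (Prod.map (Fin.castAdd 2) (Fin.castAdd 2)) ++ qs) := by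
  convert (h.map _ (Fin.castAdd_injective n 2) hLH).append hqs ?_
  · symm
    refine Set.eq_univ_of_forall fun v => ?_
    induction v using Fin.addCases with
    | left v => exact .inl ⟨v, trivial, rfl⟩
    | right v => fin_cases v <;> simp
  · rw [Set.disjoint_left]
    rintro _ ⟨v, _, rfl⟩ hv
    have := v.isLt
    simp [Fin.ext_iff] at hv
    omega

/-- A path through all but the last two vertices is closed by the path of these two. -/
theorem HasSpanningCycle.of_castAdd_single
    (hLH : ∀ u v, L.Adj u v → H.Adj (Fin.castAdd 2 u) (Fin.castAdd 2 v)) {a b : Fin n}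
    (h : Spans L Set.univ [(a, b)]) (hb : H.Adj (Fin.castAdd 2 b) (Fin.natAdd n 0))
    (hxy : H.Adj (Fin.natAdd n 0) (Fin.natAdd n 1))
    (ha : H.Adj (Fin.natAdd n 1) (Fin.castAdd 2 a)) :
    HasSpanningCycle H Set.univ :=
  .of_pair (h.castAdd hLH (qs := [(Fin.natAdd n 0, Fin.natAdd n 1)])
    ⟨[[_, _]], .cons ⟨.cons_cons hxy (.singleton _), rfl, rfl⟩ .nil, by simp [hxy.ne], by simp⟩)
    hb ha

/-- Two paths that cover all but the last two vertices are closed by these vertices. -/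
theorem HasSpanningCycle.of_castAdd_pair
    (hLH : ∀ u v, L.Adj u v → H.Adj (Fin.castAdd 2 u) (Fin.castAdd 2 v)) {a b c d : Fin n}
    (h : Spans L Set.univ [(a, b), (c, d)]) (hb : H.Adj (Fin.castAdd 2 b) (Fin.natAdd n 0))
    (hc : H.Adj (Fin.natAdd n 0) (Fin.castAdd 2 c)) (hd : H.Adj (Fin.castAdd 2 d) (Fin.natAdd n 1))
    (ha : H.Adj (Fin.natAdd n 1) (Fin.castAdd 2 a)) : HasSpanningCycle H Set.univ := by
  have h1 := h.castAdd hLH (qs := [(Fin.natAdd n 0, Fin.natAdd n 0),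
    (Fin.natAdd n 1, Fin.natAdd n 1)]) ⟨[[_], [_]], .cons ⟨.singleton _, rfl, rfl⟩
      (.cons ⟨.singleton _, rfl, rfl⟩ .nil), by simp [Fin.ext_iff], by simp⟩
  have h2 := h1.perm (qs := [(Fin.castAdd 2 a, Fin.castAdd 2 b), (Fin.natAdd n 0, Fin.natAdd n 0),
    (Fin.castAdd 2 c, Fin.castAdd 2 d), (Fin.natAdd n 1, Fin.natAdd n 1)])
    (.cons _ (.swap _ _ _))
  exact .of_pair (((h2.join hb).join hc)) hd ha

end Join


/-! ### A link with 74 vertices -/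

/-- The neighbours of the vertices of a planar cubic hypohamiltonian graph with 76 vertices,
three for each vertex. -/
def neighbors76 : ℕ := pack [
  74, 70, 11, 4, 74, 6, 4, 5, 75, 23, 75, 8, 2, 1, 7, 9, 8, 2, 10, 1, 11, 4, 10, 9, 14, 3, 5, 5,
  7, 12, 6, 13, 7, 6, 0, 24, 15, 9, 13, 16, 12, 10, 8, 19, 22, 17, 18, 12, 13, 25, 17, 15, 16, 20,
  15, 21, 19, 18, 26, 14, 21, 17, 29, 18, 20, 27, 23, 14, 33, 22, 73, 3, 28, 11, 47, 28, 29, 16,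
  27, 30, 19, 26, 21, 31, 24, 37, 25, 38, 20, 25, 32, 34, 26, 27, 39, 32, 30, 31, 35, 46, 22, 34,
  36, 33, 30, 36, 32, 40, 35, 42, 34, 48, 38, 28, 37, 51, 29, 43, 40, 31, 41, 35, 39, 40, 44, 42,
  36, 41, 45, 44, 39, 52, 43, 49, 41, 50, 42, 49, 56, 33, 50, 24, 70, 48, 37, 47, 57, 53, 45, 44,
  54, 46, 45, 57, 55, 38, 53, 43, 55, 52, 58, 49, 50, 59, 60, 67, 52, 51, 46, 60, 66, 51, 48, 71,
  53, 63, 59, 54, 58, 61, 54, 62, 56, 62, 59, 64, 61, 65, 60, 68, 64, 58, 69, 61, 63, 69, 66, 62,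
  73, 56, 65, 55, 71, 68, 63, 67, 72, 72, 65, 64, 0, 71, 47, 67, 57, 70, 69, 68, 73, 66, 72, 23,
  75, 0, 1, 74, 2, 3]

/-- The faces of this graph at its vertices; each is opposite to the edge to the neighbour in
the same place of the table `neighbors76`. -/
def faces76 : ℕ := pack [
  2, 4, 0, 4, 17, 5, 3, 5, 16, 3, 11, 0, 17, 16, 5, 3, 16, 15, 4, 14, 17, 29, 16, 17, 3, 15, 11,
  29, 15, 16, 29, 17, 14, 2, 14, 4, 29, 30, 15, 29, 14, 30, 18, 11, 15, 15, 30, 32, 28, 30, 14,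
  28, 32, 30, 31, 15, 32, 18, 15, 31, 28, 23, 32, 23, 31, 32, 18, 6, 11, 0, 11, 6, 2, 12, 14, 28,
  14, 27, 18, 31, 33, 23, 33, 31, 27, 14, 12, 28, 27, 23, 18, 33, 34, 38, 33, 23, 38, 34, 33, 18,
  20, 6, 18, 34, 20, 38, 37, 34, 20, 34, 37, 27, 12, 13, 23, 27, 13, 38, 23, 39, 38, 39, 37, 36,
  37, 39, 36, 20, 37, 23, 26, 39, 36, 39, 26, 36, 25, 20, 20, 21, 6, 1, 12, 2, 1, 13, 12, 36, 26,
  25, 20, 25, 21, 23, 13, 8, 23, 10, 26, 25, 26, 10, 35, 21, 25, 23, 8, 10, 19, 6, 21, 1, 8, 13,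
  24, 25, 10, 24, 35, 25, 19, 21, 35, 24, 22, 35, 19, 35, 22, 24, 10, 9, 24, 9, 22, 19, 22, 7, 19,
  7, 6, 0, 10, 8, 0, 9, 10, 22, 9, 7, 1, 2, 0, 1, 0, 8, 0, 7, 9, 0, 6, 7, 4, 5, 0, 3, 0, 5]

/-- Walks through the graph from which the required systems of paths are read off. -/
def linkCertificate76 : LinkCertificate where
  cross := [
    0x53a3114e3a3ae2b51d5, 0xea3a3a8e8d71715570, 0x2b88fae2b8aab8bee2b, 0xb172e8e8eae8d71715]
  delete := [
    0x2e55ca06ae71715546c, 0x51deb715bba95c1177e, 0x2b7477a8eea3f475c5d, 0x75705738b8ab81714e8,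
    0x5b8fa3a951dd17276e2, 0x1d7115c56c5bb171beb, 0x7c475746bb1718eab8b, 0x7570572746b94655c0a,
    0x68ea78b8ab8afb2ba34, 0x5d8b94715c5715de2af, 0x1d55c4547d7211d38ba, 0x7571151f5c845711d1e,
    0x5716758b8a2be288ea3, 0x747544e8ea3897268ea, 0x3b911dfd28e3a8ab8d5, 0x2ec52a74689d474e3a2,
    0x3aae0ae4e8d72c5c6d4, 0x23a9c55d4d8c1571570, 0x4759ceb8ae23aae2b8a, 0x3b8ae29d4771d4f155d,
    0x3e2b88a3a8e58b8e5c4, 0x7d714538bbaae288ea3, 0x4e2e2e8eac5eaa3a3af, 0x1d6dc571d51ee3a8eeb,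
    0x5c5c92b88a2be288ea3, 0x62ee2b8ae8eb5ce2e2a, 0x15f177a8eafc571d58f, 0x758baf958b8a3a88ea3,
    0x75705738b8ae2a3ab62, 0x15717255473a831d55e, 0x3b8ae3aa3dcea89dca3, 0x2762eea3ae3a25c74a3,
    0x63a83ae754758bbbaa2, 0x3ae3a34b91d1d46ae2b, 0x5d6aed62e95ca8eba8e, 0x3e28b9d123ac5c7551e,
    0x62b9c51c775571d1a5e, 0x57718a3afe2f715bab9, 0x75d12b83a8e8b8b8ab8, 0x2ec52ed13a8e8ae23a2,
    0x6a3ae4171f76962e3b4, 0x7d475515c5db8adce8f, 0x1d51244e9d25c55c5ca, 0x3e28ee89172c5c7551e,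
    0x62ee2bd451d5f46b9d0, 0x8eb6a3bfa5c571d55d, 0x6b8714dd4776962e3b4, 0x3b8a971720aeb8aeb92,
    0x5cdd11728e3628ea2e3, 0x3a8e8ae2c5c7453aca3, 0x1d5138b8bb31545ca3a, 0x7dca28e8ddaae288ea3,
    0x75474a3ba245c555c0a, 0x18eaae8d717145aae2b, 0x22e58bba8eb8abe13a3, 0x2aa2b1775628c77ae5d,
    0xaae3a3717715c5c9de, 0x623ebe2e2b8aa8eba8e, 0x351d5ac5c4e2748e8dc, 0x3a3a8e8d71d474b923b,
    0x7de2afc557159d478af, 0x5477a356bb8a9738c5d, 0x576a39d465d1f6b8ab8, 0x7c715c55731eaa3a3af,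
    0xedd475711ce762e3b4, 0x744e2e2ed4655c50ea8, 0x5477a356bb8a9dc62b9, 0x6dc54ae2bb055c50ea8,
    0x3a3a8e8d71d715db171, 0x3a3a8e8d71d47744b93, 0x1d776c5d1c75a8ea3eb, 0x74751d746bba3645da9,
    0x2e4c54e8d571a255c5c, 0x39d1aa9d1a351d5d1ae]
  left := 0x3e28ae2a475b89915b6
  right := 0x7d18ae2b46ec5c6eb8b

/-- The exceptional faces and the closed sets of faces that are used in the search for a
splitting of the faces. -/
def refutation76 : Refutation where
  corners := [
    0x15, 0x20030, 0x10028, 0x809, 0x30020, 0x18008, 0x24010, 0x20030000, 0x8808, 0x20018000,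
    0x20024000, 0x4014, 0x60008000, 0x60004000, 0x48800, 0x140008000, 0x50004000, 0x150000000,
    0x180008000, 0x80048000, 0x110800000, 0x180800000, 0x40840, 0x841, 0x5004, 0x18004000,
    0x280040000, 0x280800000, 0x8005000, 0x18800000, 0x600040000, 0x4200800000, 0x4600000000,
    0x140040, 0x400140000, 0x6400000000, 0x2400100000, 0x8003000, 0x8802000, 0xc000800000,
    0xe000000000, 0xb000000000, 0x3000100000, 0x8004800000, 0x9004000000, 0x1002100000, 0x300040,
    0x1006, 0x3002, 0x1006000000, 0x2300000, 0x802100, 0x4800400, 0x6000400, 0x802200000,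
    0x800500, 0x280040, 0x2102, 0x3000400, 0x803000000, 0x800280000, 0x801400000, 0x800480000,
    0x1000600, 0x1400200, 0x480080, 0x800c0, 0x501, 0x601, 0x400280, 0x7, 0x103, 0x281, 0xc1,
    0x31, 0x29]
  exceptional := [(6, 2), (10, 2), (18, 2), (20, 2), (25, 2)]
  closed := [
    (0x100000, 0x3402240040), (0x400100000, 0x7202240040), (0x8004000000, 0x7002800400),
    (0xc404100000, 0x3202a40440), (0x2000100000, 0xd402240040), (0x4000000, 0x9002800400),
    (0xa004100000, 0x5402a40440), (0x1004100000, 0xa402a40440), (0x5404100000, 0xa202a40440),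
    (0xa000000000, 0x5404900000), (0xc204000000, 0x3482840400), (0x300000, 0x3c020c0040),
    (0x380000, 0x3c024400c0), (0x1000000, 0x802400600), (0x1380280, 0x3c02440441),
    (0x1780000, 0x3c020406c0), (0x801300000, 0x34024c0640), (0x801300280, 0x34024c0441),
    (0xc404300000, 0x3a028c0440), (0xc404380000, 0x3a02c404c0), (0xc405380280, 0x3a02c40441),
    (0xc405780000, 0x3a028406c0), (0xcc05300000, 0x3202cc0640), (0xcc05300280, 0x3202cc0441),
    (0x2000300000, 0xdc020c0040), (0x2000380000, 0xdc024400c0), (0x2001380280, 0xdc02440441),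
    (0x2001780000, 0xdc020406c0), (0x2801300000, 0xd4024c0640), (0x2801300280, 0xd4024c0441),
    (0x200000000, 0x4480840000), (0xa004300000, 0x5c028c0440), (0xa004380000, 0x5c02c404c0),
    (0xa005380280, 0x5c02c40441), (0xa005780000, 0x5c028406c0), (0xa805300000, 0x5402cc0640),
    (0xa805300280, 0x5402cc0441), (0x4200000000, 0xa480840000), (0x1004300000, 0xac028c0440),
    (0x1004380000, 0xac02c404c0), (0x1005380280, 0xac02c40441), (0x1005780000, 0xac028406c0),
    (0x1805300000, 0xa402cc0640), (0x1805300280, 0xa402cc0441), (0x5404300000, 0xaa028c0440),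
    (0x5404380000, 0xaa02c404c0), (0x5405380280, 0xaa02c40441), (0x5405780000, 0xaa028406c0),
    (0x5c05300000, 0xa202cc0640), (0x5c05300280, 0xa202cc0441), (0x4400000000, 0xa200940000),
    (0x1400000, 0x802080680), (0x480000, 0x8012002c0), (0xc000000000, 0x3604800000),
    (0xc200000000, 0x3484840000), (0x801200280, 0x2580441), (0x801200000, 0x2580640),
    (0x1680000, 0x8021006c0), (0x1280280, 0x802500441), (0x280000, 0x8025000c0),
    (0x200000, 0x802180040), (0x8000000000, 0x7004800000), (0x7004000000, 0x8602900400),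
    (0x1004000000, 0xa002900400)]
  residue := 2

/-- The order in which the faces after the first one, which has the number 18, are assigned to the
sides. -/
def searchOrder76 : List ℕ := [
  6, 20, 10, 25, 21, 26, 36, 37, 39, 34, 38, 33, 23, 31, 24, 35, 19, 22, 7, 9, 0, 11, 8, 15, 32,
  3, 16, 5, 17, 4, 29, 30, 28, 14, 27, 2, 12, 1, 13]

/-- The edges without an end among the last two vertices, ordered by the height of their lower ends
in the drawing below. -/
def edges76 : List (Fin 74 × Fin 74) := [
  (0, 11), (0, 70), (47, 70), (70, 71), (24, 47), (47, 48), (6, 11), (11, 24), (24, 28), (37, 48),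
  (48, 57), (1, 6), (6, 10), (25, 28), (28, 37), (37, 38), (1, 4), (51, 57), (57, 71), (67, 71),
  (29, 38), (38, 51), (16, 25), (25, 29), (51, 55), (7, 10), (10, 13), (20, 29), (13, 16),
  (16, 17), (55, 67), (67, 68), (12, 13), (52, 55), (2, 4), (4, 7), (7, 9), (15, 17), (17, 20),
  (20, 21), (9, 12), (12, 15), (15, 18), (5, 9), (18, 21), (21, 27), (43, 52), (52, 53), (18, 19),
  (63, 68), (68, 72), (39, 43), (43, 44), (26, 27), (27, 31), (49, 53), (53, 58), (31, 32),
  (31, 39), (39, 40), (41, 44), (44, 49), (35, 40), (40, 41), (45, 49), (58, 63), (63, 64),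
  (19, 26), (26, 30), (30, 32), (32, 35), (41, 42), (58, 59), (2, 5), (35, 36), (36, 42),
  (42, 45), (69, 72), (72, 73), (14, 19), (30, 34), (34, 36), (45, 50), (5, 8), (61, 64),
  (64, 69), (54, 59), (59, 61), (33, 34), (61, 62), (65, 69), (46, 50), (50, 54), (54, 60),
  (60, 62), (62, 65), (56, 60), (22, 33), (33, 46), (46, 56), (65, 66), (8, 14), (14, 22),
  (56, 66), (3, 8), (22, 23), (66, 73), (3, 23), (23, 73)]

/-- The first coordinates of the vertices but the last two in a straight-line drawing. -/
def abscissas76 : ℕ := pack [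
  1, 1, 1, 1, 6, 12, 14, 15, 17, 19, 20, 22, 29, 30, 37, 39, 41, 43, 44, 44, 49, 49, 49, 50, 51,
  51, 52, 54, 56, 56, 58, 60, 61, 61, 62, 64, 65, 66, 66, 66, 67, 69, 69, 72, 72, 73, 73, 75, 75,
  75, 76, 78, 78, 79, 81, 83, 83, 84, 84, 84, 84, 87, 87, 89, 90, 91, 91, 92, 94, 94, 100, 100,
  100, 100]

/-- The second coordinates of the vertices but the last two in a straight-line drawing. -/
def ordinates76 : ℕ := pack [
  0, 33, 66, 99, 49, 68, 31, 49, 81, 57, 42, 18, 52, 47, 77, 54, 45, 49, 59, 67, 50, 57, 82, 93,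
  22, 40, 65, 62, 31, 42, 67, 63, 65, 75, 70, 66, 67, 32, 38, 63, 64, 65, 66, 61, 63, 67, 75, 16,
  27, 64, 71, 40, 57, 62, 71, 48, 78, 33, 65, 69, 74, 70, 73, 64, 68, 76, 84, 46, 59, 70, 0, 33,
  66, 99]

/-- The table of the neighbours in the graph with 76 vertices. -/
def nbr76 : Fin 76 → Fin 3 → Fin 76 := tableFun neighbors76 76

theorem isNbrTable76 : IsNbrTable nbr76 where
  injective := by decide +kernel
  ne := by decide +kernel
  symm := by decide +kernel

theorem noShortCycle76 : NoShortCycle (nbrGraph nbr76) :=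
  isNbrTable76.noShortCycle (by decide +kernel) (by decide +kernel)

/-- The neighbours of the last two vertices, two for each of them. -/
def leftTerminal76 : Fin 4 → Fin 74 := ![0, 1, 2, 3]

/-- The ends of the two edges that are removed from the graph. -/
def rightTerminal76 : Fin 4 → Fin 74 := ![70, 71, 72, 73]


theorem isCut76 : IsCut (nbrGraph nbr76) leftTerminal76 rightTerminal76 where
  injective_left := by decide +kernel
  injective_right := by decide +kernel
  ne := by decide +kernel
  not_adj_left := by decide +kernel
  not_adj_right := by decide +kernel
  adj_right := by decide +kernel
  adj := by decide +kernel
  adj_left := by decide +kernel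

theorem linkCertificate76_valid : linkCertificate76.Valid
    (fun v i => entry neighbors76 (3 * v + i)) leftTerminal76 rightTerminal76 where
  cross := by decide +kernel
  delete := by decide +kernel
  left := by decide +kernel
  right := by decide +kernel

/-- The faces of the graph with 76 vertices. -/
def faceSystem76 : FaceSystem (nbrGraph nbr76) (Fin 40) :=
  .ofTable isNbrTable76 (tableFun faces76 40) (by decide +kernel) rfl (by decide +kernel)

open Finset in
theorem refutation76_fits : refutation76.Fits faceSystem76 where
  mem_corners := by decide +kernel
  cornerMask_mem := by decide +kernel
  closed_spec := by decide +kernel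
  lt := by decide +kernel
  degree := by
    show ∀ f : Fin 40, #{x : Fin 76 × Fin 3 | tableFun faces76 40 x.1 x.2 = f} % 3 = _
    decide +kernel
  residue_eq := by decide +kernel

theorem search76 : refutation76.search [] searchOrder76 (1 <<< 18) 0 = true := by decide +kernel

theorem not_isHamiltonian76 : ¬ (nbrGraph nbr76).IsHamiltonian :=
  refutation76_fits.not_isHamiltonian 18 searchOrder76 search76 (by simp) le_rfl (by simp)

/-- A straight-line drawing of the graph without its last two vertices. -/
def position76 (v : Fin 74) : ℤ × ℤ := (entry abscissas76 v, entry ordinates76 v)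

theorem sweep76 : sweep position76 edges76 := by decide +kernel

theorem mem_edges76 (u v : Fin 74) (h : ((nbrGraph nbr76).comap (Fin.castAdd 2)).Adj u v) :
    (u, v) ∈ edges76 ∨ (v, u) ∈ edges76 := by
  have key : ∀ (u : Fin 74) (i : Fin 3) (h : (nbr76 (Fin.castAdd 2 u) i : ℕ) < 74),
      (u : ℕ) < nbr76 (Fin.castAdd 2 u) i → (u, ⟨nbr76 (Fin.castAdd 2 u) i, h⟩) ∈ edges76 := by
    decide +kernel
  have key' : ∀ u v : Fin 74, (nbrGraph nbr76).Adj (Fin.castAdd 2 u) (Fin.castAdd 2 v) → u < v →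
      (u, v) ∈ edges76 := by
    intro u v h h'
    obtain ⟨i, hi⟩ := (isNbrTable76.adj_iff _ _).1 h
    have h1 : (nbr76 (Fin.castAdd 2 u) i : ℕ) = v := congrArg Fin.val hi
    have h2 := key u i (by rw [h1]; exact v.isLt) (by rw [h1]; exact h')
    simp only [h1] at h2
    exact h2
  have h' : (nbrGraph nbr76).Adj (Fin.castAdd 2 u) (Fin.castAdd 2 v) := h
  rcases lt_or_gt_of_ne h.ne with h1 | h1
  · exact .inl (key' u v h' h1)
  · exact .inr (key' v u h'.symm h1)


theorem goodLink76 : IsGoodLink (cut (nbrGraph nbr76) rightTerminal76) leftTerminal76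
    rightTerminal76 :=
  have hcard := isNbrTable76.ncard_neighborSet
  .of_cut hcard noShortCycle76 isCut76
    (linkCertificate76_valid.isLink (adj_of_step (by decide) isNbrTable76)) not_isHamiltonian76
    -- A face of length five that contains none of the removed edges and vertices.
    ⟨0, 70, 47, 24, 11, by decide, by
      simp only [cut, unclose, SimpleGraph.deleteEdges_adj]
      decide +kernel⟩
    (isCut76.hasLinkDrawing hcard noShortCycle76 position76 mem_edges76 sweep76 100
      (by decide +kernel) (by decide +kernel) (by decide +kernel) (by decide +kernel)
      (by decide +kernel) (by decide +kernel))

/-- The base pole is the graph from which the link was cut out. -/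
theorem exists_card_add_seventySix (k : ℕ) :
    ∃ G : SimpleGraph (Fin (74 * k + 76)), IsPlanarCubicHypohamiltonianOfGirthFive G :=
  goodLink76.isGoodPole.exists_card goodLink76 k


/-! ### The two halves of a graph with 152 vertices -/

/-- The neighbours of the vertices of a graph with 78 vertices. Its first 76 vertices form the
left half of a graph with 152 vertices. The last two vertices are adjacent, and they have the
terminals 29 and 55 and the terminals 52 and 20, respectively, as their further neighbours. -/
def neighborsLeft : ℕ := pack [
  74, 70, 11, 4, 74, 6, 4, 5, 75, 23, 75, 8, 2, 1, 7, 9, 8, 2, 10, 1, 11, 4, 10, 9, 14, 3, 5, 5,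
  7, 12, 6, 13, 7, 6, 0, 24, 15, 9, 13, 16, 12, 10, 8, 19, 22, 17, 18, 12, 13, 25, 17, 15, 16, 20,
  15, 21, 19, 18, 26, 14, 21, 17, 77, 18, 20, 27, 23, 14, 33, 22, 73, 3, 28, 11, 47, 28, 29, 16,
  27, 30, 19, 26, 21, 31, 24, 37, 25, 38, 76, 25, 32, 34, 26, 27, 39, 32, 30, 31, 35, 46, 22, 34,
  36, 33, 30, 36, 32, 40, 35, 42, 34, 48, 38, 28, 37, 51, 29, 43, 40, 31, 41, 35, 39, 40, 44, 42,
  36, 41, 45, 44, 39, 52, 43, 49, 41, 50, 42, 49, 56, 33, 50, 24, 70, 48, 37, 47, 57, 53, 45, 44,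
  54, 46, 45, 57, 55, 38, 53, 43, 77, 52, 58, 49, 50, 59, 60, 67, 76, 51, 46, 60, 66, 51, 48, 71,
  53, 63, 59, 54, 58, 61, 54, 62, 56, 62, 59, 64, 61, 65, 60, 68, 64, 58, 69, 61, 63, 69, 66, 62,
  73, 56, 65, 55, 71, 68, 63, 67, 72, 72, 65, 64, 0, 71, 47, 67, 57, 70, 69, 68, 73, 66, 72, 23,
  75, 0, 1, 74, 2, 3, 29, 55, 77, 52, 20, 76]

/-- The faces of this graph at its vertices; each is opposite to the edge to the neighbour in
the same place of the table `neighborsLeft`. -/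
def facesLeft : ℕ := pack [
  31, 32, 17, 32, 39, 35, 34, 35, 40, 34, 33, 17, 39, 40, 35, 34, 40, 28, 32, 27, 39, 38, 40, 39,
  34, 28, 33, 38, 28, 40, 38, 39, 27, 31, 27, 32, 38, 26, 28, 38, 27, 26, 21, 33, 28, 28, 26, 13,
  12, 26, 27, 12, 13, 26, 14, 28, 13, 21, 28, 14, 12, 4, 13, 4, 14, 13, 21, 20, 33, 17, 33, 20,
  31, 37, 27, 12, 27, 25, 21, 14, 15, 4, 15, 14, 25, 27, 37, 12, 25, 16, 21, 15, 22, 11, 15, 4,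
  11, 22, 15, 21, 6, 20, 21, 22, 6, 11, 10, 22, 6, 22, 10, 25, 37, 29, 16, 25, 29, 11, 4, 3, 11,
  3, 10, 2, 10, 3, 2, 6, 10, 4, 0, 3, 2, 3, 0, 2, 1, 6, 6, 9, 20, 30, 37, 31, 30, 29, 37, 2, 0, 1,
  6, 1, 9, 16, 29, 18, 4, 5, 0, 1, 0, 5, 8, 9, 1, 16, 18, 5, 24, 20, 9, 30, 18, 29, 7, 1, 5, 7, 8,
  1, 24, 9, 8, 7, 23, 8, 24, 8, 23, 7, 5, 19, 7, 19, 23, 24, 23, 36, 24, 36, 20, 17, 5, 18, 17,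
  19, 5, 23, 19, 36, 30, 31, 17, 30, 17, 18, 17, 36, 19, 17, 20, 36, 32, 35, 17, 34, 17, 35, 5,
  12, 16, 12, 5, 4]

/-- The exceptional faces and the closed sets of faces that are used in the searches in this
graph. -/
def refutationLeft : Refutation where
  corners := [
    0x180020000, 0x8900000000, 0x10c00000000, 0x600020000, 0x18800000000, 0x10410000000,
    0x8108000000, 0x1c000000000, 0x610000000, 0x14010000000, 0xc008000000, 0x188000000,
    0x4014000000, 0x400c000000, 0x210200000, 0x14002000, 0xc001000, 0x4003000, 0x10006000,
    0x10204000, 0x3010, 0x6010, 0x200300000, 0x200120000, 0x2088000000, 0xa001000, 0x20c000,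
    0xc010, 0x200a000000, 0x2011000, 0x608000, 0x8810, 0x408800, 0x300040, 0x600040, 0x400c00,
    0x400440, 0x2022000000, 0x22010000, 0x818, 0xc08, 0x40c, 0x444, 0x19, 0xd, 0x46, 0x100240,
    0x20c0000000, 0x2060000000, 0x7, 0x242, 0x20050000, 0x31, 0x23, 0x302, 0x50020, 0x1100200,
    0x60040000, 0xa2, 0x182, 0x1000300, 0x800180, 0x1800100, 0x800a0, 0x880080, 0x1001800000,
    0x1001100000, 0x60020, 0xa0020, 0x1000880000, 0xc0020000, 0x40060000, 0x10000a0000,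
    0x1000120000, 0x900020000, 0xc00020000, 0x11020, 0x1030]
  exceptional := [(1, 2), (5, 1), (6, 2), (12, 2), (20, 2), (21, 2)]
  closed := [
    (0x408, 0x400855), (0x10000807c0, 0x1f2082e), (0x7c0, 0x1f8082e), (0x18006c0, 0x100078092e),
    (0x10010806c0, 0xf2092e), (0x1000640, 0x1000f0090e), (0x80, 0x880122), (0x640, 0x170090e),
    (0x440, 0x700a0e), (0x808, 0x408415), (0x1800000, 0x1000180380), (0x800080, 0x1001080122),
    (0x8808, 0x604415), (0x1000080380, 0x1920062), (0x380, 0x1980062), (0x1800280, 0x1000180162),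
    (0x1001080280, 0x920162), (0x1000200, 0x1000900142), (0x200, 0x1100142), (0x8, 0xc15),
    (0x8000, 0x604810), (0x5, 0x47a), (0xc05, 0x40807a), (0x1, 0x3e), (0x9, 0xc36),
    (0x40, 0x700606), (0x400849, 0x308636), (0x449, 0x700a36), (0x45, 0x70063a),
    (0x400845, 0x30863a), (0x8809, 0x604436), (0x240, 0x1700506), (0x1000240, 0x1000f00506),
    (0x10010802c0, 0xf20526), (0x18002c0, 0x1000780526), (0x3c0, 0x1f80426),
    (0x10000803c0, 0x1f20426), (0x400a49, 0x1308536), (0x1400a49, 0x1000b08536),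
    (0x1001480ac9, 0xb28536), (0x1c00ac9, 0x1000388536), (0x400bc9, 0x1b88436),
    (0x1000480bc9, 0x1b28436), (0x649, 0x1700936), (0x1000649, 0x1000f00936),
    (0x10010806c9, 0xf20936), (0x18006c9, 0x1000780936), (0x7c9, 0x1f80836),
    (0x10000807c9, 0x1f20836), (0x8800, 0x604418), (0x245, 0x170053a), (0x1000245, 0x1000f0053a),
    (0x10010802c5, 0xf2053a), (0x18002c5, 0x100078053a), (0x3c5, 0x1f8043a),
    (0x10000803c5, 0x1f2043a), (0x400a45, 0x130853a), (0x1400a45, 0x1000b0853a),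
    (0x1001480ac5, 0xb2853a), (0x1c00ac5, 0x100038853a), (0x400bc5, 0x1b8843a),
    (0x1000480bc5, 0x1b2843a)]
  residue := 1

/-- The order of the faces in the search for the Hamiltonian cycles that leave the left half at the
terminals 0 and 2. -/
def searchOrderLeft02 : List ℕ := [
  5, 12, 16, 1, 6, 20, 21, 0, 2, 3, 10, 22, 11, 15, 9, 14, 13, 8, 7, 24, 23, 19, 36, 17, 33, 18,
  28, 34, 26, 38, 40, 35, 39, 32, 27, 25, 31, 30, 29, 37]

/-- The order of the faces in the search for the Hamiltonian cycles that leave the left half at the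
terminals 1 and 3. -/
def searchOrderLeft13 : List ℕ := [
  5, 12, 16, 1, 6, 20, 21, 0, 9, 2, 3, 10, 11, 22, 15, 14, 13, 7, 8, 24, 23, 19, 36, 17, 18, 33,
  28, 26, 34, 29, 25, 30, 37, 31, 27, 32, 35, 40, 39, 38]


/-- The table of the neighbours in the graph that extends the left half. -/
def nbrLeft : Fin 78 → Fin 3 → Fin 78 := tableFun neighborsLeft 78

theorem isNbrTableLeft : IsNbrTable nbrLeft where
  injective := by decide +kernel
  ne := by decide +kernel
  symm := by decide +kernel

/-- The faces of the graph that extends the left half. -/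
def faceSystemLeft : FaceSystem (nbrGraph nbrLeft) (Fin 41) :=
  .ofTable isNbrTableLeft (tableFun facesLeft 41) (by decide +kernel) rfl (by decide +kernel)

open Finset in
theorem refutationLeft_fits : refutationLeft.Fits faceSystemLeft where
  mem_corners := by decide +kernel
  cornerMask_mem := by decide +kernel
  closed_spec := by decide +kernel
  lt := by decide +kernel
  degree := by
    show ∀ f : Fin 41, #{x : Fin 78 × Fin 3 | tableFun facesLeft 41 x.1 x.2 = f} % 3 = _
    decide +kernel
  residue_eq := by decide +kernel

theorem searchLeft02 :
    refutationLeft.search [(16, 5), (4, 12)] searchOrderLeft02 (1 <<< 4) 0 = true := by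
  decide +kernel

theorem searchLeft13 :
    refutationLeft.search [(12, 16), (5, 4)] searchOrderLeft13 (1 <<< 4) 0 = true := by
  decide +kernel

/-- The neighbours of the vertices of a graph with 78 vertices. Its first 76 vertices form the
right half of a graph with 152 vertices. The last two vertices are adjacent, and they have the
terminals 50 and 51 and the terminals 43 and 15, respectively, as their further neighbours. -/
def neighborsRight : ℕ := pack [
  4, 1, 63, 0, 2, 36, 1, 3, 38, 2, 4, 60, 3, 0, 6, 9, 6, 63, 5, 7, 4, 6, 8, 60, 7, 9, 17, 8, 5,
  16, 14, 11, 69, 10, 12, 44, 11, 13, 41, 12, 14, 40, 13, 10, 72, 17, 16, 77, 15, 9, 49, 8, 15,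
  30, 22, 19, 55, 18, 20, 73, 19, 21, 39, 20, 22, 23, 21, 18, 25, 21, 24, 66, 23, 25, 64, 24, 22,
  56, 32, 27, 62, 26, 28, 58, 27, 29, 33, 28, 30, 35, 29, 31, 17, 30, 32, 61, 31, 26, 69, 28, 34,
  57, 33, 35, 52, 34, 29, 54, 1, 37, 71, 36, 38, 46, 37, 2, 61, 43, 40, 20, 39, 13, 73, 12, 42,
  45, 41, 43, 49, 42, 39, 77, 11, 45, 46, 44, 41, 48, 44, 47, 37, 46, 48, 71, 47, 45, 49, 42, 16,
  48, 76, 51, 75, 50, 76, 65, 34, 53, 64, 52, 54, 68, 53, 35, 75, 59, 56, 18, 55, 57, 25, 56, 58,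
  33, 57, 59, 27, 58, 55, 62, 7, 61, 3, 60, 31, 38, 26, 59, 70, 5, 0, 71, 24, 52, 67, 51, 66, 74,
  65, 23, 67, 66, 64, 68, 67, 53, 74, 32, 70, 10, 69, 62, 72, 63, 36, 47, 70, 73, 14, 72, 19, 40,
  75, 65, 68, 50, 74, 54, 51, 50, 77, 15, 43, 76]

/-- The faces of this graph at its vertices; each is opposite to the edge to the neighbour in
the same place of the table `neighborsRight`. -/
def facesRight : ℕ := pack [
  2, 0, 1, 6, 2, 1, 7, 6, 1, 3, 7, 1, 0, 3, 1, 0, 4, 5, 3, 0, 5, 9, 3, 5, 10, 9, 5, 4, 10, 5, 14,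
  20, 21, 19, 14, 21, 17, 19, 21, 30, 17, 21, 20, 30, 21, 11, 15, 10, 4, 11, 10, 15, 9, 10, 36,
  40, 32, 31, 36, 32, 18, 31, 32, 33, 18, 32, 40, 33, 32, 34, 18, 33, 37, 34, 33, 40, 37, 33, 28,
  22, 16, 29, 28, 16, 23, 29, 16, 15, 23, 16, 9, 15, 16, 14, 9, 16, 22, 14, 16, 37, 29, 23, 24,
  37, 23, 15, 24, 23, 8, 2, 6, 14, 8, 6, 7, 14, 6, 31, 18, 17, 30, 31, 17, 12, 19, 17, 11, 12, 17,
  18, 11, 17, 13, 14, 19, 12, 13, 19, 8, 14, 13, 4, 8, 13, 12, 4, 13, 4, 12, 11, 26, 15, 25, 18,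
  26, 25, 38, 37, 24, 27, 38, 24, 15, 27, 24, 40, 36, 39, 37, 40, 39, 29, 37, 39, 28, 29, 39, 36,
  28, 39, 7, 3, 9, 14, 7, 9, 36, 22, 28, 2, 4, 0, 38, 34, 37, 35, 26, 18, 34, 35, 18, 38, 35, 34,
  27, 35, 38, 20, 14, 22, 36, 20, 22, 8, 4, 2, 30, 20, 36, 31, 30, 36, 35, 27, 26, 27, 15, 26, 15,
  18, 25, 18, 15, 11]

/-- The exceptional faces and the closed sets of faces that are used in the searches in this
graph. -/
def refutationRight : Refutation where
  corners := [
    0x7, 0x46, 0xc2, 0x8a, 0xb, 0x31, 0x29, 0x228, 0x620, 0x430, 0x304000, 0x284000, 0x2a0000,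
    0x40220000, 0x40300000, 0x8c00, 0xc10, 0x8600, 0x11100000000, 0x1180000000, 0x180040000,
    0x300040000, 0x10300000000, 0x600040000, 0x2600000000, 0x12200000000, 0x10410000, 0x30010000,
    0x20810000, 0x818000, 0x18200, 0x14200, 0x414000, 0x2020800000, 0x2001800000, 0x1808000,
    0x144, 0x4140, 0x40c0, 0x80060000, 0xc0020000, 0xa1000, 0x21800, 0x60800, 0x86000, 0x83000,
    0x6100, 0x2110, 0x3010, 0x1810, 0x6008000, 0x6040000, 0x6001000000, 0x4009000000, 0x9008000,
    0x19000000000, 0x1a000000000, 0xa020000000, 0x8030000000, 0x9010000000, 0x288, 0x4280,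
    0x1010400000, 0x15, 0x6400000000, 0x804040000, 0xc00040000, 0x4c00000000, 0x4808000000,
    0x504000, 0x1000500000, 0x114, 0x1040100000, 0x10c0000000, 0x80c000000, 0xc008000, 0x2048000,
    0x48800]
  exceptional := [(9, 2), (11, 1), (14, 2), (15, 2), (16, 2), (17, 2), (18, 2), (25, 1)]
  closed := [
    (0x400, 0x8a30), (0x88, 0x4263), (0x6, 0x1d9), (0x420, 0x8a19), (0x421, 0x8a1e),
    (0x80, 0x424a), (0x4e5, 0xcb1a), (0x4a3, 0xca5c), (0x4a8, 0xca53), (0x4ec, 0xcb13),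
    (0x600, 0x1c8b8), (0x4, 0x153), (0x1, 0x3e), (0x680, 0x1c87a), (0x6c5, 0x1c93a),
    (0x683, 0x1c87c), (0x2e, 0x7d1), (0x28, 0x693), (0x609, 0x1c8b6), (0x64d, 0x1c9b2),
    (0x25, 0x75a), (0x21, 0x61e), (0x20, 0x619), (0x2000000, 0x4048000), (0xc00, 0x69230),
    (0x1c9, 0x6236), (0x3dc9, 0xec236), (0x18d, 0x6272), (0x3d8d, 0xec272), (0x2, 0xcd),
    (0xc20, 0x69219), (0x186, 0x6259), (0x3da6, 0xec259), (0xc21, 0x6921e), (0xce5, 0x6d31a),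
    (0xca3, 0x6d25c), (0x1c0, 0x621e), (0x3de1, 0xec21e), (0x3ce5, 0xec31a), (0x100, 0x6054),
    (0x3da3, 0xec25c), (0xca8, 0x6d253), (0xcec, 0x6d313), (0x104, 0x6053), (0x3dac, 0xec253),
    (0x3cec, 0xec313), (0x200, 0x1c4a8), (0x208, 0x1c4a3), (0x24a, 0x1c5a5), (0xb5a, 0x7f4a5),
    (0x40, 0x4186), (0xb59, 0x7f4a6), (0x220, 0x1c499), (0x800, 0x69410), (0x363, 0x1e49c),
    (0x3b63, 0xfc49c), (0x42, 0x418d), (0xb72, 0x7f48d), (0x2c0, 0x1c52e), (0xbd1, 0x7f42e),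
    (0xb93, 0x7f46c), (0x3a6, 0x1e459), (0x3ba6, 0xfc459), (0x3e1, 0x1e41e), (0x3be1, 0xfc41e),
    (0x3a5, 0x1e45a), (0x3ba5, 0xfc45a), (0xa, 0x2e5), (0x8, 0x2a3), (0xbb2, 0x7f44d),
    (0x9, 0x2b6), (0xe00, 0x7d0b8), (0x143, 0x60bc), (0x3f43, 0xfc0bc), (0xe09, 0x7d0b6),
    (0xe4d, 0x7d1b2), (0x140, 0x6096), (0x3f49, 0xfc0b6), (0x3e4d, 0xfc1b2), (0xe80, 0x7d07a),
    (0xec5, 0x7d13a), (0xe83, 0x7d07c), (0x105, 0x607a), (0x3f85, 0xfc07a), (0x3ec5, 0xfc13a),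
    (0x3f83, 0xfc07c)]
  residue := 1

/-- The order of the faces in the search for the Hamiltonian cycles that leave the right half at the
terminals 0 and 1. -/
def searchOrderRight01 : List ℕ := [
  18, 25, 9, 14, 15, 16, 17, 10, 26, 5, 4, 12, 13, 19, 8, 21, 0, 2, 3, 1, 6, 7, 20, 22, 30, 31,
  36, 28, 32, 23, 29, 39, 40, 33, 37, 24, 27, 34, 35, 38]

/-- The order of the faces in the search for the Hamiltonian cycles that leave the right half at the
terminals 2 and 3. -/
def searchOrderRight23 : List ℕ := [
  15, 25, 9, 14, 16, 17, 18, 26, 10, 5, 3, 7, 4, 0, 12, 1, 2, 6, 8, 13, 19, 21, 27, 35, 38, 24,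
  23, 34, 37, 29, 33, 31, 30, 20, 32, 22, 36, 28, 40, 39]

/-- The order of the faces in the search for the Hamiltonian cycles that leave the right half at
all four terminals. -/
def searchOrderRightPairs : List ℕ := [
  18, 9, 11, 14, 16, 17, 25, 10, 26, 7, 5, 3, 4, 0, 12, 1, 2, 6, 8, 13, 19, 21, 22, 20, 30, 31,
  36, 28, 32, 29, 39, 40, 23, 37, 33, 34, 24, 35, 27, 38]

/-- The table of the neighbours in the graph that extends the right half. -/
def nbrRight : Fin 78 → Fin 3 → Fin 78 := tableFun neighborsRight 78

theorem isNbrTableRight : IsNbrTable nbrRight where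
  injective := by decide +kernel
  ne := by decide +kernel
  symm := by decide +kernel

/-- The faces of the graph that extends the right half. -/
def faceSystemRight : FaceSystem (nbrGraph nbrRight) (Fin 41) :=
  .ofTable isNbrTableRight (tableFun facesRight 41) (by decide +kernel) rfl (by decide +kernel)

open Finset in
theorem refutationRight_fits : refutationRight.Fits faceSystemRight where
  mem_corners := by decide +kernel
  cornerMask_mem := by decide +kernel
  closed_spec := by decide +kernel
  lt := by decide +kernel
  degree := by
    show ∀ f : Fin 41, #{x : Fin 78 × Fin 3 | tableFun facesRight 41 x.1 x.2 = f} % 3 = _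
    decide +kernel
  residue_eq := by decide +kernel

theorem searchRight01 :
    refutationRight.search [(18, 25), (11, 18)] searchOrderRight01 (1 <<< 11) 0 = true := by
  decide +kernel

theorem searchRight23 :
    refutationRight.search [(25, 15), (15, 11)] searchOrderRight23 (1 <<< 11) 0 = true := by
  decide +kernel

theorem searchRightPairs :
    refutationRight.search [(15, 18)] searchOrderRightPairs (1 <<< 15) 0 = true := by
  decide +kernel



/-- A Hamiltonian cycle that avoids these two edges would arise from a spanning path of the left
half between the terminals 0 and 2, that is, the vertices 29 and 52. -/
theorem not_isHamiltonianLeft02 :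
    ¬ ((nbrGraph nbrLeft).deleteEdges {s(76, 55), s(77, 20)}).IsHamiltonian :=
  refutationLeft_fits.not_isHamiltonian 4 searchOrderLeft02 searchLeft02 (by simp)
    (SimpleGraph.deleteEdges_le _) (List.forall_mem_cons.2 ⟨⟨76, 1, by
        rw [SimpleGraph.deleteEdges_adj]; decide +kernel, by decide +kernel⟩,
      List.forall_mem_singleton.2 ⟨77, 1, by
        rw [SimpleGraph.deleteEdges_adj]; decide +kernel, by decide +kernel⟩⟩)

/-- A Hamiltonian cycle that avoids these two edges would arise from a spanning path of the left
half between the terminals 1 and 3, that is, the vertices 55 and 20. -/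
theorem not_isHamiltonianLeft13 :
    ¬ ((nbrGraph nbrLeft).deleteEdges {s(76, 29), s(77, 52)}).IsHamiltonian :=
  refutationLeft_fits.not_isHamiltonian 4 searchOrderLeft13 searchLeft13 (by simp)
    (SimpleGraph.deleteEdges_le _) (List.forall_mem_cons.2 ⟨⟨76, 0, by
        rw [SimpleGraph.deleteEdges_adj]; decide +kernel, by decide +kernel⟩,
      List.forall_mem_singleton.2 ⟨77, 0, by
        rw [SimpleGraph.deleteEdges_adj]; decide +kernel, by decide +kernel⟩⟩)

/-- A Hamiltonian cycle that avoids these two edges would arise from a spanning path of the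
right half between the terminals 0 and 1, that is, the vertices 15 and 50. -/
theorem not_isHamiltonianRight01 :
    ¬ ((nbrGraph nbrRight).deleteEdges {s(76, 51), s(77, 43)}).IsHamiltonian :=
  refutationRight_fits.not_isHamiltonian 11 searchOrderRight01 searchRight01 (by simp)
    (SimpleGraph.deleteEdges_le _) (List.forall_mem_cons.2 ⟨⟨76, 0, by
        rw [SimpleGraph.deleteEdges_adj]; decide +kernel, by decide +kernel⟩,
      List.forall_mem_singleton.2 ⟨77, 1, by
        rw [SimpleGraph.deleteEdges_adj]; decide +kernel, by decide +kernel⟩⟩)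

/-- A Hamiltonian cycle that avoids these two edges would arise from a spanning path of the
right half between the terminals 2 and 3, that is, the vertices 51 and 43. -/
theorem not_isHamiltonianRight23 :
    ¬ ((nbrGraph nbrRight).deleteEdges {s(76, 50), s(77, 15)}).IsHamiltonian :=
  refutationRight_fits.not_isHamiltonian 11 searchOrderRight23 searchRight23 (by simp)
    (SimpleGraph.deleteEdges_le _) (List.forall_mem_cons.2 ⟨⟨76, 1, by
        rw [SimpleGraph.deleteEdges_adj]; decide +kernel, by decide +kernel⟩,
      List.forall_mem_singleton.2 ⟨77, 0, by
        rw [SimpleGraph.deleteEdges_adj]; decide +kernel, by decide +kernel⟩⟩)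

/-- A Hamiltonian cycle that avoids this edge would arise from a spanning pair of paths of the right
half. -/
theorem not_isHamiltonianRightPairs :
    ¬ ((nbrGraph nbrRight).deleteEdges {s(76, 77)}).IsHamiltonian :=
  refutationRight_fits.not_isHamiltonian 15 searchOrderRightPairs searchRightPairs (by simp)
    (SimpleGraph.deleteEdges_le _)
    (List.forall_mem_singleton.2 ⟨76, 2, by
        rw [SimpleGraph.deleteEdges_adj]; decide +kernel, by decide +kernel⟩)



/-! ### A pole with 152 vertices -/

/-- The neighbours of the vertices of a planar cubic hypohamiltonian graph with 152 vertices.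
The first 76 vertices form its left half, which is the graph with 76 vertices without two edges,
and the other ones form its right half. -/
def neighbors152 : ℕ := pack [
  74, 70, 11, 4, 74, 6, 4, 5, 75, 23, 75, 8, 2, 1, 7, 9, 8, 2, 10, 1, 11, 4, 10, 9, 14, 3, 5, 5,
  7, 12, 6, 13, 7, 6, 0, 24, 15, 9, 13, 16, 12, 10, 8, 19, 22, 17, 18, 12, 13, 25, 17, 15, 16, 20,
  15, 21, 19, 18, 26, 14, 21, 17, 119, 18, 20, 27, 23, 14, 33, 22, 73, 3, 28, 11, 47, 28, 29, 16,
  27, 30, 19, 26, 21, 31, 24, 37, 25, 38, 91, 25, 32, 34, 26, 27, 39, 32, 30, 31, 35, 46, 22, 34,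
  36, 33, 30, 36, 32, 40, 35, 42, 34, 48, 38, 28, 37, 51, 29, 43, 40, 31, 41, 35, 39, 40, 44, 42,
  36, 41, 45, 44, 39, 52, 43, 49, 41, 50, 42, 49, 56, 33, 50, 24, 70, 48, 37, 47, 57, 53, 45, 44,
  54, 46, 45, 57, 55, 38, 53, 43, 127, 52, 58, 49, 50, 59, 60, 67, 126, 51, 46, 60, 66, 51, 48,
  71, 53, 63, 59, 54, 58, 61, 54, 62, 56, 62, 59, 64, 61, 65, 60, 68, 64, 58, 69, 61, 63, 69, 66,
  62, 73, 56, 65, 55, 71, 68, 63, 67, 72, 72, 65, 64, 0, 71, 47, 67, 57, 70, 69, 68, 73, 66, 72,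
  23, 75, 0, 1, 74, 2, 3, 80, 77, 139, 76, 78, 112, 77, 79, 114, 78, 80, 136, 79, 76, 82, 85, 82,
  139, 81, 83, 80, 82, 84, 136, 83, 85, 93, 84, 81, 92, 90, 87, 145, 86, 88, 120, 87, 89, 117, 88,
  90, 116, 89, 86, 148, 93, 92, 29, 91, 85, 125, 84, 91, 106, 98, 95, 131, 94, 96, 149, 95, 97,
  115, 96, 98, 99, 97, 94, 101, 97, 100, 142, 99, 101, 140, 100, 98, 132, 108, 103, 138, 102, 104,
  134, 103, 105, 109, 104, 106, 111, 105, 107, 93, 106, 108, 137, 107, 102, 145, 104, 110, 133,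
  109, 111, 128, 110, 105, 130, 77, 113, 147, 112, 114, 122, 113, 78, 137, 119, 116, 96, 115, 89,
  149, 88, 118, 121, 117, 119, 125, 118, 115, 20, 87, 121, 122, 120, 117, 124, 120, 123, 113, 122,
  124, 147, 123, 121, 125, 118, 92, 124, 55, 127, 151, 126, 52, 141, 110, 129, 140, 128, 130, 144,
  129, 111, 151, 135, 132, 94, 131, 133, 101, 132, 134, 109, 133, 135, 103, 134, 131, 138, 83,
  137, 79, 136, 107, 114, 102, 135, 146, 81, 76, 147, 100, 128, 143, 127, 142, 150, 141, 99, 143,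
  142, 140, 144, 143, 129, 150, 108, 146, 86, 145, 138, 148, 139, 112, 123, 146, 149, 90, 148, 95,
  116, 151, 141, 144, 126, 150, 130]

/-- Paths in the graph without two edges, the numbers of the steps being those of the table
`neighborsPole152`. -/
def poleCertificate152 : PoleCertificate where
  cross := [
    0x9bd5e8d621d7179cc1fac92e670fc11e57ac51d5c5de869833fb07782ccf,
    0x6fd1176b6e742fff772c887d60d9066a45d6157c9e6325c21ed28903681e,
    0x7f0c4f8bdee741d0d6cf02e6b0146c55956e652c5a744da7ce4cabe73644,
    0xd80c479aa1f7ab5c7a9f438a2cd65a868da2e708260cde45c9c363a9287]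
  delete := [
    0x2288159774b4c494e23b69f8f4054aea2ecf778d43d5f28546587a2399dc,
    0x2366a1558b38e1e8558f5f36a36e0a46312987b31472ed8f04da3b655a98,
    0x227e1763a9e64b03e707297a7c349c8007e1a8008bb16d38b9da05103052,
    0x279c713ba83d53f6f283916091879229b2c48a5d341b08bf0f916a8b2230,
    0x323ca968e763f6ef6e00a53bb018588b9caacfdbfe0a98dfff3e015f5a2a,
    0x27ae4eccf131cba23dd4660173c2f4f0833370a34787bd63d88c876f1c1c,
    0x204e87b3cd18ef2faaff7b2442e1e94a8269c73ba98a3dbc31d438006f7c,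
    0x236660cfed9b802d1578863c3936cfcbe86297949a66080402c7bf0634cc,
    0x204dfd8dbeff60f6fba32b86d963bbc076b49aef377f3f5b907698e29c72,
    0x25b64e783dabdaf482b95ded03491d953b59df2c4dee3cc11c12bfdf55be,
    0x323caaf730738564163b455cb9bd5d211c427a36210e2d300c94248cf6b6,
    0x236660cfef43317b43adb54f36226e01256c0ac349d2cf77a3a523950030,
    0x31c792538e9fe5dbfa687794e2d8c72cc46d6e678f5ee2fa1fa21c78ae94,
    0x25a3a31d439d32bdce36ca29f8ffb2f5dec4a2afc84bbfff28e7bf435936,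
    0x26b4559a75122668fd3d8da27ef3e03f268bfa852bc847389b22bedfbe20,
    0x323ca904089a73c0ca226b892eefc3fbb221257009e5c607112ec3c0aad2,
    0x25a66e8c4a847e6e4840be2908bcb77d6e946e1d6ac3b7143b3106b0e798,
    0x2366613e6f01ca9646f8aad1b6ac057eae08b3ad47822d60c96ca5816684,
    0x25b49305024f64309a0b9927f14245929a15b251cfd36da25803ce270b8e,
    0x25a66ec18d3dadab6be98eb130212823b0b5a908e09d1008882a86faa466,
    0x4ad5e0ffefc36d414e064335cc9f0ad78e5978cfeba4eaae7828bc571dab,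
    0x22873ab9b1c89e7bf40f90dad4509a34adcfddbc215a16db61b14f2f2ec8,
    0x27ae4eccf083b6fee0da1482bb6ac0a65304f1ed827b0b2509abfff6ecec,
    0x116edfdbdabb07f708772dd991e81a57b1b7f95899639a1a61a15ecb1ce0,
    0x259dc98948bef5d7f2cf172e3c2bd800af6bddebc0e4b39ac7417fa80b86,
    0x236660cfef2746337f2438260f2844ef8e0f11c6ae65d8ec3bdff110f18a,
    0x27954c59c8c9eb86b7b83b0dd072423ac11e42017fc456e65935d65345e2,
    0x2366995c6839602487a77f775502faaff340683fe03f26d76e91ab5cd2a6,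
    0x2592949ce27905b90f637d0445909d2a15605a068870151016dce1ebd77c,
    0x25a66ee1b289732decb993a8d197ed89b14abbd6b7aa5b87da896a1b16d0,
    0x3248a3dea7f8b4fecc4de9f949964fd0ede2b626dee506eda175accf3db0,
    0x259bf80885680efd081dbe699bb3e91e4755b62998f6ff56dae6387913e2,
    0x204e8d25ca7dba2a1fa98948c4f943c53fe6170249689e201f3df77d883a,
    0x25be7b5b8e1655645803b46036678ce1f0523fb0e1b68714b5676f3514b6,
    0x3232b2ea68f2c5c25ff120de5478e37528347a9304f9e79441e0994fd890,
    0x324b52638ccf0b4ede5591b57e573b1327efe05abebcbf205285bf87d6a2,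
    0x236ef728f72edab502f4a80f2a207e7430cca7a0b19d103621dca6123ba6,
    0x31c86d3178b9cae3dedc7f1da444769937ccdc9422bb2a638b1685c844b4,
    0x31c7a03b328af6c46e35096a856c737a29ada4453e323fb0a6afc443d3ba,
    0x654efa9ef341c4fdf845ddafdd2a65e5fbf7dfd80ec77dc13f961e19f953,
    0x3232b1bbb48d2ffbaedafb4c55845a36343bc4f2a9bf2fe836c5e6a58328,
    0x2049b2000fc1b37cd994c70e68779a99fefcdb5dcce00ffee9725beef3b2,
    0x25b5e576f3529bbe876bb55c8a91e13ad96a301858e914a91b29ec399740,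
    0x900828d22984089af16caf817da587026ea723838c61cb47b091e110653,
    0x323caa927e9ff02a5f26454a7c1878421afb1ac527b15386da396a5ff766,
    0x31c3730e6c5e40d918f94f293cd1b1e2cfe63927dfc581c97dafaef35e10,
    0x227dfd30b6372d15d7278a849422d9d3a6597628e113122296ab487fa39c,
    0x116ee8102cf83dfe1a6a42c15afafcb15fc3b48ed67fd06399113f3958ec,
    0x228816414aed979967234006027e7429c866867b52b531db56f878687602,
    0xf856ab6b3873b9f89114c3baa840922b4c018d3a3219230629d82056e88,
    0x26b96d5b868a16439df133ee64a30468f13d366dde5a0831b61ffd8ba1ba,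
    0x259dc989526eee1956e879cdfa94f086b4a91776e7a0c01ad280a004c90e,
    0x20669996666b6cba24baf57c8dfb85d9901668296d17caa68a81deb36b04,
    0x31c8b19556d00f946a2ac631d791474e8b06da3f92090ed4c63cd69a93e0,
    0x323a3a39a7c46efadb5950ee93b524b459e360f4f313e4b4ba27b24a5692,
    0x4ad59c0b39ad6c7935ae8cb603ae3090a50408feec3c935ce3309551e49f,
    0x324bce89ca2860a9d73b30ead62dc70cd49ea5d5fd74f425a8e4b560d6d4,
    0x25a350c73a3ef131e37f898b71a523bfb85b532510f1cf8fe8b0f1d2253e,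
    0x11f6755f11ca9a5234bafbf4beefe38158ce5f15fde4a9704cf5c401006a,
    0x279a303d96cc980ace8d7078191976c798f5ecc214935089066c7a69867c,
    0x3232b2f36f01d27a883ce71cdf48a0e836e4ed58288e3e8d75b94a71d828,
    0x258727bb5b945b91798026bf6b32836146591c58ae3ad2ce3ae13d96d5f2,
    0x3248a3efb0ab80607fb8f09aca51fe010229b443dd1fa55dd7446e7eb25e,
    0x25c1d37a006968949e02fa89c6733f7bcc1f9e90cc72d33a91e7dce643d2,
    0x26b4559a7510da945bffc2fe004f72e5b5ff59c4cfa109bea32d79e052fa,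
    0x25be71d3831323183f1f0c3c173b1f5011f85c458d9eb7febb6fa9efd9b0,
    0x269a44ac5f00d81e1e4b1230419e89813b4cbb9f887e7d37b698645a0a5e,
    0x323caa7caf59edd77ae02e7df394ff23cee10d284e2893556a6b148c7e6a,
    0xf856abc4b6f1632226c53db648059f015570d9ab073ff466f5b3f22abb0,
    0x31c3730e6c4bbf838b5860b92891d8bd69ffcbbbd050f9526d15cb8089b8,
    0x2278acc440f13ae502007b4003f63306fd2b9c7cd4ae3b4bd353d0bfc8f6,
    0x2592949c0f3098ba117f48b2e1d13c9bd22f5f78286cf85178f0c589b9ce,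
    0x259ec20e5a28395d4109fdfc4c9c3ef0d09d82a8fc2f1b62d54f668dce52,
    0x235f1195d0136b0830d04f47d464a536e79bf86c06474f18b79749dc42f0,
    0x204e0dc4be053dcab66be1a8e58e259d69ceee746569a4611f434c2ace26,
    0x31c804c2ea558b7b456398bd33d7e436a5e23f231c4eb990dc8c5a373240,
    0x323e566d87feb6f99d22c48b5400b33f84adf103ed89371424829a856f2e,
    0x235f118affd1a20a2704ea17af958ef35203d2bdcc61d64e08397bf4ae42,
    0x323a3aa9328a550257bdccaae3beb7ad3e88aec06e7fc9327ef29c1c23a0,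
    0x323e5f4d9e3c6cf4b382d9375956bfce343409d6e5ba17c22fe8f4ddecd0,
    0x259d349dedab372e785f46a7600f0d0316ba45078e62ac973e379a31a9e4,
    0x116d191d0f8b155d8a2c5b5730736c97efeba996c88b6d2177b19f587218,
    0x204e0d36bb1cdbe8da8da30e3c5cd2f1a6d85e696e6468fc848e882e73d2,
    0x228d753fe427d347c7e05a4a506dc31f22dda246f2584988a19ef03570d4,
    0x236660d9c61ea6f1ac291ac90cfa5784e56071a00dbbaeb336bc23f49274,
    0x4ad2ed10cdd0aaa21d92e21a6b17df2f4378d439fa0f6ca76e112df76363,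
    0x323e566d885b44c7542215bfa7edc84dc720fbd020ecde4541a007e358ba,
    0x25a350d1ddb0c275105499b91a58af30624582837244bada988074037504,
    0x204de67c1512560628e44c5834492a9eb9947a03701673bc81fb0bbdc334,
    0x22873aec3afb81cc9ec61f5dc8d6d00825a53018aedc69b3b6cf07d66b08,
    0x259eb86cc7420c048854dab39dd0a68346ccb38f5f29688cbddb31fa6c1e,
    0x90076737784bce02d923c2b2e951dd339daa03e0a3d9a1a8bb850f3cffd,
    0x323a3ac8f1f1b12941fe5d03eedef86e2b3350c38efc373c6423d27c2cb6,
    0x116d1ae5971890bbbb8b693429d1d102907ad9d572a2141d9922f6f52d2a,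
    0x323a3a9fa7ad673ebbed77e7b914c7f7f9f0a93a02b32bef67f8befd8170,
    0x204e8ebf53be9c8be49482ddb59faf45626a7ec51538011436b6697a5d6e,
    0x2596d1c01bb5be2570733ea3efd3bb49b3aff6fb717dc61dab0cb1f5eca0,
    0x323a39edba3a1047de98544d0e1b88f289840158e88d6ccc0b94605de054,
    0x323e5fbb6613cfef9f2848933fec885d20a1a50a6602b4979d6c7af8b506,
    0x20e0025fcd6608ee18bd8b1ca29de0c1b52d64ba92ebd89eaeabfe8589ad,
    0x116d1ae03229ca286d698cfd835e044f70828e0a0a03f32818f2a5b98e14,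
    0x269927eb4f4d153c63ad68bbbb00693ceba31d43e05d0473d3d0d0750b08,
    0x323a3aaee0f80b9e93ad2bf014a409a81ebe4885c8f059e81ad9ff218406,
    0x268c5d72d6cac7ab9b023d7adb99848213a307a3c778fdd3733bf935a7d8,
    0x324bce047d1e79f1d4df5e6d954bccf0a3a13965bcf0f77115431987e896,
    0x323a3a9feb6996109d73d22eec418ad9e5adabdd40ceddf9977cb2e1956e,
    0x27954c5a218af2cb5d4d2869bf8b45b994d0df0c6608a43200c4e3e61950,
    0x323e5f4d987e389ccdecc526460b4d8b53af4ca7c982a1110d692cdc896e,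
    0x235f118aff6d546e65c4a4df976df72271299158d8c0e03df206302e1564,
    0x25a66ee1b357b2953e264d1a12cc0bcebed7f3f727695324a079804b5ece,
    0x116d51441e67b1fa437be76dd7a8e515a53e39591e34ca344720b4e04aec,
    0x25a350d1ddb057ce60e02af95c6eae8a56ae8a638745d2aa2594bf2a6b2e,
    0x204e87b80a0874722c248ecd36f754edb4dbd9a0a7f7989309b40d661ac2,
    0x26ae5a40818585ea235c8be7861df8a93907677c526d6524bfc897100aee,
    0x235f118aff6d51893d90f5a80005a803b7738022ede9661b0ebe6aff7bce,
    0x323e4f2259901ffbeb53fa6cb46144a5867bb8a6e745ee221c3056f62c60,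
    0x323a3aae9a9f6b58276c79493c178f6f9a1247e8b8b794f6e9f21a492576,
    0x4ad39231acb55cf884bdc4a42d26f707e24c81397cb7aa06b2b96b45110d,
    0x324bd18aa4f830f01f444b1a97cb6a038cf7062d38af4db554a8419e374e,
    0x27954c5a857a807baf230d16cca2b142f9d5ae8e0e8e2c5459bb67145fda,
    0x204de67638132291f9a6e988c82f970a71b8220e5e71b0c66533afdde8dc,
    0x26ae5b89e0eb09cf26cec6bedcd7cfdfe0bf1a2dbd930a235059e9fe806e,
    0x204e8d25c61acd6213e1e0cb3d1322be5a74b4a32497a3a25840817db792,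
    0x323a3aae9550a13fe518e06e2e12f4291711f18864cc9ddc14b9eb076858,
    0x324b3be05e84e214df3b1a5d25d5650164960c0d193d31f5677709317a0c,
    0x27ae55e6b4fc840a6f33a1eb4eae09b9d9cb0600b53725ed3596b5e9a136,
    0x31cac3f7758e680b9be960f99a2e92bcec19bc4e4c0069c8e1e6c5ec071a,
    0x90086d04acd06e2e41d44033d92d05b57cbad0b516a1bb9282dddf7740d,
    0x223239dd4622fd0f7a91a8cd36c82d149003577a0b953748f8bf7fe5bcf3,
    0x3248c2786718edb5cc8a5737b78f9f7ea3c3a86edb66a4ee99da4b6e06d6,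
    0x492e362ad662e702c7f62bb0c588e6906ee36b9eba4f8f74fbdff9a3d457,
    0x116d1374543b888dc1317d325786e480bcd2cb154c26105cfb405f1fe95e,
    0x323a3aaeea167c3e5a5cda33e354997bbea1b27196c463aef19c27dd1de4,
    0x204de67d75346b57e7007a915da0625d64d224145fb53def66345f205124,
    0x2799ba534dbe63d3b0f9844ce1267783641dc247d04e22a728ca2cea802a,
    0x324bce04560775a7ad8898549c580edcb96ba2271f266468008101b0b62a,
    0x268c5d72d6cac7b485256ccf0d9e9e81b0f887f08af259e047b491dcd860,
    0x324b1e3e4a581c42292743422a2dbee9e73405aec1c95a6d9a12cb8a6ace,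
    0x268c5d72e93b62d7105dccbb0d32871ac9344826ef09a4e4e60b6d700eba,
    0x227df030bbfa6b7eb3f4bb23dbad49b3ab75482602e0e6b3ac430a400ee4,
    0x3248b53c38b33e616330a28f66b7dd0827738e23baf66194379456c88dae,
    0x340f04ad2a307f8780dada2df47ab80e6a50cdb946100b07a00988d34bae,
    0x116d9544d480a93d8abf4534731a4f428cde0d919542aebc46212b49d3ae,
    0x5f6e959594cdb963e25967dfac1f239d26fa49588487cfe8b46776b39bc3,
    0x279c713eabf4ae5adb63ecc4081bd8383d0b3a170077ffea4bffd48a853e,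
    0x2596d1c031f1a17d10bcf4f7f0d7170e5b779eb8ab88ff28fb0a6d618812,
    0x323a3a04c5bdf1652569274a807384c2a8662e0194d1f70bc709cb2ba95e,
    0x223bfdbd18ceebbbaab7db7c15c305ef203af9f6ff74f774ddb4af160aa3,
    0x2596d1c0205b3eac55e39855bbfd7b415f4d06f6ec3f5df4626644574d3e,
    0x268c5d72dfdbbe444441616f214c7b3cbb1c2ea92fa58029c78c6a0b9ea2,
    0xa17c5f96c29cc9d56e35d615e2cecd0d0b2f3d83bcac645820b6bdaa563,
    0x26b452e85f9589a7e84cb24b9ca0b5e6beb7e55ada4f3613a73884f32f82]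

/-- The table `neighbors152` with loops in place of the two removed edges. -/
def neighborsPole152 : ℕ := pack [
  74, 70, 11, 4, 74, 6, 4, 5, 75, 23, 75, 8, 2, 1, 7, 9, 8, 2, 10, 1, 11, 4, 10, 9, 14, 3, 5, 5,
  7, 12, 6, 13, 7, 6, 0, 24, 15, 9, 13, 16, 12, 10, 8, 19, 22, 17, 18, 12, 13, 25, 17, 15, 16, 20,
  15, 21, 19, 18, 26, 14, 21, 17, 119, 18, 20, 27, 23, 14, 33, 22, 73, 3, 28, 11, 47, 28, 29, 16,
  27, 30, 19, 26, 21, 31, 24, 37, 25, 38, 91, 25, 32, 34, 26, 27, 39, 32, 30, 31, 35, 46, 22, 34,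
  36, 33, 30, 36, 32, 40, 35, 42, 34, 48, 38, 28, 37, 51, 29, 39, 40, 31, 41, 35, 39, 40, 44, 42,
  36, 41, 45, 44, 43, 52, 43, 49, 41, 50, 42, 49, 56, 33, 50, 24, 70, 48, 37, 47, 57, 53, 45, 44,
  54, 46, 45, 57, 55, 38, 53, 43, 127, 52, 58, 49, 50, 59, 60, 67, 126, 51, 46, 60, 66, 51, 48,
  71, 53, 63, 59, 54, 58, 61, 54, 62, 56, 62, 59, 64, 61, 65, 60, 68, 64, 58, 69, 61, 63, 69, 66,
  62, 73, 56, 65, 55, 71, 68, 63, 67, 72, 72, 65, 64, 0, 71, 47, 67, 57, 70, 69, 68, 73, 66, 72,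
  23, 75, 0, 1, 74, 2, 3, 80, 77, 139, 76, 78, 112, 77, 79, 114, 78, 80, 136, 79, 76, 82, 85, 82,
  139, 81, 83, 80, 82, 84, 136, 83, 85, 93, 84, 81, 92, 90, 87, 145, 86, 88, 120, 87, 89, 117, 88,
  90, 116, 89, 86, 148, 93, 92, 29, 91, 85, 125, 84, 91, 106, 98, 95, 131, 94, 96, 149, 95, 97,
  115, 96, 98, 99, 97, 94, 101, 97, 100, 142, 99, 101, 140, 100, 98, 132, 108, 103, 138, 102, 104,
  134, 103, 105, 109, 104, 106, 111, 105, 107, 93, 106, 108, 137, 107, 102, 145, 104, 110, 133,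
  109, 111, 128, 110, 105, 130, 77, 113, 147, 112, 114, 122, 113, 78, 137, 119, 116, 96, 115, 89,
  149, 88, 118, 121, 117, 119, 125, 118, 115, 20, 87, 121, 122, 120, 117, 124, 120, 123, 113, 122,
  124, 147, 123, 121, 125, 118, 92, 124, 55, 127, 151, 126, 52, 141, 110, 129, 140, 128, 130, 144,
  129, 111, 151, 135, 132, 94, 131, 133, 101, 132, 134, 109, 133, 135, 103, 134, 131, 138, 83,
  137, 79, 136, 107, 114, 102, 135, 146, 81, 76, 147, 100, 128, 143, 127, 141, 150, 142, 99, 143,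
  142, 140, 144, 143, 129, 150, 108, 146, 86, 145, 138, 148, 139, 112, 123, 146, 149, 90, 148, 95,
  116, 151, 141, 144, 126, 150, 130]

/-- The edges, ordered by the height of their lower ends in the drawing below. -/
def edges152 : List (Fin 152 × Fin 152) := [
  (31, 39), (39, 40), (39, 43), (27, 31), (31, 32), (35, 40), (40, 41), (30, 32), (32, 35),
  (21, 27), (26, 27), (35, 36), (26, 30), (30, 34), (19, 26), (34, 36), (36, 42), (33, 34),
  (41, 42), (41, 44), (42, 45), (14, 19), (18, 19), (18, 21), (20, 21), (22, 33), (33, 46),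
  (15, 18), (8, 14), (14, 22), (22, 23), (45, 49), (45, 50), (43, 44), (44, 49), (46, 50),
  (46, 56), (50, 54), (3, 8), (5, 8), (49, 53), (56, 60), (56, 66), (3, 23), (23, 73), (54, 59),
  (54, 60), (3, 75), (43, 52), (60, 62), (12, 15), (15, 17), (2, 5), (5, 9), (65, 66), (66, 73),
  (72, 73), (7, 9), (9, 12), (61, 62), (62, 65), (65, 69), (12, 13), (2, 4), (2, 75), (58, 59),
  (59, 61), (74, 75), (61, 64), (1, 4), (4, 7), (7, 10), (16, 17), (17, 20), (64, 69), (69, 72),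
  (20, 119), (63, 64), (68, 72), (6, 10), (10, 13), (13, 16), (53, 58), (58, 63), (0, 74), (1, 6),
  (1, 74), (52, 53), (63, 68), (6, 11), (16, 25), (0, 11), (0, 70), (11, 24), (67, 68), (52, 127),
  (24, 28), (24, 47), (47, 70), (70, 71), (25, 28), (25, 29), (47, 48), (28, 37), (57, 71),
  (67, 71), (37, 48), (48, 57), (55, 67), (37, 38), (51, 57), (29, 38), (38, 51), (29, 91),
  (51, 55), (115, 119), (118, 119), (55, 126), (117, 118), (118, 125), (91, 92), (91, 93),
  (85, 92), (92, 125), (124, 125), (126, 127), (127, 141), (81, 85), (84, 85), (88, 117),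
  (117, 121), (121, 124), (123, 124), (126, 151), (76, 139), (81, 139), (139, 147), (76, 77),
  (76, 80), (81, 82), (120, 121), (122, 123), (123, 147), (83, 84), (84, 93), (80, 82), (82, 83),
  (112, 147), (83, 136), (93, 106), (77, 78), (77, 112), (79, 80), (112, 113), (113, 122),
  (120, 122), (87, 120), (78, 79), (78, 114), (79, 136), (113, 114), (136, 137), (87, 88),
  (88, 89), (114, 137), (86, 87), (107, 137), (96, 115), (105, 106), (106, 107), (115, 116),
  (107, 108), (89, 90), (89, 116), (86, 90), (86, 145), (130, 151), (150, 151), (90, 148),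
  (116, 149), (108, 145), (145, 146), (102, 108), (141, 142), (141, 150), (104, 105), (105, 111),
  (146, 148), (148, 149), (138, 146), (102, 103), (102, 138), (95, 149), (111, 130), (129, 130),
  (110, 111), (144, 150), (135, 138), (103, 104), (103, 134), (104, 109), (131, 135), (133, 134),
  (134, 135), (109, 110), (109, 133), (110, 128), (94, 95), (95, 96), (128, 129), (129, 144),
  (132, 133), (96, 97), (94, 131), (131, 132), (143, 144), (128, 140), (94, 98), (101, 132),
  (97, 98), (98, 101), (100, 101), (100, 140), (140, 143), (99, 100), (142, 143), (97, 99),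
  (99, 142)]

/-- The first coordinates of the vertices in a straight-line drawing. -/
def abscissas152 : ℕ := pack [
  127, 114, 115, 132, 110, 111, 110, 103, 122, 98, 98, 118, 83, 86, 123, 68, 75, 48, 75, 105, 12,
  49, 144, 146, 120, 96, 123, 105, 112, 107, 154, 176, 177, 163, 170, 201, 192, 124, 129, 255,
  229, 224, 208, 255, 235, 207, 177, 130, 134, 221, 192, 153, 238, 221, 189, 178, 176, 145, 203,
  194, 183, 187, 182, 188, 184, 176, 170, 169, 176, 177, 138, 152, 170, 161, 122, 124, 80, 80, 84,
  87, 84, 82, 86, 90, 93, 84, 70, 60, 50, 49, 61, 96, 76, 104, 96, 69, 49, 105, 114, 176, 168,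
  139, 107, 121, 135, 140, 118, 104, 98, 146, 166, 165, 76, 76, 85, 12, 37, 42, 29, 0, 60, 52, 68,
  65, 57, 53, 206, 234, 185, 198, 189, 111, 128, 132, 121, 110, 90, 94, 99, 76, 194, 255, 255,
  225, 218, 84, 84, 72, 69, 57, 228, 208]

/-- The second coordinates of the vertices in a straight-line drawing. -/
def ordinates152 : ℕ := pack [
  100, 91, 83, 76, 86, 78, 94, 86, 72, 81, 90, 100, 82, 90, 62, 77, 96, 87, 59, 53, 88, 53, 63,
  74, 107, 109, 37, 24, 111, 124, 34, 6, 23, 57, 44, 28, 41, 116, 123, 0, 22, 45, 49, 76, 65, 63,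
  65, 110, 115, 73, 67, 125, 106, 91, 75, 131, 73, 118, 90, 83, 76, 84, 81, 93, 88, 81, 78, 115,
  100, 87, 108, 113, 89, 80, 91, 83, 151, 155, 157, 157, 155, 151, 153, 154, 152, 148, 170, 162,
  159, 169, 173, 139, 142, 154, 207, 198, 202, 231, 219, 249, 230, 220, 183, 187, 187, 179, 167,
  168, 176, 195, 197, 185, 155, 157, 159, 167, 173, 148, 138, 128, 156, 151, 155, 151, 148, 142,
  148, 144, 206, 199, 184, 204, 208, 199, 194, 194, 158, 163, 186, 150, 223, 178, 255, 230, 205,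
  175, 181, 153, 180, 184, 185, 172]

/-- The ends of the two edges that are removed from the graph. They lie on the right border of the
drawing. -/
def terminal152 : Fin 4 → Fin 152 := ![39, 43, 141, 142]

/-- The table of the neighbours in the graph with 152 vertices. -/
def nbr152 : Fin 152 → Fin 3 → Fin 152 := tableFun neighbors152 152

theorem isNbrTable152 : IsNbrTable nbr152 where
  injective := by decide +kernel
  ne := by decide +kernel
  symm := by decide +kernel

theorem noShortCycle152 : NoShortCycle (nbrGraph nbr152) :=
  isNbrTable152.noShortCycle (by decide +kernel) (by decide +kernel)

theorem poleCertificate152_valid : poleCertificate152.Valid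
    (fun v i => entry neighborsPole152 (3 * v + i)) terminal152 where
  cross := by decide +kernel
  delete := by decide +kernel

/-- A straight-line drawing of the graph with 152 vertices. -/
def position152 (v : Fin 152) : ℤ × ℤ := (entry abscissas152 v, entry ordinates152 v)

theorem mem_edges152 : ∀ u i, u < nbr152 u i → (u, nbr152 u i) ∈ edges152 := by
  decide +kernel

theorem sweep152 : sweep position152 edges152 := by decide +kernel


/-- A graph on `m + n` vertices is glued from its first `m` and its last `n` vertices, if the edges
between these are as prescribed. -/
def glueIso {m n : ℕ} {G : SimpleGraph (Fin (m + n))} {t : Fin 4 → Fin m} {t' : Fin 4 → Fin n}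
    (h : ∀ u w, G.Adj (Fin.castAdd n u) (Fin.natAdd m w) ↔ ∃ i, t i = u ∧ t' i = w) :
    glue (G.comap (Fin.castAdd n)) (G.comap (Fin.natAdd m)) t t' ≃g G where
  toEquiv := finSumFinEquiv
  map_rel_iff' := by
    rintro (x | x) (y | y)
    · rfl
    · simpa using h x y
    · simpa [G.adj_comm] using h y x
    · rfl

/-- A shift of the labels that takes the neighbours in the first table to neighbours in the second
one preserves adjacency. -/
theorem adj_of_table {k N M a : ℕ} {nbr : Fin N → Fin 3 → Fin N} {nbr' : Fin M → Fin 3 → Fin M}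
    (hn : IsNbrTable nbr) (hn' : IsNbrTable nbr') {f : Fin k → Fin N} (hf : ∀ u, (f u : ℕ) = a + u)
    {g : Fin k → Fin M} (hg : ∀ u, (g u : ℕ) = u)
    (h : ∀ u i, a ≤ (nbr (f u) i : ℕ) → (nbr (f u) i : ℕ) < a + k →
      ∃ j, a + (nbr' (g u) j : ℕ) = nbr (f u) i) {u v : Fin k}
    (huv : (nbrGraph nbr).Adj (f u) (f v)) : (nbrGraph nbr').Adj (g u) (g v) := by
  obtain ⟨i, hi⟩ := (hn.adj_iff _ _).1 huv
  have hv := hf v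
  obtain ⟨j, hj⟩ := h u i (by rw [hi]; omega) (by rw [hi]; omega)
  refine (hn'.adj_iff _ _).2 ⟨j, Fin.ext ?_⟩
  rw [hi] at hj
  have := hg v
  omega

/-- The left half of the graph with 152 vertices. -/
def left152 : SimpleGraph (Fin 76) := (nbrGraph nbr152).comap (Fin.castAdd 76)

/-- The right half of the graph with 152 vertices. -/
def right152 : SimpleGraph (Fin 76) := (nbrGraph nbr152).comap (Fin.natAdd 76)

/-- The ends in the left half of the four edges between the two halves. -/
def leftEnd152 : Fin 4 → Fin 76 := ![29, 55, 52, 20]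

/-- The ends in the right half of the four edges between the two halves. -/
def rightEnd152 : Fin 4 → Fin 76 := ![15, 50, 51, 43]

theorem adj_cross152 (u w : Fin 76) :
    (nbrGraph nbr152).Adj (Fin.castAdd 76 u) (Fin.natAdd 76 w) ↔
      ∃ i, leftEnd152 i = u ∧ rightEnd152 i = w := by
  rw [isNbrTable152.adj_iff]
  constructor
  · have key : ∀ (u : Fin 76) (i : Fin 3), 76 ≤ (nbr152 (Fin.castAdd 76 u) i : ℕ) →
        ∃ k, leftEnd152 k = u ∧ 76 + (rightEnd152 k : ℕ) = nbr152 (Fin.castAdd 76 u) i := by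
      decide +kernel
    rintro ⟨i, hi⟩
    obtain ⟨k, hk, hk'⟩ := key u i (by simp [hi])
    refine ⟨k, hk, Fin.ext ?_⟩
    rw [hi, Fin.val_natAdd] at hk'
    omega
  · have key : ∀ k, ∃ i, nbr152 (Fin.castAdd 76 (leftEnd152 k)) i =
        Fin.natAdd 76 (rightEnd152 k) := by
      decide +kernel
    rintro ⟨k, rfl, rfl⟩
    exact key k

theorem adj76_of_left (u v : Fin 76) (h : left152.Adj u v) : (nbrGraph nbr76).Adj u v :=
  adj_of_table (a := 0) (g := id) isNbrTable152 isNbrTable76 (by simp) (by simp)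
    (by decide +kernel) h

theorem adjLeft_of_left (u v : Fin 76) (h : left152.Adj u v) :
    (nbrGraph nbrLeft).Adj (Fin.castAdd 2 u) (Fin.castAdd 2 v) :=
  adj_of_table (a := 0) isNbrTable152 isNbrTableLeft (by simp) (by simp) (by decide +kernel) h

theorem adjRight_of_right (u v : Fin 76) (h : right152.Adj u v) :
    (nbrGraph nbrRight).Adj (Fin.castAdd 2 u) (Fin.castAdd 2 v) :=
  adj_of_table isNbrTable152 isNbrTableRight (fun u => Fin.val_natAdd 76 u) (by simp)
    (by decide +kernel) h

theorem edges152_complete (u v : Fin 152) (h : (nbrGraph nbr152).Adj u v) :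
    (u, v) ∈ edges152 ∨ (v, u) ∈ edges152 := by
  rcases h.ne.lt_or_gt with h' | h'
  · obtain ⟨i, rfl⟩ := (isNbrTable152.adj_iff _ _).1 h
    exact .inl (mem_edges152 _ _ h')
  · obtain ⟨i, rfl⟩ := (isNbrTable152.adj_iff _ _).1 h.symm
    exact .inr (mem_edges152 _ _ h')

/-- To delete edges at the last two vertices does not affect the adjacency of the other ones. -/
theorem adj_castAdd_deleteEdges {n : ℕ} {H : SimpleGraph (Fin (n + 2))} {u v : Fin n}
    {S : Set (Sym2 (Fin (n + 2)))} (h : H.Adj (Fin.castAdd 2 u) (Fin.castAdd 2 v))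
    (hS : ∀ e ∈ S, Fin.natAdd n 0 ∈ e ∨ Fin.natAdd n 1 ∈ e) :
    (H.deleteEdges S).Adj (Fin.castAdd 2 u) (Fin.castAdd 2 v) := by
  refine SimpleGraph.deleteEdges_adj.2 ⟨h, fun he => ?_⟩
  have := u.isLt
  have := v.isLt
  rcases hS _ he with h | h <;> simp [Fin.ext_iff] at h <;> omega

theorem not_hasSpanningCycle_glue152 :
    ¬ HasSpanningCycle (glue left152 right152 leftEnd152 rightEnd152) Set.univ := by
  have h76 : ¬ HasSpanningCycle (nbrGraph nbr76) Set.univ :=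
    fun h => not_isHamiltonian76 (h.isHamiltonian (by simp))
  have hmem : ∀ {x y : Fin 78} {a b : Fin 78}, (x = 76 ∧ y = 77) →
      ∀ e ∈ ({s(x, a), s(y, b)} : Set (Sym2 (Fin 78))),
        Fin.natAdd 76 (0 : Fin 2) ∈ e ∨ Fin.natAdd 76 (1 : Fin 2) ∈ e := by
    rintro x y a b ⟨rfl, rfl⟩ e (rfl | rfl)
    · exact .inl (Sym2.mem_mk_left _ _)
    · exact .inr (Sym2.mem_mk_left _ _)
  have hmem' : ∀ e ∈ ({s(76, 77)} : Set (Sym2 (Fin 78))),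
      Fin.natAdd 76 (0 : Fin 2) ∈ e ∨ Fin.natAdd 76 (1 : Fin 2) ∈ e := by
    rintro e rfl
    exact .inl (Sym2.mem_mk_left _ _)
  refine not_hasSpanningCycle_glue_of_not_spans (by decide) (by decide) (fun h => ?_) (fun h => ?_)
    (fun h => ?_) (fun h => ?_) (fun h => ?_) (fun h => ?_) (fun h => ?_) (fun h => ?_)
    (fun h => ?_) (fun h => ?_)
  -- The terminals 0 and 2 of the left half are adjacent to different ones of the two new
  -- vertices, and so are 1 and 3. A path between them is closed by way of the new vertices, and
  -- it does not use the new edges to the other two terminals.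
  · refine not_isHamiltonianLeft02 (HasSpanningCycle.isHamiltonian
      (.of_castAdd_single (fun u v huv => adj_castAdd_deleteEdges (adjLeft_of_left u v huv)
        (hmem ⟨rfl, rfl⟩)) h.reverse_head
      ?_ ?_ ?_) (by simp)) <;> rw [SimpleGraph.deleteEdges_adj] <;> decide +kernel
  · refine not_isHamiltonianLeft13 (HasSpanningCycle.isHamiltonian
      (.of_castAdd_single (fun u v huv => adj_castAdd_deleteEdges (adjLeft_of_left u v huv)
        (hmem ⟨rfl, rfl⟩)) h.reverse_head
      ?_ ?_ ?_) (by simp)) <;> rw [SimpleGraph.deleteEdges_adj] <;> decide +kernel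
  -- In the graph with 76 vertices the terminals 1 and 2 of the left half are adjacent, and so are
  -- the terminals 3 and 0.
  · exact h76 ⟨_, _, by decide +kernel, h.mono adj76_of_left⟩
  · exact h76 ⟨_, _, by decide +kernel, h.mono adj76_of_left⟩
  · exact h76 (.of_pair (h.mono adj76_of_left) (by decide +kernel) (by decide +kernel))
  · exact h76 (.of_pair (h.mono adj76_of_left) (by decide +kernel) (by decide +kernel))
  -- In the right half, the new vertices are adjacent to the terminals 1 and 2 and to the
  -- terminals 3 and 0, respectively.
  · refine not_isHamiltonianRight01 (HasSpanningCycle.isHamiltonian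
      (.of_castAdd_single (fun u v huv => adj_castAdd_deleteEdges (adjRight_of_right u v huv)
        (hmem ⟨rfl, rfl⟩)) h
      ?_ ?_ ?_) (by simp)) <;> rw [SimpleGraph.deleteEdges_adj] <;> decide +kernel
  · refine not_isHamiltonianRight23 (HasSpanningCycle.isHamiltonian
      (.of_castAdd_single (fun u v huv => adj_castAdd_deleteEdges (adjRight_of_right u v huv)
        (hmem ⟨rfl, rfl⟩)) h.reverse_head
      ?_ ?_ ?_) (by simp)) <;> rw [SimpleGraph.deleteEdges_adj] <;> decide +kernel
  · refine not_isHamiltonianRightPairs (HasSpanningCycle.isHamiltonian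
      (.of_castAdd_pair (fun u v huv => adj_castAdd_deleteEdges (adjRight_of_right u v huv) hmem') h
      ?_ ?_ ?_ ?_) (by simp)) <;> rw [SimpleGraph.deleteEdges_adj] <;> decide +kernel
  · refine not_isHamiltonianRightPairs (HasSpanningCycle.isHamiltonian
      (.of_castAdd_pair (fun u v huv => adj_castAdd_deleteEdges (adjRight_of_right u v huv) hmem') h
      ?_ ?_ ?_ ?_) (by simp)) <;> rw [SimpleGraph.deleteEdges_adj] <;> decide +kernel

theorem not_hasSpanningCycle152 : ¬ HasSpanningCycle (nbrGraph nbr152) Set.univ := fun h =>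
  not_hasSpanningCycle_glue152 (.of_isHamiltonian
    ((h.isHamiltonian (by simp)).of_iso (glueIso adj_cross152).symm) (by simp))

theorem isPole152 : IsPole (unclose (nbrGraph nbr152) terminal152) terminal152 := by
  refine poleCertificate152_valid.isPole fun v i => ?_
  have key : ∀ (v : Fin 152) (i : Fin 3), ∃ w : Fin 152, entry neighborsPole152 (3 * v + i) = w ∧
      (w = v ∨ (∃ j, nbr152 v j = w) ∧ s(v, w) ∉
        ({s(terminal152 0, terminal152 1), s(terminal152 2, terminal152 3)} :
          Set (Sym2 (Fin 152)))) := by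
    intro v i
    refine ⟨Fin.ofNat 152 (entry neighborsPole152 (3 * v + i)), ?_, ?_⟩
    · rw [Fin.val_ofNat, eq_comm]
      refine Nat.mod_eq_of_lt ?_
      revert v i
      decide +kernel
    · revert v i
      decide +kernel
  obtain ⟨w, hw, h⟩ := key v i
  exact ⟨w, hw, h.imp_right fun h => SimpleGraph.deleteEdges_adj.2
    ⟨(isNbrTable152.adj_iff _ _).2 h.1, h.2⟩⟩

theorem goodPole152 : IsGoodPole (unclose (nbrGraph nbr152) terminal152) terminal152 :=
  have hcard := isNbrTable152.ncard_neighborSet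
  .of_unclose (by decide) (by decide +kernel) (by decide +kernel) (by decide +kernel) hcard
    noShortCycle152 isPole152 not_hasSpanningCycle152
    -- A face of length five that contains none of the removed edges.
    ⟨0, 74, 1, 6, 11, by decide, by
      simp only [unclose, SimpleGraph.deleteEdges_adj]
      decide +kernel⟩
    (hasPoleDrawing_unclose (by decide +kernel) (by decide +kernel) hcard noShortCycle152
      position152 edges152_complete sweep152 255 (by decide +kernel) (by decide +kernel)
      (by decide +kernel))

theorem exists_card_add_hundredFiftyTwo (k : ℕ) :
    ∃ G : SimpleGraph (Fin (74 * k + 152)), IsPlanarCubicHypohamiltonianOfGirthFive G :=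
  goodPole152.exists_card goodLink76 k


/-! ### Infinitely many graphs -/

theorem mainTheorem2 :
    (∃ (n : ℕ → ℕ) (G : ∀ i : ℕ, SimpleGraph (Fin (n i))),
      (∀ i : ℕ, IsPlanarCubicHypohamiltonianOfGirthFive (G i)) ∧
      ∀ i j : ℕ, i ≠ j → IsEmpty (G i ≃g G j)) ∧
    (∀ k : ℕ, 2 ≤ k → ∀ a ∈ ({2, 4} : Set ℕ),
      ∃ G : SimpleGraph (Fin (74 * k + a)), IsPlanarCubicHypohamiltonianOfGirthFive G) := by
  refine ⟨?_, ?_⟩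
  · -- Isomorphic graphs have the same number of vertices.
    choose G hG using exists_card_add_seventySix
    refine ⟨_, G, hG, fun i j hij => ⟨fun e => hij ?_⟩⟩
    have := Fin.equiv_iff_eq.1 ⟨e.toEquiv⟩
    omega
  · rintro k hk a (rfl | rfl)
    · obtain ⟨l, rfl⟩ := Nat.exists_eq_add_of_le' hk
      have h := exists_card_add_seventySix (l + 1)
      rwa [show 74 * (l + 1) + 76 = 74 * (l + 2) + 2 by ring] at h
    · obtain ⟨l, rfl⟩ := Nat.exists_eq_add_of_le' hk
      have h := exists_card_add_hundredFiftyTwo l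
      rwa [show 74 * l + 152 = 74 * (l + 2) + 4 by ring] at h
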